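/- **Setting.** Let $N\ge 1$ and $0<\delta<1$. In each round a player and an adversary, knowing the outcomes of all previous rounds, choose a distribution on $\{1,\dots,N\}$ and a distribution on $[-1,1]^N$; then $I$ and $q$ are drawn from them, independently given the past. Put $r=q_I\mathbb 1-q$. The number $T\ge1$ of rounds is geometric with mean $1/\delta$ and independent of the play; the regret is $R(a,p)=\mathbb E\big[\sum_{\tau\le T}(q_\tau)_{I_\tau}-\min_i\sum_{\tau\le T}(q_\tau)_i\big]$. For an adversary $a$ or a player $p$ let $v_a(x)=\inf_p\mathbb E\max_i(x_i+\sum_{\tau\le T}r_{\tau,i})$ and $v_p(x)=\sup_a\mathbb E\max_i(x_i+\sum_{\tau\le T}r_{\tau,i})$, where strategies that depend on the cumulative regret see $x+\sum r$. For $\kappa>0$ and $t<0$ let $\varphi_\kappa(x,t)=(2\pi\sigma^2)^{-N/2}\int_{\mathbb R^N}e^{-\|y\|^2/2\sigma^2}\max_k(x_k-y_k)\,dy$ with $\sigma^2=-2\kappa t$, and $\hat\varphi_\kappa(x)=e^\delta\int_{-\infty}^{-\delta}e^t\varphi_\kappa(x,t)\,dt$. Let $Y$ be a standard Gaussian vector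 in $\mathbb R^N$, $M_N=\mathbb E\max_iY_i$, $\operatorname{erfc}(z)=\frac2{\sqrt\pi}\int_z^\infty e^{-s^2}ds$. Let $\kappa_s$ be $\frac{1-\delta}\delta$ for $N=2$, $\frac{1-\delta}\delta(\frac12+\frac1{2N})$ for $N$ odd, $\frac{1-\delta}\delta(\frac12+\frac1{2N-2})$ otherwise, and $\kappa_u=\frac{1-\delta}\delta$. Put $\hat u^h=\hat\varphi_{\kappa_s}-\sqrt{2\kappa_s\delta}\,M_N$ and $\hat w^h=\hat\varphi_{\kappa_u}+\sqrt{2\kappa_u\delta}\,M_N$. The *heat adversary* $a^h$ draws $q$ in every round uniformly from the $q\in\{\pm1\}^N$ with $\sum_iq_i=\pm1$ ($N$ odd) or $\sum_iq_i=0$ ($N$ even). The *heat player* $p^h$ follows expert $i$ with probability $\partial_i\hat w^h(x)$ when the cumulative regret is $x$. *Error terms.* Say that $K_3$ is admissible for $\kappa$ if $|D^3\varphi_\kappa(y,t)[q,q,q]|\le K_3/|t|$ for all $t<0$, $y\in\mathbb R^N$, $q\in[-1,1]^N$, and that $K_4$ is admissible for $\kappa$ if $|D^4\varphi_\kappa(y,t)[q,q,q,q]|\le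 K_4/|t|^{3/2}$ for all $t<0$, $y\in\mathbb R^N$, $q\in\{\pm1\}^N$. Let $E_{\hat u^h}$ be either $\frac{1-\delta}{6\delta}K_3(1+\log\frac1\delta)$ or $\frac{1-\delta}{24\delta}K_4\big(\frac2{\sqrt\delta}-2e^\delta\sqrt\pi\operatorname{erfc}\sqrt\delta\big)$ for any $K_3$, $K_4$ admissible for $\kappa_s$, and let $E_{\hat w^h}=\frac{1-\delta}{6\delta}K_3(1+\log\frac1\delta)$ for any $K_3$ admissible for $\kappa_u$. **Theorem.** 1. (Orders.) There is an absolute constant $C>0$ such that for all $N\ge1$ and $\kappa>0$ there are admissible $K_3\le C\kappa^{-1}\sqrt N$ and $K_4\le C\kappa^{-3/2}N\sqrt N$, and such that for all $N\ge1$ and $0<\delta<1$ the error terms can be chosen with $E_{\hat u^h}\le C\min\{N\sqrt N,\ \sqrt N(1+\log\frac1\delta)\}$ and $E_{\hat w^h}+2\le C\sqrt N(1+\log\frac1\delta)$. 2. (Lower bound.) For all $N\ge 1$, $0<\delta<1$ and every such $E_{\hat u^h}$: the infimum defining $v_{a^h}(x)$ is finite, $\hat u^h(x)-E_{\hat u^h}\le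 v_{a^h}(x)$ and $\hat u^h(x)-E_{\hat u^h}\le\delta\max_ix_i+(1-\delta)v_{a^h}(x)$ for all $x$; and for every player $p$ $$\sqrt{2\kappa_s}\,M_N\,e^\delta\tfrac{\sqrt\pi}2\operatorname{erfc}(\sqrt\delta)-E_{\hat u^h}\le R(a^h,p).$$ 3. (Upper bound.) For all $N\ge 1$, $0<\delta<1$: $\hat w^h$ is differentiable, its gradient is a probability vector, so that $p^h$ exists and is unique, and the supremum defining $v_{p^h}(x)$ is finite. For every such $E_{\hat w^h}$ and all $x$, $v_{p^h}(x)\le\hat w^h(x)+E_{\hat w^h}+2$ and $\delta\max_ix_i+(1-\delta)v_{p^h}(x)\le\hat w^h(x)+E_{\hat w^h}$; and with $B=\sqrt{\tfrac{2(1-\delta)}\delta}\,M_N\big(e^\delta\tfrac{\sqrt\pi}2\operatorname{erfc}(\sqrt\delta)+2\sqrt\delta\big)$, for every adversary $a$, $$R(a,p^h)\le B+E_{\hat w^h}+2\qquad\text{and}\qquad(1-\delta)R(a,p^h)\le B+E_{\hat w^h}.$$ (The quantity $\delta\max_ix_i+(1-\delta)v(x)$ is the value of the game in which the decision to stop is taken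 before each round, that is, with $T-1$ rounds in place of $T$; the first forms, with the summand $2$, are for the game with $T$ rounds.) 4. (Order of the lower bound.) There is an absolute constant $c>0$ such that for every $N\ge1$ and all sufficiently small $\delta>0$ (depending on $N$), $R(a^h,p)\ge c\sqrt{\log N/\delta}$ for every player $p$. 5. (Asymptotic optimality for $N=2$.) For $N=2$, as $\delta\to0$, each of $\hat u^h(0)$, $\hat w^h(0)$, $\inf_pR(a^h,p)$, $\sup_aR(a,p^h)$ and the minimax regret $\inf_p\sup_aR(a,p)$, multiplied by $\sqrt{2\delta}$, tends to $1$. -/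

import Mathlib

open MeasureTheory ProbabilityTheory Filter Topology

namespace Experts

/-! ### The game -/

/-- Outcome of one round: the loss vector `q` and the index `I` of the expert that was followed. -/
abbrev Round (N : ℕ) : Type := (Fin N → ℝ) × Fin N

/-- The outcomes of `t` completed rounds. -/
abbrev History (N t : ℕ) : Type := Fin t → Round N

/-- The hypercube `[-1,1]^N` of admissible losses. -/
def cube (N : ℕ) : Set (Fin N → ℝ) := {q | ∀ i, |q i| ≤ 1}

/-- A player strategy: after `t` rounds, a distribution on the experts which depends (measurably)
on the history. -/
structure Player (N : ℕ) where
  kernel : ∀ t : ℕ, Kernel (History N t) (Fin N)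
  markov : ∀ t, IsMarkovKernel (kernel t)

/-- An adversary strategy: after `t` rounds, a distribution on the hypercube which depends
(measurably) on the history. -/
structure Adversary (N : ℕ) where
  kernel : ∀ t : ℕ, Kernel (History N t) (Fin N → ℝ)
  markov : ∀ t, IsMarkovKernel (kernel t)
  mem_cube : ∀ t h, ∀ᵐ q ∂(kernel t h), q ∈ cube N

/-- The joint law of the first `t` rounds: in each round `q` and `I` are drawn
independently conditioned on the history. -/
noncomputable def law {N : ℕ} (p : Player N) (a : Adversary N) : ∀ t : ℕ, Measure (History N t)
  | 0 => Measure.dirac Fin.elim0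
  | t + 1 => (law p a t ⊗ₘ (a.kernel t ×ₖ p.kernel t)).map
      (fun z => Fin.snoc (α := fun _ => Round N) z.1 z.2)

/-- The regret vector `∑ τ, (q_{I_τ, τ} 𝟙 - q_τ)` accumulated over a history. -/
def cumRegret {N t : ℕ} (h : History N t) : Fin N → ℝ :=
  fun i => ∑ τ, ((h τ).1 (h τ).2 - (h τ).1 i)

/-- The fixed horizon regret `R_T(p,a)`. -/
noncomputable def fixedRegret {N : ℕ} (p : Player N) (a : Adversary N) (T : ℕ) : ℝ :=
  ∫ h, ((∑ τ, (h τ).1 (h τ).2) - ⨅ i, ∑ τ, (h τ).1 i) ∂(law p a T)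

/-- The regret `R(p,a)` with geometric stopping: the number of rounds `T ∈ {1, 2, …}` is
independent of the play and `P (T = n + 1) = δ (1 - δ) ^ n`, so that `T` has mean `1 / δ`. -/
noncomputable def regret {N : ℕ} (δ : ℝ) (p : Player N) (a : Adversary N) : ℝ :=
  ∑' n : ℕ, δ * (1 - δ) ^ n * fixedRegret p a (n + 1)

/-- `E max_i (x_i + ∑_{τ ≤ T} r_{τ,i})`: the expected regret after `T` rounds of a game that starts
with cumulative regret `x`. -/
noncomputable def fixedRegretFrom {N : ℕ} (p : Player N) (a : Adversary N) (x : Fin N → ℝ)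
    (T : ℕ) : ℝ :=
  ∫ h, (⨆ i, (x i + cumRegret h i)) ∂(law p a T)

/-- `E_{G,p,a} max_i (x_i + ∑_{τ ≤ T} r_{τ,i})` with `T` geometric as in `regret`. -/
noncomputable def regretFrom {N : ℕ} (δ : ℝ) (p : Player N) (a : Adversary N) (x : Fin N → ℝ) : ℝ :=
  ∑' n : ℕ, δ * (1 - δ) ^ n * fixedRegretFrom p a x (n + 1)

/-- A player whose choice depends only on the current cumulative regret. -/
structure MarkovPlayer (N : ℕ) where
  kernel : Kernel (Fin N → ℝ) (Fin N)
  markov : IsMarkovKernel kernel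

theorem measurable_cumRegret {N t : ℕ} (x : Fin N → ℝ) :
    Measurable (fun h : History N t => x + cumRegret h) := by
  refine measurable_const.add (measurable_pi_lambda _ fun i => ?_)
  refine Finset.measurable_sum _ fun τ _ => Measurable.sub ?_ ?_
  · have h1 : Measurable (fun z : Round N => z.1 z.2) :=
      measurable_from_prod_countable_left fun k => measurable_pi_apply k
    exact h1.comp (measurable_pi_apply τ)
  · exact (measurable_pi_apply i).comp (measurable_fst.comp (measurable_pi_apply τ))

/-- The strategy of a Markov player in a game that starts with cumulative regret `x`. -/
noncomputable def MarkovPlayer.toPlayer {N : ℕ} (p : MarkovPlayer N) (x : Fin N → ℝ) :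
    Player N where
  kernel t := p.kernel.comap (fun h : History N t => x + cumRegret h) (measurable_cumRegret x)
  markov t := by
    have := p.markov
    infer_instance

/-- The value function of a (history independent) adversary: the player behaves optimally. -/
noncomputable def adversaryValue {N : ℕ} (δ : ℝ) (a : Adversary N) (x : Fin N → ℝ) : ℝ :=
  ⨅ p : Player N, regretFrom δ p a x

/-- The value function of a Markov player: the adversary behaves optimally. -/
noncomputable def playerValue {N : ℕ} (δ : ℝ) (p : MarkovPlayer N) (x : Fin N → ℝ) : ℝ :=
  ⨆ a : Adversary N, regretFrom δ (p.toPlayer x) a x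

/-! ### The heat adversary -/

/-- Vectors of signs with sum `± 1` (for `N` odd) or `0` (for `N` even). -/
def balancedSigns (N : ℕ) : Set (Fin N → ℝ) :=
  {q | (∀ i, q i = 1 ∨ q i = -1) ∧
    ((Odd N ∧ (∑ i, q i = 1 ∨ ∑ i, q i = -1)) ∨ (Even N ∧ ∑ i, q i = 0))}

theorem balancedSigns_finite (N : ℕ) : (balancedSigns N).Finite := by
  refine (Set.Finite.pi' (t := fun _ : Fin N => ({1, -1} : Set ℝ))
    fun _ => Set.toFinite _).subset ?_
  intro q hq i
  simpa using hq.1 i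

theorem balancedSigns_nonempty (N : ℕ) : (balancedSigns N).Nonempty := by
  have hs : ∑ i : Fin N, ((-1 : ℝ)) ^ (i : ℕ) = if Even N then 0 else 1 := by
    rw [Fin.sum_univ_eq_sum_range (fun i => (-1 : ℝ) ^ i), neg_one_geom_sum]
  refine ⟨fun i => (-1) ^ (i : ℕ), fun i => neg_one_pow_eq_or ℝ _, ?_⟩
  rcases Nat.even_or_odd N with h | h
  · right
    exact ⟨h, by simpa [h] using hs⟩
  · left
    exact ⟨h, Or.inl (by simpa [Nat.not_even_iff_odd.2 h] using hs)⟩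

theorem balancedSigns_subset_cube (N : ℕ) : balancedSigns N ⊆ cube N := by
  intro q hq i
  rcases hq.1 i with h | h <;> simp [h]

/-- The heat adversary `a^h`: in every round `q` is uniform on the balanced sign vectors. -/
noncomputable def heatAdversary (N : ℕ) : Adversary N where
  kernel t := Kernel.const _ (uniformOn (balancedSigns N))
  markov t := by
    have := isProbabilityMeasure_uniformOn (balancedSigns_finite N) (balancedSigns_nonempty N)
    infer_instance
  mem_cube t h := by
    rw [Kernel.const_apply]
    refine measure_mono_null
      (Set.compl_subset_compl.2 (balancedSigns_subset_cube N) :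
        (cube N)ᶜ ⊆ (balancedSigns N)ᶜ) ?_
    rw [uniformOn_eq_zero_iff (balancedSigns_finite N), Set.inter_compl_self]

/-! ### Heat potentials -/

/-- `E max_i Y_i` for a standard Gaussian vector `Y` in `ℝ^N`. -/
noncomputable def gaussMax (N : ℕ) : ℝ :=
  ∫ y : Fin N → ℝ, (⨆ i, y i) ∂(Measure.pi fun _ => gaussianReal 0 1)

/-- The complementary error function. -/
noncomputable def erfc (z : ℝ) : ℝ :=
  2 / √Real.pi * ∫ s in Set.Ioi z, Real.exp (-s ^ 2)

/-- The heat potential `φ(x,t)`, `t < 0`, with diffusion factor `κ`; here `σ² = -2 κ t`. -/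
noncomputable def heat {N : ℕ} (κ : ℝ) (x : Fin N → ℝ) (t : ℝ) : ℝ :=
  (2 * Real.pi * (-2 * κ * t)) ^ (-(N : ℝ) / 2) *
    ∫ y : Fin N → ℝ, Real.exp (-(∑ i, y i ^ 2) / (2 * (-2 * κ * t))) * ⨆ k, (x k - y k)

/-- The Laplace transform `e^δ ∫_{-∞}^{-δ} e^t φ(x,t) dt`. -/
noncomputable def heatHat {N : ℕ} (δ κ : ℝ) (x : Fin N → ℝ) : ℝ :=
  Real.exp δ * ∫ t in Set.Iic (-δ), Real.exp t * heat κ x t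

/-- The constant `C^φ = √(2κδ) E max_i Y_i`. -/
noncomputable def heatConst (N : ℕ) (δ κ : ℝ) : ℝ := √(2 * κ * δ) * gaussMax N

open Classical in
/-- The diffusion factor `κ_s` of the lower bound. -/
noncomputable def kappaS (N : ℕ) (δ : ℝ) : ℝ :=
  if N = 2 then (1 - δ) / δ
  else if Odd N then (1 - δ) / δ * (1 / 2 + 1 / (2 * (N : ℝ)))
  else (1 - δ) / δ * (1 / 2 + 1 / (2 * (N : ℝ) - 2))

/-- The diffusion factor of the upper bound. -/
noncomputable def kappaU (δ : ℝ) : ℝ := (1 - δ) / δ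

/-- The lower bound potential `û^h`. -/
noncomputable def heatLower {N : ℕ} (δ : ℝ) (x : Fin N → ℝ) : ℝ :=
  heatHat δ (kappaS N δ) x - heatConst N δ (kappaS N δ)

/-- The upper bound potential `ŵ^h`. -/
noncomputable def heatUpper {N : ℕ} (δ : ℝ) (x : Fin N → ℝ) : ℝ :=
  heatHat δ (kappaU δ) x + heatConst N δ (kappaU δ)

/-- `p` is the heat player `p^h = ∇ŵ^h`: the potential is differentiable and the player follows
expert `i` with probability `∂_i ŵ^h(x)` when the cumulative regret is `x`. -/
def IsHeatPlayer {N : ℕ} (δ : ℝ) (p : MarkovPlayer N) : Prop :=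
  ∀ x : Fin N → ℝ, HasFDerivAt (heatUpper δ)
    (∑ i, (p.kernel x).real {i} • (ContinuousLinearMap.proj i : (Fin N → ℝ) →L[ℝ] ℝ)) x

/-! ### Error terms -/

/-- `|D³φ(y,t)[q,q,q]| ≤ K / |t|` for all `t < 0`, all `y` and all `q` in the hypercube. -/
def ThirdBound (N : ℕ) (κ K : ℝ) : Prop :=
  ∀ t < 0, ∀ y : Fin N → ℝ, ∀ q ∈ cube N,
    |iteratedFDeriv ℝ 3 (fun x => heat κ x t) y (fun _ => q)| ≤ K / |t|

/-- `|D⁴φ(y,t)[q,q,q,q]| ≤ K / |t|^{3/2}` for all `t < 0`, all `y` and all sign vectors `q`. -/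
def FourthBound (N : ℕ) (κ K : ℝ) : Prop :=
  ∀ t < 0, ∀ y q : Fin N → ℝ, (∀ i, q i = 1 ∨ q i = -1) →
    |iteratedFDeriv ℝ 4 (fun x => heat κ x t) y (fun _ => q)| ≤ K / |t| ^ (3 / 2 : ℝ)

/-- The error term obtained from third derivatives. -/
noncomputable def err3 (δ K : ℝ) : ℝ := (1 - δ) / (6 * δ) * K * (1 + Real.log (1 / δ))

/-- The error term obtained from fourth derivatives. -/
noncomputable def err4 (δ K : ℝ) : ℝ :=
  (1 - δ) / (24 * δ) * K * (2 / √δ - 2 * Real.exp δ * √Real.pi * erfc √δ)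

/-- `E` is an error term `E_{û^h}` of the lower bound: one obtained from any bound on the third
derivatives, or from any bound on the fourth derivatives, of `φ` with `κ = κ_s`. -/
def IsLowerErr (N : ℕ) (δ E : ℝ) : Prop :=
  (∃ K, ThirdBound N (kappaS N δ) K ∧ E = err3 δ K) ∨
    (∃ K, FourthBound N (kappaS N δ) K ∧ E = err4 δ K)

/-- `E` is an error term `E_{ŵ^h}` of the upper bound: one obtained from any bound on the third
derivatives of `φ` with `κ = (1 - δ) / δ`. -/
def IsUpperErr (N : ℕ) (δ E : ℝ) : Prop :=
  ∃ K, ThirdBound N (kappaU δ) K ∧ E = err3 δ K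

end Experts

/-!
The two potentials are built from one function, the Gaussian average `Φ(x) = E max_i (x_i + Y_i)`
(`Experts.maxAvg`): by scaling, `φ_κ(x, -s) = σ Φ(x / σ)` with `σ = √(2κs)` (`heat_eq`). The
gradient of `Φ` is the vector of probabilities that coordinate `i` leads in `x + Y`
(`hasFDerivAt_maxAvg`), hence a probability vector, and the same holds for the potentials. The
Hessian of `Φ` has nonpositive off-diagonal entries and vanishing column sums (`crossMean_nonpos`,
`sum_crossMean`), so on the cube its quadratic form is at most twice the Laplacian
(`dirDeriv_two_maxAvg_le`).

*Higher derivatives.* The third derivative in a direction `q` of the cube is `∑ i, q_i P_i''`,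
with `P_i''` the second derivative of the `i`-th leading probability along `q`. Given the other
coordinates, `P_i` is the Gaussian distribution function of a concave gap, and the distribution
function is increasing. Therefore `P_i'' ≤ 4 E[Y_i² + 1; i leads]` (`lineD2_leadInd_le`), and
these bounds sum to `O(√N)` (`sum_leadMoment_le`). Since the `P_i''` sum to zero, a one-sided
bound suffices (`abs_dirDeriv_three_maxAvg_le`). The fourth derivative is estimated by absolute
moments of the Gaussian variable `q ⬝ Y` (`abs_dirDeriv_four_maxAvg_le`).

*One round.* The potentials average `φ_κ(x, -s)` over times `s > δ` with density `e^{δ-s}`.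
Integration by parts in time and the heat equation give `κ Δφ̂ = φ̂ - φ_κ(·, -δ)`
(`expAvg_heatLaplacian`), where the Laplacian is averaged in the same way, and `φ_κ(·, -δ)` lies
between `max_i x_i` and `max_i x_i + √(2κδ) M_N`. In the Taylor expansion of `φ̂` over one round,
the first-order term vanishes: for the heat player because he follows the gradient, for the heat
adversary because the signs are symmetric. The second-order term is at most `Δφ̂` on the cube, and
for the balanced signs it equals a fixed multiple of `Δφ̂` on average, as their covariance is
exchangeable (`sum_balancedFinset_mul`). The constants `κ_u` and `κ_s` are those for which this
term, times `1 - δ`, equals `δ (φ̂ - φ_κ(·, -δ))`. This yields the inequalities `heatUpper_step`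
and `heatLower_step`, in which the maximum of the regrets is collected with the probability `δ` to
stop.

*The game.* The law of the game enters through `integral_law_succ`, the expectation of a potential
after one more round. With the weights `δ (1 - δ)^n` the one-round inequalities telescope
(`tsum_le_of_step`, `le_tsum_of_step`) to bounds on the game that may stop before each round
(`heatLower_sub_le`, `IsHeatPlayer.le_heatUpper_add`). One round raises the expected regret by at
most `2`, and against the heat adversary it does not decrease it, which gives the bounds for the
game with one round more. At the origin the potentials have the closed forms `heatLower_zero` and
`heatUpper_zero`; the growth `M_N ≥ c √(log N)` (`sqrt_log_le_gaussMax`) and `M_2 = 1 / √π`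
(`gaussMax_two`) then give the orders of magnitude and the limits for two experts.
-/

namespace Experts

/-! ### Tail integrals and the complementary error function -/

theorem setIntegral_Ioi_eq_sub {f : ℝ → ℝ} (hf : Integrable f) (a z : ℝ) :
    ∫ s in Set.Ioi z, f s = (∫ s in Set.Ioi a, f s) - ∫ s in a..z, f s := by
  have := intervalIntegral.integral_interval_add_Ioi (a := a) (b := z) (f := f)
    hf.integrableOn hf.integrableOn
  linarith

theorem hasDerivAt_setIntegral_Ioi {f : ℝ → ℝ} (hf : Integrable f) (hc : Continuous f) (z : ℝ) :
    HasDerivAt (fun z => ∫ s in Set.Ioi z, f s) (-f z) z := by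
  have h1 : (fun z => ∫ s in Set.Ioi z, f s)
      = fun z => (∫ s in Set.Ioi 0, f s) - ∫ s in (0 : ℝ)..z, f s := by
    ext z
    exact setIntegral_Ioi_eq_sub hf 0 z
  rw [h1]
  exact (intervalIntegral.integral_hasDerivAt_right hf.intervalIntegrable
    hc.stronglyMeasurable.stronglyMeasurableAtFilter hc.continuousAt).const_sub _

theorem tendsto_setIntegral_Ioi_atTop {f : ℝ → ℝ} (hf : Integrable f) :
    Tendsto (fun z => ∫ s in Set.Ioi z, f s) atTop (𝓝 0) := by
  have h1 : (fun z => ∫ s in Set.Ioi z, f s)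
      = fun z => (∫ s in Set.Ioi 0, f s) - ∫ s in (0 : ℝ)..z, f s := by
    ext z
    exact setIntegral_Ioi_eq_sub hf 0 z
  rw [h1]
  have h2 := (tendsto_const_nhds (x := ∫ s in Set.Ioi 0, f s)).sub
    (intervalIntegral_tendsto_integral_Ioi 0 hf.integrableOn tendsto_id)
  rwa [sub_self] at h2

theorem integrable_exp_neg_sq : Integrable fun s : ℝ => Real.exp (-s ^ 2) := by
  simpa using integrable_exp_neg_mul_sq (b := 1) one_pos

theorem hasDerivAt_erfc (z : ℝ) :
    HasDerivAt erfc (-(2 / √Real.pi * Real.exp (-z ^ 2))) z := by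
  have := (hasDerivAt_setIntegral_Ioi integrable_exp_neg_sq (by fun_prop) z).const_mul
    (2 / √Real.pi)
  rw [mul_neg] at this
  exact this

theorem tendsto_erfc_atTop : Tendsto erfc atTop (𝓝 0) := by
  have := (tendsto_setIntegral_Ioi_atTop integrable_exp_neg_sq).const_mul (2 / √Real.pi)
  rw [mul_zero] at this
  exact this

theorem erfc_zero : erfc 0 = 1 := by
  have h := integral_gaussian_Ioi 1
  simp only [neg_mul, one_mul, div_one] at h
  rw [erfc, h]
  have : √Real.pi ≠ 0 := by positivity
  field_simp

theorem erfc_nonneg (z : ℝ) : 0 ≤ erfc z :=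
  mul_nonneg (by positivity) (integral_nonneg fun _ => (Real.exp_pos _).le)

theorem hasDerivAt_erfc_sqrt {s : ℝ} (hs : 0 < s) :
    HasDerivAt (fun s => erfc √s) (-(Real.exp (-s) / (√Real.pi * √s))) s := by
  have h := (hasDerivAt_erfc √s).comp s ((hasDerivAt_id s).sqrt hs.ne')
  have h2 : √s ^ 2 = s := Real.sq_sqrt hs.le
  refine h.congr_deriv ?_
  have : √s ≠ 0 := by positivity
  have : √Real.pi ≠ 0 := by positivity
  rw [h2, id]
  field_simp

theorem tendsto_erfc_sqrt_nhdsGT_zero : Tendsto (fun δ => erfc √δ) (𝓝[>] 0) (𝓝 1) := by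
  have h : ContinuousAt (fun δ => erfc √δ) 0 :=
    ContinuousAt.comp (g := erfc) (hasDerivAt_erfc _).continuousAt Real.continuous_sqrt.continuousAt
  have := h.tendsto
  simp only [Real.sqrt_zero, erfc_zero] at this
  exact this.mono_left nhdsWithin_le_nhds

/-! ### Exponential averages of powers -/

theorem integrableOn_exp_neg_Ioi (δ : ℝ) :
    IntegrableOn (fun s => Real.exp (-s)) (Set.Ioi δ) := by
  simpa using exp_neg_integrableOn_Ioi δ one_pos

theorem tendsto_exp_neg_mul_sqrt : Tendsto (fun s => Real.exp (-s) * √s) atTop (𝓝 0) := by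
  have h := Real.tendsto_pow_mul_exp_neg_atTop_nhds_zero 1
  refine tendsto_of_tendsto_of_tendsto_of_le_of_le' tendsto_const_nhds h
    (Eventually.of_forall fun s => by positivity) ?_
  filter_upwards [eventually_ge_atTop 1] with s hs
  rw [mul_comm]
  gcongr
  rw [pow_one]
  rw [Real.sqrt_le_left (by linarith)]
  nlinarith

theorem integral_exp_neg_Ioi' (δ : ℝ) :
    Real.exp δ * ∫ s in Set.Ioi δ, Real.exp (-s) = 1 := by
  rw [integral_exp_neg_Ioi, ← Real.exp_add, add_neg_cancel, Real.exp_zero]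

/-- `∫_δ^∞ e^{-s} √s ds`, by parts. -/
theorem integral_exp_neg_mul_sqrt {δ : ℝ} (hδ : 0 < δ) :
    IntegrableOn (fun s => Real.exp (-s) * √s) (Set.Ioi δ) ∧
    ∫ s in Set.Ioi δ, Real.exp (-s) * √s
      = Real.exp (-δ) * √δ + √Real.pi / 2 * erfc √δ := by
  have hd : ∀ s ∈ Set.Ici δ, HasDerivAt
      (fun s => -(Real.exp (-s) * √s) - √Real.pi / 2 * erfc √s) (Real.exp (-s) * √s) s := by
    intro s hs
    have hs0 : 0 < s := lt_of_lt_of_le hδ hs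
    have h1 := (((hasDerivAt_id s).neg.exp.mul ((hasDerivAt_id s).sqrt hs0.ne')).neg).sub
      ((hasDerivAt_erfc_sqrt hs0).const_mul (√Real.pi / 2))
    refine h1.congr_deriv ?_
    have h2 : √s ≠ 0 := by positivity
    have h3 : √Real.pi ≠ 0 := by positivity
    simp only [Pi.neg_apply, id]
    field_simp
    ring
  have ht : Tendsto (fun s => -(Real.exp (-s) * √s) - √Real.pi / 2 * erfc √s) atTop (𝓝 0) := by
    have := tendsto_exp_neg_mul_sqrt.neg.sub
      ((tendsto_erfc_atTop.comp Real.tendsto_sqrt_atTop).const_mul (√Real.pi / 2))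
    simpa using this
  have hp : ∀ s ∈ Set.Ioi δ, 0 ≤ Real.exp (-s) * √s := fun s _ => by positivity
  refine ⟨integrableOn_Ioi_deriv_of_nonneg' hd hp ht, ?_⟩
  rw [integral_Ioi_of_hasDerivAt_of_nonneg' hd hp ht]
  ring

/-- `∫_δ^∞ e^{-s} s^{-3/2} ds`, by parts. -/
theorem integral_exp_neg_div_rpow {δ : ℝ} (hδ : 0 < δ) :
    IntegrableOn (fun s => Real.exp (-s) * (1 / s ^ (3 / 2 : ℝ))) (Set.Ioi δ) ∧
    Real.exp δ * ∫ s in Set.Ioi δ, Real.exp (-s) * (1 / s ^ (3 / 2 : ℝ))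
      = 2 / √δ - 2 * Real.exp δ * √Real.pi * erfc √δ := by
  have hd : ∀ s ∈ Set.Ici δ, HasDerivAt
      (fun s => -(2 * (Real.exp (-s) * (√s)⁻¹)) + 2 * √Real.pi * erfc √s)
      (Real.exp (-s) * (1 / s ^ (3 / 2 : ℝ))) s := by
    intro s hs
    have hs0 : 0 < s := lt_of_lt_of_le hδ hs
    have h2 : √s ≠ 0 := by positivity
    have h3 : √Real.pi ≠ 0 := by positivity
    have h1 := ((((hasDerivAt_id s).neg.exp.mul
      (((hasDerivAt_id s).sqrt hs0.ne').inv h2)).const_mul 2).neg).add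
      ((hasDerivAt_erfc_sqrt hs0).const_mul (2 * √Real.pi))
    refine h1.congr_deriv ?_
    have h4 : s ^ (3 / 2 : ℝ) = √s ^ 3 := by
      rw [Real.sqrt_eq_rpow, ← Real.rpow_natCast, ← Real.rpow_mul hs0.le]
      norm_num
    rw [h4]
    simp only [Pi.neg_apply, id, Pi.inv_apply]
    field_simp
    ring
  have ht : Tendsto (fun s => -(2 * (Real.exp (-s) * (√s)⁻¹)) + 2 * √Real.pi * erfc √s)
      atTop (𝓝 0) := by
    have h5 : Tendsto (fun s => Real.exp (-s) * (√s)⁻¹) atTop (𝓝 (0 * 0)) :=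
      Real.tendsto_exp_neg_atTop_nhds_zero.mul
        (tendsto_inv_atTop_zero.comp Real.tendsto_sqrt_atTop)
    have := ((h5.const_mul 2).neg).add
      ((tendsto_erfc_atTop.comp Real.tendsto_sqrt_atTop).const_mul (2 * √Real.pi))
    simpa using this
  have hp : ∀ s ∈ Set.Ioi δ, 0 ≤ Real.exp (-s) * (1 / s ^ (3 / 2 : ℝ)) := fun s hs => by
    have : 0 < s := lt_trans hδ hs
    positivity
  refine ⟨integrableOn_Ioi_deriv_of_nonneg' hd hp ht, ?_⟩
  rw [integral_Ioi_of_hasDerivAt_of_nonneg' hd hp ht]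
  have : Real.exp δ * Real.exp (-δ) = 1 := by rw [← Real.exp_add, add_neg_cancel, Real.exp_zero]
  linear_combination (2 * (√δ)⁻¹) * this

theorem integrableOn_exp_neg_div {δ : ℝ} (hδ : 0 < δ) :
    IntegrableOn (fun s => Real.exp (-s) * (1 / s)) (Set.Ioi δ) := by
  refine Integrable.mono' ((integrableOn_exp_neg_Ioi δ).mul_const (1 / δ))
    (by fun_prop : Measurable fun s : ℝ => Real.exp (-s) * (1 / s)).aestronglyMeasurable ?_
  filter_upwards [ae_restrict_mem measurableSet_Ioi] with s hs
  have hs : δ < s := hs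
  have : 0 < s := hδ.trans hs
  rw [Real.norm_of_nonneg (by positivity)]
  gcongr

/-- The exponential integral: `e^δ ∫_δ^∞ e^{-s} s⁻¹ ds ≤ 1 + log (1 / δ)`. -/
theorem integral_exp_neg_div_le {δ : ℝ} (hδ : 0 < δ) (hδ1 : δ < 1) :
    Real.exp δ * ∫ s in Set.Ioi δ, Real.exp (-s) * (1 / s) ≤ 1 + Real.log (1 / δ) := by
  have hi := integrableOn_exp_neg_div hδ
  have hsplit : Set.Ioc δ 1 ∪ Set.Ioi 1 = Set.Ioi δ := Set.Ioc_union_Ioi_eq_Ioi hδ1.le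
  have hi1 : IntegrableOn (fun s => Real.exp (-s) * (1 / s)) (Set.Ioc δ 1) :=
    hi.mono_set (hsplit ▸ Set.subset_union_left)
  have hi2 : IntegrableOn (fun s => Real.exp (-s) * (1 / s)) (Set.Ioi 1) :=
    hi.mono_set (hsplit ▸ Set.subset_union_right)
  rw [← hsplit, setIntegral_union Set.Ioc_disjoint_Ioi_same measurableSet_Ioi hi1 hi2, mul_add]
  have h1 : Real.exp δ * ∫ s in Set.Ioc δ 1, Real.exp (-s) * (1 / s) ≤ Real.log (1 / δ) := by
    rw [← integral_const_mul, ← integral_one_div_of_pos hδ one_pos,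
      intervalIntegral.integral_of_le hδ1.le]
    refine setIntegral_mono_on (hi1.const_mul _) ?_ measurableSet_Ioc fun s hs => ?_
    · rw [← intervalIntegrable_iff_integrableOn_Ioc_of_le hδ1.le]
      refine ContinuousOn.intervalIntegrable fun s hs => ?_
      rw [Set.uIcc_of_le hδ1.le] at hs
      have : s ≠ 0 := (hδ.trans_le hs.1).ne'
      exact (continuousAt_const.div continuousAt_id this).continuousWithinAt
    · have : 0 < s := hδ.trans hs.1
      rw [← mul_assoc, ← Real.exp_add]
      have : Real.exp (δ + -s) ≤ 1 := Real.exp_le_one_iff.2 (by linarith [hs.1])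
      nlinarith [one_div_pos.2 ‹0 < s›]
  have h2 : Real.exp δ * ∫ s in Set.Ioi 1, Real.exp (-s) * (1 / s) ≤ 1 := by
    have : ∫ s in Set.Ioi 1, Real.exp (-s) * (1 / s) ≤ ∫ s in Set.Ioi (1 : ℝ), Real.exp (-s) := by
      refine setIntegral_mono_on hi2 (integrableOn_exp_neg_Ioi 1) measurableSet_Ioi fun s hs => ?_
      have hs : 1 < s := hs
      have : 1 / s ≤ 1 := by rw [div_le_one (by linarith)]; exact hs.le
      nlinarith [Real.exp_pos (-s)]
    rw [integral_exp_neg_Ioi] at this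
    calc _ ≤ Real.exp δ * Real.exp (-1) := by gcongr
      _ ≤ 1 := by rw [← Real.exp_add]; exact Real.exp_le_one_iff.2 (by linarith)
  linarith

/-! ### The standard Gaussian measure on `ℝ^N` -/

/-- The standard Gaussian measure on `ℝ^N`. -/
noncomputable abbrev stdNormal (N : ℕ) : Measure (Fin N → ℝ) := Measure.pi fun _ => gaussianReal 0 1

/-- The density of `stdNormal N`. -/
noncomputable def stdNormalPDF (N : ℕ) (y : Fin N → ℝ) : ℝ :=
  (2 * Real.pi) ^ (-(N : ℝ) / 2) * Real.exp (-(∑ i, y i ^ 2) / 2)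

theorem stdNormalPDF_nonneg {N : ℕ} (y : Fin N → ℝ) : 0 ≤ stdNormalPDF N y := by
  unfold stdNormalPDF; positivity

theorem stdNormalPDF_eq_prod {N : ℕ} (y : Fin N → ℝ) :
    stdNormalPDF N y = ∏ i, gaussianPDFReal 0 1 (y i) := by
  simp only [gaussianPDFReal, Finset.prod_mul_distrib, ← Real.exp_sum, Finset.prod_const,
    Finset.card_univ, Fintype.card_fin, stdNormalPDF, NNReal.coe_one, mul_one, sub_zero]
  congr 1
  · rw [Real.sqrt_eq_rpow, ← Real.rpow_neg (by positivity), ← Real.rpow_natCast,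
      ← Real.rpow_mul (by positivity)]
    congr 1
    ring
  · congr 1
    rw [← Finset.sum_neg_distrib, Finset.sum_div]

theorem measurable_stdNormalPDF (N : ℕ) : Measurable (stdNormalPDF N) := by
  unfold stdNormalPDF; fun_prop

theorem stdNormal_eq_withDensity (N : ℕ) :
    stdNormal N = volume.withDensity fun y => ENNReal.ofReal (stdNormalPDF N y) := by
  refine Measure.pi_eq fun s hs => ?_
  rw [withDensity_apply _ (MeasurableSet.univ_pi hs), volume_pi, Measure.restrict_pi_pi]
  simp only [stdNormalPDF_eq_prod]
  rw [← ofReal_integral_eq_lintegral_ofReal, integral_fintype_prod_eq_prod,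
    ENNReal.ofReal_prod_of_nonneg]
  · refine Finset.prod_congr rfl fun i _ => ?_
    rw [gaussianReal_apply_eq_integral _ one_ne_zero]
  · exact fun i _ => integral_nonneg fun _ => gaussianPDFReal_nonneg _ _ _
  · exact Integrable.fintype_prod fun i => (integrable_gaussianPDFReal 0 1).restrict
  · exact Eventually.of_forall fun y => Finset.prod_nonneg fun i _ => gaussianPDFReal_nonneg _ _ _

theorem integral_stdNormal {N : ℕ} (f : (Fin N → ℝ) → ℝ) :
    ∫ y, f y ∂stdNormal N = ∫ y, stdNormalPDF N y * f y := by
  rw [stdNormal_eq_withDensity, integral_withDensity_eq_integral_toReal_smul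
    (measurable_stdNormalPDF N).ennreal_ofReal (by simp)]
  simp only [ENNReal.toReal_ofReal (stdNormalPDF_nonneg _), smul_eq_mul]

/-- The Cameron–Martin formula. -/
theorem integral_stdNormal_add {N : ℕ} (f : (Fin N → ℝ) → ℝ) (v : Fin N → ℝ) :
    ∫ y, f (v + y) ∂stdNormal N
      = ∫ y, Real.exp (∑ i, v i * y i - (∑ i, v i ^ 2) / 2) * f y ∂stdNormal N := by
  rw [integral_stdNormal, integral_stdNormal,
    ← integral_add_left_eq_self (fun y => stdNormalPDF N y *
      (Real.exp (∑ i, v i * y i - (∑ i, v i ^ 2) / 2) * f y)) v]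
  congr 1
  ext y
  rw [← mul_assoc]
  congr 1
  simp only [stdNormalPDF, mul_assoc, ← Real.exp_add]
  congr 2
  simp only [Pi.add_apply, Finset.sum_div, ← Finset.sum_sub_distrib, ← Finset.sum_neg_distrib,
    ← Finset.sum_add_distrib]
  exact Finset.sum_congr rfl fun i _ => by ring

theorem integral_stdNormal_neg {N : ℕ} (f : (Fin N → ℝ) → ℝ) :
    ∫ y, f (-y) ∂stdNormal N = ∫ y, f y ∂stdNormal N := by
  rw [integral_stdNormal, integral_stdNormal, ← integral_neg_eq_self]
  simp [stdNormalPDF]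

theorem integrable_exp_mul_abs_gaussianReal (R : ℝ) :
    Integrable (fun y => Real.exp (R * |y|)) (gaussianReal 0 1) := by
  refine Integrable.mono' ((integrable_exp_mul_gaussianReal (μ := 0) (v := 1) R).add
    (integrable_exp_mul_gaussianReal (μ := 0) (v := 1) (-R))) (by fun_prop) ?_
  refine Eventually.of_forall fun y => ?_
  rw [Real.norm_of_nonneg (Real.exp_pos _).le]
  rcases abs_cases y with ⟨h, _⟩ | ⟨h, _⟩ <;> rw [h] <;> simp <;> positivity

theorem integrable_exp_mul_sum_abs {N : ℕ} (R : ℝ) :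
    Integrable (fun y : Fin N → ℝ => Real.exp (R * ∑ i, |y i|)) (stdNormal N) := by
  simp only [Finset.mul_sum, Real.exp_sum]
  exact Integrable.fintype_prod fun i => integrable_exp_mul_abs_gaussianReal R

theorem norm_le_sum_abs {N : ℕ} (y : Fin N → ℝ) : ‖y‖ ≤ ∑ i, |y i| :=
  (pi_norm_le_iff_of_nonneg (Finset.sum_nonneg fun _ _ => abs_nonneg _)).2 fun i =>
    Finset.single_le_sum (f := fun i => |y i|) (fun _ _ => abs_nonneg _) (Finset.mem_univ i)

theorem integrable_exp_mul_norm {N : ℕ} (R : ℝ) :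
    Integrable (fun y : Fin N → ℝ => Real.exp (R * ‖y‖)) (stdNormal N) := by
  refine Integrable.mono' (integrable_exp_mul_sum_abs |R|) (by fun_prop) ?_
  refine Eventually.of_forall fun y => ?_
  rw [Real.norm_of_nonneg (Real.exp_pos _).le]
  exact Real.exp_le_exp.2 ((mul_le_mul_of_nonneg_right (le_abs_self R) (norm_nonneg y)).trans
    (mul_le_mul_of_nonneg_left (norm_le_sum_abs y) (abs_nonneg R)))

/-- Functions of exponential growth are integrable against the Gaussian measure. -/
theorem integrable_stdNormal_of_le_exp {N : ℕ} {E : Type*} [NormedAddCommGroup E]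
    {f : (Fin N → ℝ) → E} (hf : AEStronglyMeasurable f (stdNormal N)) {A R : ℝ}
    (h : ∀ y, ‖f y‖ ≤ A * Real.exp (R * ‖y‖)) : Integrable f (stdNormal N) :=
  Integrable.mono' ((integrable_exp_mul_norm R).const_mul A) hf (Eventually.of_forall h)

theorem mgf_stdNormal {N : ℕ} (v : Fin N → ℝ) :
    ∫ y, Real.exp (∑ i, v i * y i) ∂stdNormal N = Real.exp ((∑ i, v i ^ 2) / 2) := by
  have h := integral_stdNormal_add (fun _ => 1) v
  simp only [integral_const, probReal_univ, smul_eq_mul, mul_one, sub_eq_add_neg, Real.exp_add,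
    integral_mul_const] at h
  rw [Real.exp_neg] at h
  field_simp at h
  exact h.symm

/-! ### Smoothness of Gaussian averages -/

/-- The linear form `x ↦ ∑ i, y i * x i`. -/
noncomputable def dotCLM {N : ℕ} (y : Fin N → ℝ) : (Fin N → ℝ) →L[ℝ] ℝ :=
  ∑ i, y i • ContinuousLinearMap.proj i

theorem dotCLM_apply {N : ℕ} (y x : Fin N → ℝ) : dotCLM y x = ∑ i, y i * x i := by
  simp [dotCLM]

theorem continuous_dotCLM {N : ℕ} : Continuous (dotCLM (N := N)) := by
  unfold dotCLM; fun_prop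

theorem sum_abs_le_mul_norm {N : ℕ} (y : Fin N → ℝ) : ∑ i, |y i| ≤ N * ‖y‖ := by
  calc ∑ i, |y i| ≤ ∑ _i : Fin N, ‖y‖ := Finset.sum_le_sum fun i _ => norm_le_pi_norm y i
    _ = N * ‖y‖ := by simp

theorem norm_dotCLM_le {N : ℕ} (y : Fin N → ℝ) : ‖dotCLM y‖ ≤ N * ‖y‖ := by
  refine ContinuousLinearMap.opNorm_le_bound _ (by positivity) fun x => ?_
  rw [dotCLM_apply, Real.norm_eq_abs]
  calc |∑ i, y i * x i| ≤ ∑ i, |y i| * ‖x‖ := by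
        refine (Finset.abs_sum_le_sum_abs _ _).trans (Finset.sum_le_sum fun i _ => ?_)
        rw [abs_mul]
        gcongr
        exact norm_le_pi_norm x i
    _ = (∑ i, |y i|) * ‖x‖ := by rw [Finset.sum_mul]
    _ ≤ N * ‖y‖ * ‖x‖ := by gcongr; exact sum_abs_le_mul_norm y

theorem le_exp_self (u : ℝ) : u ≤ Real.exp u := by linarith [Real.add_one_le_exp u]

/-- `f` has at most exponential growth. -/
def ExpGrowth {N : ℕ} {G : Type*} [NormedAddCommGroup G] (f : (Fin N → ℝ) → G) : Prop :=
  ∃ A R : ℝ, 0 ≤ A ∧ 0 ≤ R ∧ ∀ y, ‖f y‖ ≤ A * Real.exp (R * ‖y‖)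

section
variable {N : ℕ} {G : Type*} [NormedAddCommGroup G]

theorem ExpGrowth.integrable {f : (Fin N → ℝ) → G} (h : ExpGrowth f)
    (hf : AEStronglyMeasurable f (stdNormal N)) : Integrable f (stdNormal N) := by
  obtain ⟨A, R, -, -, h⟩ := h
  exact integrable_stdNormal_of_le_exp hf h

theorem ExpGrowth.of_bound {f : (Fin N → ℝ) → G} {A : ℝ} (h : ∀ y, ‖f y‖ ≤ A) :
    ExpGrowth f :=
  ⟨A, 0, (norm_nonneg _).trans (h 0), le_rfl, fun y => by simpa using h y⟩

theorem ExpGrowth.of_linear {f : (Fin N → ℝ) → G} {A B : ℝ} (hA : 0 ≤ A) (hB : 0 ≤ B)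
    (h : ∀ y, ‖f y‖ ≤ A + B * ‖y‖) : ExpGrowth f := by
  refine ⟨A + B, 1, by positivity, zero_le_one, fun y => (h y).trans ?_⟩
  rw [one_mul, add_mul]
  gcongr
  · exact le_mul_of_one_le_right hA (Real.one_le_exp (norm_nonneg y))
  · exact le_exp_self _

variable [NormedSpace ℝ G]

theorem ExpGrowth.smul {g : (Fin N → ℝ) → ℝ} {f : (Fin N → ℝ) → G}
    (hg : ExpGrowth g) (hf : ExpGrowth f) : ExpGrowth fun y => g y • f y := by
  obtain ⟨A, R, hA, hR, h⟩ := hg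
  obtain ⟨B, S, hB, hS, h'⟩ := hf
  refine ⟨A * B, R + S, by positivity, by positivity, fun y => ?_⟩
  rw [norm_smul, add_mul, Real.exp_add]
  calc _ ≤ (A * Real.exp (R * ‖y‖)) * (B * Real.exp (S * ‖y‖)) := by
        gcongr
        exacts [h y, h' y]
    _ = _ := by ring

theorem ExpGrowth.mul {g f : (Fin N → ℝ) → ℝ}
    (hg : ExpGrowth g) (hf : ExpGrowth f) : ExpGrowth fun y => g y * f y := hg.smul hf

theorem ExpGrowth.exp_dotCLM (x : Fin N → ℝ) :
    ExpGrowth fun y : Fin N → ℝ => Real.exp (dotCLM y x) := by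
  refine ⟨1, N * ‖x‖, zero_le_one, by positivity, fun y => ?_⟩
  rw [Real.norm_of_nonneg (Real.exp_pos _).le, one_mul]
  refine Real.exp_le_exp.2 ((le_abs_self _).trans (((dotCLM y).le_opNorm x).trans ?_))
  calc ‖dotCLM y‖ * ‖x‖ ≤ (N * ‖y‖) * ‖x‖ := by gcongr; exact norm_dotCLM_le y
    _ = _ := by ring

theorem ExpGrowth.dotCLM_smulRight {g : (Fin N → ℝ) → G} (hg : ExpGrowth g) :
    ExpGrowth fun y => (dotCLM y).smulRight (g y) := by
  obtain ⟨A, R, hA, hR, h⟩ := hg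
  refine ⟨N * A, R + 1, by positivity, by positivity, fun y => ?_⟩
  rw [ContinuousLinearMap.norm_smulRight_apply, add_mul, Real.exp_add, one_mul]
  calc ‖dotCLM y‖ * ‖g y‖ ≤ (N * Real.exp ‖y‖) * (A * Real.exp (R * ‖y‖)) := by
        gcongr
        · refine (norm_dotCLM_le y).trans ?_
          gcongr
          exact le_exp_self _
        · exact h y
    _ = _ := by ring

theorem aestronglyMeasurable_dotCLM_smulRight {g : (Fin N → ℝ) → G}
    (hm : AEStronglyMeasurable g (stdNormal N)) :
    AEStronglyMeasurable (fun y => (dotCLM y).smulRight (g y)) (stdNormal N) := by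
  have h : Continuous fun p : ((Fin N → ℝ) →L[ℝ] ℝ) × G => p.1.smulRight p.2 := by
    fun_prop
  exact h.comp_aestronglyMeasurable
    (continuous_dotCLM.aestronglyMeasurable.prodMk hm)

theorem hasFDerivAt_integral_exp_dotCLM {g : (Fin N → ℝ) → G}
    (hm : AEStronglyMeasurable g (stdNormal N)) (hg : ExpGrowth g) (x : Fin N → ℝ) :
    HasFDerivAt (fun x => ∫ y, Real.exp (dotCLM y x) • g y ∂stdNormal N)
      (∫ y, Real.exp (dotCLM y x) • (dotCLM y).smulRight (g y) ∂stdNormal N) x := by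
  have hc : ∀ x, Continuous fun y : Fin N → ℝ => Real.exp (dotCLM y x) := fun x =>
    Real.continuous_exp.comp (continuous_dotCLM.clm_apply continuous_const)
  have hm' := aestronglyMeasurable_dotCLM_smulRight hm
  obtain ⟨A, R, hA, hR, h⟩ := hg.dotCLM_smulRight
  refine hasFDerivAt_integral_of_dominated_of_fderiv_le
    (bound := fun y => Real.exp ((N * (‖x‖ + 1)) * ‖y‖) * (A * Real.exp (R * ‖y‖)))
    (F' := fun x y => Real.exp (dotCLM y x) • (dotCLM y).smulRight (g y))
    (Metric.ball_mem_nhds x one_pos)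
    (Eventually.of_forall fun x => (hc x).aestronglyMeasurable.smul hm)
    (((ExpGrowth.exp_dotCLM x).smul hg).integrable ((hc x).aestronglyMeasurable.smul hm))
    ((hc x).aestronglyMeasurable.smul hm') ?_ ?_ ?_
  · refine Eventually.of_forall fun y z hz => ?_
    rw [norm_smul, Real.norm_of_nonneg (Real.exp_pos _).le]
    gcongr
    · refine (le_abs_self _).trans (((dotCLM y).le_opNorm z).trans ?_)
      have hz' : ‖z‖ ≤ ‖x‖ + 1 := by
        rw [Metric.mem_ball, dist_eq_norm] at hz
        linarith [norm_le_norm_add_norm_sub' z x]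
      calc ‖dotCLM y‖ * ‖z‖ ≤ (N * ‖y‖) * (‖x‖ + 1) := by gcongr; exact norm_dotCLM_le y
        _ = _ := by ring
    · exact h y
  · have : ∀ y : Fin N → ℝ, Real.exp ((N * (‖x‖ + 1)) * ‖y‖) * (A * Real.exp (R * ‖y‖))
        = A * Real.exp ((N * (‖x‖ + 1) + R) * ‖y‖) := fun y => by
      rw [add_mul, Real.exp_add]; ring
    simp only [this]
    exact (integrable_exp_mul_norm _).const_mul A
  · refine Eventually.of_forall fun y z _ => ?_
    have := ((dotCLM y).hasFDerivAt (x := z)).exp.smul_const (g y)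
    refine this.congr_fderiv ?_
    ext v
    simp [smul_smul]

end

theorem contDiff_integral_exp_dotCLM {N : ℕ} (n : ℕ) {G : Type} [NormedAddCommGroup G]
    [NormedSpace ℝ G] {g : (Fin N → ℝ) → G} (hm : AEStronglyMeasurable g (stdNormal N))
    (hg : ExpGrowth g) :
    ContDiff ℝ n fun x => ∫ y, Real.exp (dotCLM y x) • g y ∂stdNormal N := by
  induction n generalizing G with
  | zero =>
    exact contDiff_zero.2 (continuous_iff_continuousAt.2 fun x =>
      (hasFDerivAt_integral_exp_dotCLM hm hg x).continuousAt)
  | succ n ih =>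
    push_cast
    rw [contDiff_succ_iff_hasFDerivAt]
    exact ⟨_, ih (aestronglyMeasurable_dotCLM_smulRight hm) hg.dotCLM_smulRight,
      fun x => hasFDerivAt_integral_exp_dotCLM hm hg x⟩

/-- The Gaussian average `E f (x + Y)`. -/
noncomputable def gaussAvg {N : ℕ} (f : (Fin N → ℝ) → ℝ) (x : Fin N → ℝ) : ℝ :=
  ∫ y, f (x + y) ∂stdNormal N

theorem gaussAvg_eq {N : ℕ} (f : (Fin N → ℝ) → ℝ) (x : Fin N → ℝ) :
    gaussAvg f x = Real.exp (-(∑ i, x i ^ 2) / 2) *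
      ∫ y, Real.exp (dotCLM y x) • f y ∂stdNormal N := by
  rw [gaussAvg, integral_stdNormal_add, ← integral_const_mul]
  congr 1
  ext y
  rw [smul_eq_mul, ← mul_assoc, ← Real.exp_add, dotCLM_apply]
  congr 2
  simp only [mul_comm (x _)]
  ring

theorem contDiff_gaussAvg {N : ℕ} (n : ℕ) {f : (Fin N → ℝ) → ℝ}
    (hm : AEStronglyMeasurable f (stdNormal N)) (hf : ExpGrowth f) :
    ContDiff ℝ n (gaussAvg f) := by
  have : gaussAvg f = fun x => Real.exp (-(∑ i, x i ^ 2) / 2) *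
      ∫ y, Real.exp (dotCLM y x) • f y ∂stdNormal N := by
    ext x
    exact gaussAvg_eq f x
  rw [this]
  refine ContDiff.mul (by fun_prop) (contDiff_integral_exp_dotCLM n hm hf)

/-! ### Derivatives along lines -/

/-- The `k`-th derivative of `f` at `x` in the direction `q`. -/
noncomputable def dirDeriv {N : ℕ} (k : ℕ) (f : (Fin N → ℝ) → ℝ) (x q : Fin N → ℝ) : ℝ :=
  iteratedFDeriv ℝ k f x fun _ => q

section
variable {N : ℕ} {f : (Fin N → ℝ) → ℝ}

theorem dirDeriv_zero (x q : Fin N → ℝ) : dirDeriv 0 f x q = f x := by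
  simp [dirDeriv]

theorem dirDeriv_one (x q : Fin N → ℝ) : dirDeriv 1 f x q = fderiv ℝ f x q := by
  simp [dirDeriv]

theorem hasDerivAt_line (x q : Fin N → ℝ) (s : ℝ) :
    HasDerivAt (fun s : ℝ => x + s • q) q s := by
  simpa using ((hasDerivAt_id s).smul_const q).const_add x

theorem hasDerivAt_dirDeriv {k : ℕ} (hf : ContDiff ℝ (k + 1 : ℕ) f) (x q : Fin N → ℝ) (s : ℝ) :
    HasDerivAt (fun s : ℝ => dirDeriv k f (x + s • q) q) (dirDeriv (k + 1) f (x + s • q) q) s := by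
  have h1 : DifferentiableAt ℝ (iteratedFDeriv ℝ k f) (x + s • q) :=
    (hf.differentiable_iteratedFDeriv (by exact_mod_cast Nat.lt_succ_self k)) _
  have h2 := h1.hasFDerivAt.comp_hasDerivAt s (hasDerivAt_line x q s)
  have h3 := ((ContinuousMultilinearMap.apply ℝ (fun _ : Fin k => Fin N → ℝ) ℝ
    (fun _ => q)).hasFDerivAt).comp_hasDerivAt s h2
  exact h3

/-- The `k`-th moment of `y ↦ q ⬝ y` for the tilted Gaussian average of `f (x + y)`. -/
noncomputable def tiltMoment (f : (Fin N → ℝ) → ℝ) (x q : Fin N → ℝ) (k : ℕ) (s : ℝ) : ℝ :=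
  ∫ y, Real.exp (s * dotCLM y q) * (dotCLM y q ^ k * f (x + y)) ∂stdNormal N

theorem ExpGrowth.dotCLM (q : Fin N → ℝ) : ExpGrowth fun y : Fin N → ℝ => dotCLM y q := by
  refine ExpGrowth.of_linear (A := 0) (B := N * ‖q‖) le_rfl (by positivity) fun y => ?_
  calc ‖Experts.dotCLM y q‖ ≤ ‖Experts.dotCLM y‖ * ‖q‖ := (Experts.dotCLM y).le_opNorm q
    _ ≤ N * ‖y‖ * ‖q‖ := by gcongr; exact norm_dotCLM_le y
    _ = _ := by ring

theorem ExpGrowth.pow {g : (Fin N → ℝ) → ℝ} (hg : ExpGrowth g) (k : ℕ) :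
    ExpGrowth fun y => g y ^ k := by
  induction k with
  | zero => exact ExpGrowth.of_bound (A := 1) fun y => by simp
  | succ k ih => simpa only [pow_succ] using ih.mul hg

theorem ExpGrowth.comp_add {G : Type*} [NormedAddCommGroup G] {g : (Fin N → ℝ) → G}
    (hg : ExpGrowth g) (x : Fin N → ℝ) : ExpGrowth fun y => g (x + y) := by
  obtain ⟨A, R, hA, hR, h⟩ := hg
  refine ⟨A * Real.exp (R * ‖x‖), R, by positivity, hR, fun y => (h _).trans ?_⟩
  rw [mul_assoc, ← Real.exp_add, ← mul_add]
  gcongr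
  exact norm_add_le x y

theorem measurable_dotCLM (q : Fin N → ℝ) : Measurable fun y : Fin N → ℝ => dotCLM y q :=
  (continuous_dotCLM.clm_apply continuous_const).measurable

theorem hasDerivAt_tiltMoment (hm : Measurable f) (hf : ExpGrowth f) (x q : Fin N → ℝ) (k : ℕ)
    (s : ℝ) : HasDerivAt (tiltMoment f x q k) (tiltMoment f x q (k + 1) s) s := by
  have hm' : Measurable fun y => dotCLM y q ^ k * f (x + y) :=
    ((measurable_dotCLM q).pow_const k).mul (hm.comp (measurable_const_add x))
  have hg : ExpGrowth fun y => dotCLM y q ^ k * f (x + y) :=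
    ((ExpGrowth.dotCLM q).pow k).mul (hf.comp_add x)
  have h1 := hasFDerivAt_integral_exp_dotCLM hm'.aestronglyMeasurable hg (0 + s • q)
  have h2 := h1.comp_hasDerivAt s (hasDerivAt_line 0 q s)
  have h3 : Integrable (fun y => Real.exp (dotCLM y (0 + s • q)) •
      (dotCLM y).smulRight (dotCLM y q ^ k * f (x + y))) (stdNormal N) := by
    refine ((ExpGrowth.exp_dotCLM _).smul hg.dotCLM_smulRight).integrable ?_
    exact ((Real.continuous_exp.comp
      (continuous_dotCLM.clm_apply continuous_const)).aestronglyMeasurable).smul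
      (aestronglyMeasurable_dotCLM_smulRight hm'.aestronglyMeasurable)
  rw [ContinuousLinearMap.integral_apply h3] at h2
  have h4 : ((fun z => ∫ y, Real.exp (dotCLM y z) • (dotCLM y q ^ k * f (x + y)) ∂stdNormal N) ∘
      fun s : ℝ => 0 + s • q) = tiltMoment f x q k := by
    ext s
    simp [tiltMoment]
  rw [h4] at h2
  refine h2.congr_deriv ?_
  simp only [tiltMoment, zero_add]
  congr 1
  ext y
  simp
  ring

theorem gaussAvg_line (f : (Fin N → ℝ) → ℝ) (x q : Fin N → ℝ) (s : ℝ) :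
    gaussAvg f (x + s • q)
      = Real.exp (-(s ^ 2 * ∑ i, q i ^ 2) / 2) * tiltMoment f x q 0 s := by
  have h : gaussAvg f (x + s • q) = gaussAvg (fun y => f (x + y)) (s • q) := by
    simp only [gaussAvg, add_assoc]
  rw [h, gaussAvg_eq]
  simp only [tiltMoment, Pi.smul_apply, smul_eq_mul, mul_pow, ← Finset.mul_sum, map_smul, pow_zero,
    one_mul]

theorem hasDerivAt_exp_neg_sq (c s : ℝ) :
    HasDerivAt (fun s => Real.exp (-(s ^ 2 * c) / 2))
      (-(s * c) * Real.exp (-(s ^ 2 * c) / 2)) s := by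
  have h := ((((hasDerivAt_pow 2 s).mul_const c).neg).div_const 2).exp
  refine h.congr_deriv ?_
  simp only [Pi.neg_apply]
  push_cast
  ring

/-- First derivative of `s ↦ gaussAvg f (x + s • q)`. -/
noncomputable def lineD1 (f : (Fin N → ℝ) → ℝ) (x q : Fin N → ℝ) (s : ℝ) : ℝ :=
  let c := ∑ i, q i ^ 2
  Real.exp (-(s ^ 2 * c) / 2) * (tiltMoment f x q 1 s - s * c * tiltMoment f x q 0 s)

/-- Second derivative of `s ↦ gaussAvg f (x + s • q)`. -/
noncomputable def lineD2 (f : (Fin N → ℝ) → ℝ) (x q : Fin N → ℝ) (s : ℝ) : ℝ :=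
  let c := ∑ i, q i ^ 2
  Real.exp (-(s ^ 2 * c) / 2) * (tiltMoment f x q 2 s - 2 * s * c * tiltMoment f x q 1 s
    + (s ^ 2 * c ^ 2 - c) * tiltMoment f x q 0 s)

/-- Third derivative of `s ↦ gaussAvg f (x + s • q)`. -/
noncomputable def lineD3 (f : (Fin N → ℝ) → ℝ) (x q : Fin N → ℝ) (s : ℝ) : ℝ :=
  let c := ∑ i, q i ^ 2
  Real.exp (-(s ^ 2 * c) / 2) * (tiltMoment f x q 3 s - 3 * s * c * tiltMoment f x q 2 s
    + (3 * s ^ 2 * c ^ 2 - 3 * c) * tiltMoment f x q 1 s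
    + (3 * s * c ^ 2 - s ^ 3 * c ^ 3) * tiltMoment f x q 0 s)

theorem hasDerivAt_gaussAvg_line (hm : Measurable f) (hf : ExpGrowth f) (x q : Fin N → ℝ)
    (s : ℝ) : HasDerivAt (fun s : ℝ => gaussAvg f (x + s • q)) (lineD1 f x q s) s := by
  simp only [gaussAvg_line]
  refine ((hasDerivAt_exp_neg_sq _ s).mul (hasDerivAt_tiltMoment hm hf x q 0 s)).congr_deriv ?_
  simp only [lineD1]
  ring

theorem hasDerivAt_lineD1 (hm : Measurable f) (hf : ExpGrowth f) (x q : Fin N → ℝ) (s : ℝ) :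
    HasDerivAt (lineD1 f x q) (lineD2 f x q s) s := by
  have h := (hasDerivAt_exp_neg_sq (∑ i, q i ^ 2) s).mul
    ((hasDerivAt_tiltMoment hm hf x q 1 s).sub
      (((hasDerivAt_id s).mul_const (∑ i, q i ^ 2)).mul (hasDerivAt_tiltMoment hm hf x q 0 s)))
  refine h.congr_deriv ?_
  simp only [lineD2, Pi.sub_apply, Pi.mul_apply, id]
  ring

theorem hasDerivAt_lineD2 (hm : Measurable f) (hf : ExpGrowth f) (x q : Fin N → ℝ) (s : ℝ) :
    HasDerivAt (lineD2 f x q) (lineD3 f x q s) s := by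
  have h := (hasDerivAt_exp_neg_sq (∑ i, q i ^ 2) s).mul
    (((hasDerivAt_tiltMoment hm hf x q 2 s).sub
      ((((hasDerivAt_id s).const_mul 2).mul_const (∑ i, q i ^ 2)).mul
        (hasDerivAt_tiltMoment hm hf x q 1 s))).add
      ((((hasDerivAt_pow 2 s).mul_const ((∑ i, q i ^ 2) ^ 2)).sub_const (∑ i, q i ^ 2)).mul
        (hasDerivAt_tiltMoment hm hf x q 0 s)))
  refine h.congr_deriv ?_
  simp only [lineD3, Pi.sub_apply, Pi.mul_apply, Pi.add_apply, id]
  push_cast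
  ring

end

/-! ### The maximum function and its leading coordinate -/

/-- The set where `i` is the first index attaining the maximum. -/
def leadSet {N : ℕ} (i : Fin N) : Set (Fin N → ℝ) :=
  {y | (∀ k, y k ≤ y i) ∧ ∀ k < i, y k < y i}

/-- The indicator function of `leadSet i`. -/
noncomputable def leadInd {N : ℕ} (i : Fin N) : (Fin N → ℝ) → ℝ := (leadSet i).indicator 1

section
variable {N : ℕ}

theorem measurableSet_leadSet (i : Fin N) : MeasurableSet (leadSet i) := by
  have h : leadSet i = (⋂ k, {y : Fin N → ℝ | y k ≤ y i}) ∩ ⋂ k, ⋂ _ : k < i, {y | y k < y i} := by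
    ext y
    simp [leadSet]
  rw [h]
  exact (MeasurableSet.iInter fun k =>
      measurableSet_le (measurable_pi_apply k) (measurable_pi_apply i)).inter
    (MeasurableSet.iInter fun k => MeasurableSet.iInter fun _ =>
      measurableSet_lt (measurable_pi_apply k) (measurable_pi_apply i))

theorem measurable_leadInd (i : Fin N) : Measurable (leadInd i) :=
  measurable_one.indicator (measurableSet_leadSet i)

theorem leadInd_nonneg (i : Fin N) (y : Fin N → ℝ) : 0 ≤ leadInd i y :=
  Set.indicator_nonneg (fun _ _ => zero_le_one) y

theorem leadInd_le_one (i : Fin N) (y : Fin N → ℝ) : leadInd i y ≤ 1 :=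
  Set.indicator_le_self' (fun _ _ => zero_le_one) y

theorem expGrowth_leadInd (i : Fin N) : ExpGrowth (leadInd i) :=
  ExpGrowth.of_bound (A := 1) fun y => by
    rw [Real.norm_of_nonneg (leadInd_nonneg i y)]
    exact leadInd_le_one i y

theorem le_ciSup_fin (y : Fin N → ℝ) (i : Fin N) : y i ≤ ⨆ k, y k :=
  le_ciSup (Set.finite_range y).bddAbove i

theorem measurable_ciSup_fin : Measurable fun y : Fin N → ℝ => ⨆ i, y i :=
  Measurable.iSup measurable_pi_apply

variable [NeZero N]

theorem exists_mem_leadSet (y : Fin N → ℝ) :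
    ∃ i, y ∈ leadSet i ∧ ∀ j, leadInd j y = if j = i then 1 else 0 := by
  classical
  have hne : (Finset.univ.filter fun i => ∀ k, y k ≤ y i).Nonempty := by
    obtain ⟨i, -, hi⟩ := Finset.exists_max_image Finset.univ y Finset.univ_nonempty
    exact ⟨i, by simpa using hi⟩
  set i := (Finset.univ.filter fun i => ∀ k, y k ≤ y i).min' hne with hi
  have h1 : ∀ k, y k ≤ y i := by
    have := Finset.min'_mem _ hne
    simpa using this
  have h2 : ∀ k < i, y k < y i := by
    intro k hk
    refine lt_of_le_of_ne (h1 k) fun he => ?_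
    have : i ≤ k := Finset.min'_le _ _ (by simpa [he] using h1)
    exact absurd this (not_le.2 hk)
  refine ⟨i, ⟨h1, h2⟩, fun j => ?_⟩
  rw [leadInd, Set.indicator_apply]
  split_ifs with hj hji hji
  · rfl
  · exfalso
    rcases lt_or_gt_of_ne hji with h | h
    · exact absurd (hj.1 i) (not_le.2 (h2 j h))
    · exact absurd (h1 j) (not_le.2 (hj.2 i h))
  · exact absurd (hji ▸ ⟨h1, h2⟩) hj
  · rfl

theorem sum_mul_leadInd (c y : Fin N → ℝ) :
    ∃ i, y ∈ leadSet i ∧ ∑ j, c j * leadInd j y = c i := by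
  obtain ⟨i, hi, h⟩ := exists_mem_leadSet y
  exact ⟨i, hi, by simp [h]⟩

theorem sum_leadInd (y : Fin N → ℝ) : ∑ j, leadInd j y = 1 := by
  obtain ⟨i, -, h⟩ := sum_mul_leadInd 1 y
  simpa using h

theorem sum_self_mul_leadInd (y : Fin N → ℝ) : ∑ j, y j * leadInd j y = ⨆ i, y i := by
  obtain ⟨i, hi, h⟩ := sum_mul_leadInd y y
  rw [h]
  exact le_antisymm (le_ciSup_fin y i) (ciSup_le hi.1)

theorem sum_mul_leadInd_le (c y : Fin N → ℝ) : ∑ j, c j * leadInd j y ≤ ⨆ i, c i := by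
  obtain ⟨i, -, h⟩ := sum_mul_leadInd c y
  exact h ▸ le_ciSup_fin c i

theorem abs_sum_mul_leadInd_le (c y : Fin N → ℝ) : |∑ j, c j * leadInd j y| ≤ ‖c‖ := by
  obtain ⟨i, -, h⟩ := sum_mul_leadInd c y
  exact h ▸ norm_le_pi_norm c i

/-- The indicator of the leading coordinate is a subgradient of the maximum. -/
theorem ciSup_add_ge (y v : Fin N → ℝ) :
    (⨆ i, y i) + ∑ j, v j * leadInd j y ≤ ⨆ i, (y + v) i := by
  rw [← sum_self_mul_leadInd, ← Finset.sum_add_distrib]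
  simpa only [Pi.add_apply, add_mul] using sum_mul_leadInd_le (y + v) y

theorem abs_ciSup_le_norm (y : Fin N → ℝ) : |⨆ i, y i| ≤ ‖y‖ := by
  rw [← sum_self_mul_leadInd]
  exact abs_sum_mul_leadInd_le y y

theorem expGrowth_ciSup : ExpGrowth fun y : Fin N → ℝ => ⨆ i, y i :=
  ExpGrowth.of_linear (A := 0) (B := 1) le_rfl zero_le_one fun y => by
    simpa using abs_ciSup_le_norm y

end

/-! ### The Gaussian average of the maximum -/

section
variable {N : ℕ}

/-- `E max_i (x_i + Y_i)` for a standard Gaussian vector `Y`. -/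
noncomputable def maxAvg (x : Fin N → ℝ) : ℝ := gaussAvg (fun y => ⨆ i, y i) x

/-- The probability that `i` is the leading coordinate of `x + Y`. -/
noncomputable def leadProb (i : Fin N) (x : Fin N → ℝ) : ℝ := gaussAvg (leadInd i) x

/-- `E [Y_j ; i is the leading coordinate of x + Y]`. -/
noncomputable def crossMean (i j : Fin N) (x : Fin N → ℝ) : ℝ :=
  ∫ y, y j * leadInd i (x + y) ∂stdNormal N

/-- `E Y_I`, where `I` is the leading coordinate of `x + Y`. -/
noncomputable def leadMean (x : Fin N → ℝ) : ℝ := ∑ i, crossMean i i x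

theorem measurable_leadInd_add (i : Fin N) (x : Fin N → ℝ) :
    Measurable fun y => leadInd i (x + y) :=
  (measurable_leadInd i).comp (measurable_const_add x)

theorem expGrowth_eval (j : Fin N) : ExpGrowth fun y : Fin N → ℝ => y j :=
  ExpGrowth.of_linear (A := 0) (B := 1) le_rfl zero_le_one fun y => by
    simpa using norm_le_pi_norm y j

theorem integrable_eval_stdNormal (j : Fin N) : Integrable (fun y => y j) (stdNormal N) :=
  (expGrowth_eval j).integrable (measurable_pi_apply j).aestronglyMeasurable

theorem integrable_leadInd_add (i : Fin N) (x : Fin N → ℝ) :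
    Integrable (fun y => leadInd i (x + y)) (stdNormal N) :=
  ((expGrowth_leadInd i).comp_add x).integrable (measurable_leadInd_add i x).aestronglyMeasurable

theorem integrable_eval_mul_leadInd (i j : Fin N) (x : Fin N → ℝ) :
    Integrable (fun y => y j * leadInd i (x + y)) (stdNormal N) :=
  ((expGrowth_eval j).mul ((expGrowth_leadInd i).comp_add x)).integrable
    ((measurable_pi_apply j).mul (measurable_leadInd_add i x)).aestronglyMeasurable

theorem integral_eval_stdNormal (j : Fin N) : ∫ y, y j ∂stdNormal N = 0 := by
  have h := integral_stdNormal_neg (N := N) (fun y => y j)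
  simp only [Pi.neg_apply, integral_neg] at h
  linarith

theorem leadProb_nonneg (i : Fin N) (x : Fin N → ℝ) : 0 ≤ leadProb i x :=
  integral_nonneg fun _ => leadInd_nonneg i _

theorem expGrowth_sum_mul_leadInd [NeZero N] (q : Fin N → ℝ) :
    ExpGrowth fun y => ∑ i, q i * leadInd i y :=
  ExpGrowth.of_bound (A := ‖q‖) fun y => abs_sum_mul_leadInd_le q y

theorem measurable_sum_mul_leadInd (q : Fin N → ℝ) :
    Measurable fun y => ∑ i, q i * leadInd i y :=
  Finset.measurable_sum _ fun i _ => (measurable_leadInd i).const_mul (q i)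

theorem gaussAvg_sum_mul_leadInd (q x : Fin N → ℝ) :
    gaussAvg (fun y => ∑ i, q i * leadInd i y) x = ∑ i, q i * leadProb i x := by
  simp only [gaussAvg, leadProb]
  rw [integral_finsetSum _ fun i _ => (integrable_leadInd_add i x).const_mul (q i)]
  simp only [integral_const_mul]

theorem lineD1_zero (f : (Fin N → ℝ) → ℝ) (x q : Fin N → ℝ) :
    lineD1 f x q 0 = ∫ y, (∑ j, y j * q j) * f (x + y) ∂stdNormal N := by
  simp [lineD1, tiltMoment, dotCLM_apply]

variable [NeZero N]

theorem sum_leadProb (x : Fin N → ℝ) : ∑ i, leadProb i x = 1 := by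
  have h := gaussAvg_sum_mul_leadInd 1 x
  simp only [Pi.one_apply, one_mul, sum_leadInd] at h
  rw [← h]
  simp [gaussAvg]

theorem integrable_ciSup_add (x : Fin N → ℝ) :
    Integrable (fun y => ⨆ i, (x + y) i) (stdNormal N) :=
  (expGrowth_ciSup.comp_add x).integrable
    (measurable_ciSup_fin.comp (measurable_const_add x)).aestronglyMeasurable

theorem contDiff_maxAvg (n : ℕ) : ContDiff ℝ n (maxAvg (N := N)) :=
  contDiff_gaussAvg n measurable_ciSup_fin.aestronglyMeasurable expGrowth_ciSup

/-- The leading probabilities form a subgradient of `maxAvg`. -/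
theorem maxAvg_add_ge (x v : Fin N → ℝ) :
    maxAvg x + ∑ i, v i * leadProb i x ≤ maxAvg (x + v) := by
  rw [← gaussAvg_sum_mul_leadInd]
  simp only [maxAvg, gaussAvg]
  rw [← integral_add (integrable_ciSup_add x)
    (((expGrowth_sum_mul_leadInd v).comp_add x).integrable
      ((measurable_sum_mul_leadInd v).comp (measurable_const_add x)).aestronglyMeasurable)]
  refine integral_mono ((integrable_ciSup_add x).add
    (((expGrowth_sum_mul_leadInd v).comp_add x).integrable
      ((measurable_sum_mul_leadInd v).comp (measurable_const_add x)).aestronglyMeasurable))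
    (integrable_ciSup_add (x + v)) fun y => ?_
  have := ciSup_add_ge (x + y) v
  rwa [add_right_comm] at this

/-- The gradient of `maxAvg` is the vector of leading probabilities: these form a subgradient of a
function known to be differentiable, since the maximum is convex and its leading indicators are
a subgradient. -/
theorem hasFDerivAt_maxAvg (x : Fin N → ℝ) :
    HasFDerivAt maxAvg
      (∑ i, leadProb i x • (ContinuousLinearMap.proj i : (Fin N → ℝ) →L[ℝ] ℝ)) x := by
  have hd : DifferentiableAt ℝ (maxAvg (N := N)) x :=
    (contDiff_maxAvg 1).differentiable (by norm_num) x
  set L := ∑ i, leadProb i x • (ContinuousLinearMap.proj i : (Fin N → ℝ) →L[ℝ] ℝ)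
  have hL : ∀ v, L v = ∑ i, v i * leadProb i x := fun v => by simp [L, mul_comm]
  have hmin : IsLocalMin (fun z => maxAvg z - L z) x := by
    refine Eventually.of_forall fun z => ?_
    have := maxAvg_add_ge x (z - x)
    rw [← hL, add_sub_cancel, map_sub] at this
    simp only
    linarith
  have h0 := hmin.hasFDerivAt_eq_zero (hd.hasFDerivAt.sub L.hasFDerivAt)
  rw [sub_eq_zero] at h0
  exact h0 ▸ hd.hasFDerivAt

theorem dirDeriv_one_maxAvg (x q : Fin N → ℝ) :
    dirDeriv 1 maxAvg x q = gaussAvg (fun y => ∑ i, q i * leadInd i y) x := by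
  rw [dirDeriv_one, (hasFDerivAt_maxAvg x).fderiv, gaussAvg_sum_mul_leadInd]
  simp [mul_comm]

theorem dirDeriv_two_maxAvg_line (x q : Fin N → ℝ) (s : ℝ) :
    dirDeriv 2 maxAvg (x + s • q) q = lineD1 (fun y => ∑ i, q i * leadInd i y) x q s := by
  have h1 := hasDerivAt_dirDeriv (k := 1) (contDiff_maxAvg 2) x q s
  simp only [dirDeriv_one_maxAvg] at h1
  exact h1.unique (hasDerivAt_gaussAvg_line (measurable_sum_mul_leadInd q)
    (expGrowth_sum_mul_leadInd q) x q s)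

theorem dirDeriv_three_maxAvg_line (x q : Fin N → ℝ) (s : ℝ) :
    dirDeriv 3 maxAvg (x + s • q) q = lineD2 (fun y => ∑ i, q i * leadInd i y) x q s := by
  have h1 := hasDerivAt_dirDeriv (k := 2) (contDiff_maxAvg 3) x q s
  simp only [dirDeriv_two_maxAvg_line] at h1
  exact h1.unique (hasDerivAt_lineD1 (measurable_sum_mul_leadInd q)
    (expGrowth_sum_mul_leadInd q) x q s)

theorem dirDeriv_four_maxAvg (x q : Fin N → ℝ) :
    dirDeriv 4 maxAvg x q = lineD3 (fun y => ∑ i, q i * leadInd i y) x q 0 := by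
  have h1 := hasDerivAt_dirDeriv (k := 3) (contDiff_maxAvg 4) x q 0
  simp only [dirDeriv_three_maxAvg_line] at h1
  have := h1.unique (hasDerivAt_lineD2 (measurable_sum_mul_leadInd q)
    (expGrowth_sum_mul_leadInd q) x q 0)
  simpa using this

theorem dirDeriv_two_maxAvg (x q : Fin N → ℝ) :
    dirDeriv 2 maxAvg x q = ∑ i, ∑ j, q i * q j * crossMean i j x := by
  have h := dirDeriv_two_maxAvg_line x q 0
  rw [zero_smul, add_zero, lineD1_zero] at h
  rw [h]
  have h2 : ∀ y : Fin N → ℝ, (∑ j, y j * q j) * ∑ i, q i * leadInd i (x + y)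
      = ∑ i, ∑ j, q i * q j * (y j * leadInd i (x + y)) := fun y => by
    rw [Finset.sum_mul_sum, Finset.sum_comm]
    exact Finset.sum_congr rfl fun i _ => Finset.sum_congr rfl fun j _ => by ring
  simp only [h2]
  rw [integral_finsetSum _ fun i _ => integrable_finsetSum _ fun j _ =>
    (integrable_eval_mul_leadInd i j x).const_mul _]
  refine Finset.sum_congr rfl fun i _ => ?_
  rw [integral_finsetSum _ fun j _ => (integrable_eval_mul_leadInd i j x).const_mul _]
  simp only [integral_const_mul, crossMean]

theorem sum_crossMean (j : Fin N) (x : Fin N → ℝ) : ∑ i, crossMean i j x = 0 := by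
  simp only [crossMean]
  rw [← integral_finsetSum _ fun i _ => integrable_eval_mul_leadInd i j x]
  simp only [← Finset.mul_sum, sum_leadInd, mul_one, integral_eval_stdNormal]

omit [NeZero N] in
/-- Raising another coordinate lowers the probability that `i` leads. -/
theorem crossMean_nonpos {i j : Fin N} (hij : j ≠ i) (x : Fin N → ℝ) : crossMean i j x ≤ 0 := by
  have h := hasDerivAt_gaussAvg_line (measurable_leadInd i) (expGrowth_leadInd i) x
    (Pi.single j 1) 0
  rw [lineD1_zero] at h
  have h1 : ∀ y : Fin N → ℝ, ∑ k, y k * (Pi.single j 1 : Fin N → ℝ) k = y j := fun y => by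
    simp [Pi.single_apply]
  simp only [h1] at h
  have hanti : Antitone fun s : ℝ => gaussAvg (leadInd i) (x + s • Pi.single j 1) := by
    intro s s' hs
    refine integral_mono (integrable_leadInd_add i _) (integrable_leadInd_add i _) fun y => ?_
    -- lowering coordinate `j` preserves the event that `i` leads
    have hsub : x + s' • (Pi.single j 1 : Fin N → ℝ) + y ∈ leadSet i →
        x + s • (Pi.single j 1 : Fin N → ℝ) + y ∈ leadSet i := by
      rintro ⟨h1, h2⟩
      have hle : ∀ k, (x + s • (Pi.single j 1 : Fin N → ℝ) + y) k
          ≤ (x + s' • (Pi.single j 1 : Fin N → ℝ) + y) k := fun k => by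
        rcases eq_or_ne k j with rfl | hk
        · simpa using hs
        · simp [Pi.single_eq_of_ne hk]
      have heq : (x + s • (Pi.single j 1 : Fin N → ℝ) + y) i
          = (x + s' • (Pi.single j 1 : Fin N → ℝ) + y) i := by
        simp [Pi.single_eq_of_ne hij.symm]
      exact ⟨fun k => (hle k).trans ((h1 k).trans_eq heq.symm),
        fun k hk => (hle k).trans_lt ((h2 k hk).trans_eq heq.symm)⟩
    by_cases hs' : x + s' • (Pi.single j 1 : Fin N → ℝ) + y ∈ leadSet i
    · exact (Set.indicator_of_mem hs' 1).trans (Set.indicator_of_mem (hsub hs') 1).symm |>.le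
    · exact (Set.indicator_of_notMem hs' 1).trans_le (leadInd_nonneg i _)
  have h2 := hanti.deriv_nonpos (x := 0)
  rw [h.deriv] at h2
  exact h2

/-- On the cube the second derivative is at most twice the Laplacian: the Hessian has nonpositive
off-diagonal entries and vanishing column sums. -/
theorem dirDeriv_two_maxAvg_le (x : Fin N → ℝ) {q : Fin N → ℝ} (hq : q ∈ cube N) :
    dirDeriv 2 maxAvg x q ≤ 2 * leadMean x := by
  rw [dirDeriv_two_maxAvg, Finset.sum_comm, leadMean, Finset.mul_sum]
  refine Finset.sum_le_sum fun j _ => ?_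
  have h0 := sum_crossMean j x
  rw [← Finset.add_sum_erase _ _ (Finset.mem_univ j)] at h0 ⊢
  have hqq : ∀ i, |q i * q j| ≤ 1 := fun i => by
    rw [abs_mul]
    exact mul_le_one₀ (hq i) (abs_nonneg _) (hq j)
  have h1 : ∑ i ∈ Finset.univ.erase j, q i * q j * crossMean i j x
      ≤ -∑ i ∈ Finset.univ.erase j, crossMean i j x := by
    rw [← Finset.sum_neg_distrib]
    refine Finset.sum_le_sum fun i hi => ?_
    have hc := crossMean_nonpos (Finset.ne_of_mem_erase hi).symm x
    nlinarith [(abs_le.1 (hqq i)).1]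
  have hn : 0 ≤ -∑ i ∈ Finset.univ.erase j, crossMean i j x := by
    rw [← Finset.sum_neg_distrib]
    exact Finset.sum_nonneg fun i hi =>
      neg_nonneg.2 (crossMean_nonpos (Finset.ne_of_mem_erase hi).symm x)
  nlinarith [(abs_le.1 (hqq j)).2]

omit [NeZero N] in
/-- Absolute moments of the centred Gaussian variable `q ⬝ Y` of variance `c²`, from
`u ^ k / k! ≤ exp u` and its moment generating function. -/
theorem integral_abs_pow_dotCLM_le {q : Fin N → ℝ} {c : ℝ} (hc : 0 < c)
    (hq : ∑ i, q i ^ 2 = c ^ 2) (k : ℕ) :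
    Integrable (fun y => |dotCLM y q| ^ k) (stdNormal N) ∧
    ∫ y, |dotCLM y q| ^ k ∂stdNormal N ≤ 4 * k.factorial * c ^ k := by
  have hi : Integrable (fun y => |dotCLM y q| ^ k) (stdNormal N) := by
    have := (((ExpGrowth.dotCLM q).pow k).integrable
      ((measurable_dotCLM q).pow_const k).aestronglyMeasurable).abs
    simpa only [abs_pow] using this
  refine ⟨hi, ?_⟩
  have hexp : ∀ ε : ℝ, ε ^ 2 = 1 → ∫ y : Fin N → ℝ, Real.exp (dotCLM y ((ε / c) • q)) ∂stdNormal N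
      ≤ 2 := by
    intro ε hε
    have := mgf_stdNormal ((ε / c) • q)
    simp only [dotCLM_apply]
    simp only [Pi.smul_apply, smul_eq_mul, mul_pow, div_pow, hε,
      ← Finset.mul_sum, hq] at this
    simp only [Pi.smul_apply, smul_eq_mul]
    have hmul : ∀ y : Fin N → ℝ, ∑ i, y i * (ε / c * q i) = ∑ i, ε / c * q i * y i := fun y =>
      Finset.sum_congr rfl fun i _ => by ring
    simp only [hmul]
    rw [this, one_div, inv_mul_cancel₀ (by positivity)]
    have h1 : Real.exp (1 / 2) ^ 2 < 4 := by
      rw [← Real.exp_nat_mul]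
      norm_num
      linarith [Real.exp_one_lt_d9]
    nlinarith [Real.exp_pos (1 / 2)]
  have hint : ∀ ε : ℝ, Integrable (fun y : Fin N → ℝ => Real.exp (dotCLM y ((ε / c) • q)))
      (stdNormal N) := fun ε =>
    (ExpGrowth.exp_dotCLM _).integrable (measurable_dotCLM _).exp.aestronglyMeasurable
  calc ∫ y, |dotCLM y q| ^ k ∂stdNormal N
      ≤ ∫ y : Fin N → ℝ, k.factorial * c ^ k * (Real.exp (dotCLM y ((1 / c) • q))
          + Real.exp (dotCLM y ((-1 / c) • q))) ∂stdNormal N := by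
        refine integral_mono hi (((hint 1).add (hint (-1))).const_mul _) fun y => ?_
        have h1 := Real.pow_div_factorial_le_exp (|dotCLM y q| / c) (by positivity) k
        rw [div_le_iff₀ (by positivity), div_pow, div_le_iff₀ (by positivity)] at h1
        have h2 : Real.exp (|dotCLM y q| / c) ≤ Real.exp (dotCLM y ((1 / c) • q))
          + Real.exp (dotCLM y ((-1 / c) • q)) := by
          simp only [map_smul, smul_eq_mul]
          rcases abs_cases (dotCLM y q) with ⟨h, _⟩ | ⟨h, _⟩ <;> rw [h]
          · rw [div_eq_inv_mul, ← one_div]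
            exact le_add_of_nonneg_right (Real.exp_pos _).le
          · rw [show -dotCLM y q / c = -1 / c * dotCLM y q by ring]
            exact le_add_of_nonneg_left (Real.exp_pos _).le
        calc |dotCLM y q| ^ k ≤ Real.exp (|dotCLM y q| / c) * k.factorial * c ^ k := h1
          _ = k.factorial * c ^ k * Real.exp (|dotCLM y q| / c) := by ring
          _ ≤ _ := by gcongr
    _ = k.factorial * c ^ k * (∫ y : Fin N → ℝ, Real.exp (dotCLM y ((1 / c) • q)) ∂stdNormal N
          + ∫ y : Fin N → ℝ, Real.exp (dotCLM y ((-1 / c) • q)) ∂stdNormal N) := by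
        rw [integral_const_mul, integral_add (hint 1) (hint (-1))]
    _ ≤ k.factorial * c ^ k * (2 + 2) := by
        gcongr
        exacts [hexp 1 (by norm_num), hexp (-1) (by norm_num)]
    _ = _ := by ring

omit [NeZero N] in
theorem abs_tiltMoment_zero_le {f : (Fin N → ℝ) → ℝ} {B : ℝ} (hB : ∀ y, |f y| ≤ B)
    {q : Fin N → ℝ} {c : ℝ} (hc : 0 < c) (hq : ∑ i, q i ^ 2 = c ^ 2) (x : Fin N → ℝ) (k : ℕ) :
    |tiltMoment f x q k 0| ≤ B * (4 * k.factorial * c ^ k) := by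
  obtain ⟨h1, h2⟩ := integral_abs_pow_dotCLM_le hc hq k
  have hB0 : 0 ≤ B := (abs_nonneg _).trans (hB 0)
  calc |tiltMoment f x q k 0| ≤ ∫ y, B * |dotCLM y q| ^ k ∂stdNormal N := by
        rw [← Real.norm_eq_abs, tiltMoment]
        refine norm_integral_le_of_norm_le (h1.const_mul B) (Eventually.of_forall fun y => ?_)
        rw [zero_mul, Real.exp_zero, one_mul, Real.norm_eq_abs, abs_mul, abs_pow, mul_comm]
        gcongr
        exact hB _
    _ = B * ∫ y, |dotCLM y q| ^ k ∂stdNormal N := integral_const_mul _ _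
    _ ≤ _ := by gcongr

/-- The fourth derivative is a Gaussian expectation of a cubic polynomial in `q ⬝ Y`, a variable of
variance `N`, times a function bounded by one. -/
theorem abs_dirDeriv_four_maxAvg_le (x : Fin N → ℝ) {q : Fin N → ℝ} (hq : ∀ i, q i = 1 ∨ q i = -1) :
    |dirDeriv 4 maxAvg x q| ≤ 36 * (N * √N) := by
  have hN : (0 : ℝ) < N := Nat.cast_pos.2 (NeZero.pos N)
  have hc : 0 < √(N : ℝ) := Real.sqrt_pos.2 hN
  have hsq : √(N : ℝ) ^ 2 = N := Real.sq_sqrt hN.le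
  have hq2 : ∑ i, q i ^ 2 = √(N : ℝ) ^ 2 := by
    have : ∀ i, q i ^ 2 = 1 := fun i => by rcases hq i with h | h <;> rw [h] <;> norm_num
    simp [this]
  have hqn : ‖q‖ ≤ 1 := (pi_norm_le_iff_of_nonneg zero_le_one).2 fun i => by
    rcases hq i with h | h <;> rw [h] <;> norm_num
  have hb : ∀ y, |∑ i, q i * leadInd i y| ≤ 1 := fun y => (abs_sum_mul_leadInd_le q y).trans hqn
  rw [dirDeriv_four_maxAvg]
  have h3 := abs_tiltMoment_zero_le hb hc hq2 x 3
  have h1 := abs_tiltMoment_zero_le hb hc hq2 x 1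
  simp only [lineD3, hq2]
  norm_num [Nat.factorial] at h3 h1 ⊢
  rw [pow_succ, hsq] at h3
  rw [abs_le] at *
  constructor <;> nlinarith

end

/-! ### One-dimensional Gaussian tails -/

/-- The standard Gaussian density. -/
noncomputable abbrev normPDF (u : ℝ) : ℝ := gaussianPDFReal 0 1 u

/-- The standard Gaussian distribution function, as the mass above `-z`. -/
noncomputable def tailMass (z : ℝ) : ℝ := ∫ u in Set.Ioi (-z), normPDF u

/-- `E [Y² + 1 ; Y > -z]` for a standard Gaussian `Y`. -/
noncomputable def tailMoment (z : ℝ) : ℝ := ∫ u in Set.Ioi (-z), (u ^ 2 + 1) * normPDF u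

theorem normPDF_eq (u : ℝ) : normPDF u = (√(2 * Real.pi))⁻¹ * Real.exp (-u ^ 2 / 2) := by
  simp [normPDF, gaussianPDFReal]

theorem normPDF_nonneg (u : ℝ) : 0 ≤ normPDF u := gaussianPDFReal_nonneg 0 1 u

theorem normPDF_neg (u : ℝ) : normPDF (-u) = normPDF u := by simp [normPDF_eq]

theorem hasDerivAt_normPDF (u : ℝ) : HasDerivAt normPDF (-u * normPDF u) u := by
  have h : normPDF = fun u => (√(2 * Real.pi))⁻¹ * Real.exp (-u ^ 2 / 2) := funext normPDF_eq
  rw [h]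
  have h2 := (((((hasDerivAt_pow 2 u).neg).div_const 2).exp).const_mul (√(2 * Real.pi))⁻¹)
  refine h2.congr_deriv ?_
  simp only [Pi.neg_apply]
  push_cast
  ring

theorem continuous_normPDF : Continuous normPDF :=
  continuous_iff_continuousAt.2 fun u => (hasDerivAt_normPDF u).continuousAt

theorem integrable_sq_mul_normPDF : Integrable fun u => u ^ 2 * normPDF u := by
  have h := (integrable_rpow_mul_exp_neg_mul_sq (b := 1 / 2) (by norm_num) (s := 2)
    (by norm_num)).const_mul (√(2 * Real.pi))⁻¹
  refine h.congr (Eventually.of_forall fun u => ?_)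
  simp only [normPDF_eq, Real.rpow_two]
  ring_nf

theorem integrable_sq_add_one_mul_normPDF : Integrable fun u => (u ^ 2 + 1) * normPDF u := by
  refine (integrable_sq_mul_normPDF.add (integrable_gaussianPDFReal 0 1)).congr
    (Eventually.of_forall fun u => ?_)
  simp only [Pi.add_apply]
  ring

theorem hasDerivAt_tailMass (z : ℝ) : HasDerivAt tailMass (normPDF z) z := by
  have h := (hasDerivAt_setIntegral_Ioi (integrable_gaussianPDFReal 0 1) continuous_normPDF
    (-z)).comp z (hasDerivAt_neg z)
  refine h.congr_deriv ?_
  have := normPDF_neg z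
  simp only [normPDF] at this
  rw [this]
  ring

theorem hasDerivAt_tailMoment (z : ℝ) :
    HasDerivAt tailMoment ((z ^ 2 + 1) * normPDF z) z := by
  have h := (hasDerivAt_setIntegral_Ioi integrable_sq_add_one_mul_normPDF
    (((continuous_pow 2).add continuous_const).mul continuous_normPDF)
    (-z)).comp z (hasDerivAt_neg z)
  refine h.congr_deriv ?_
  rw [normPDF_neg]
  ring

theorem monotone_tailMass : Monotone tailMass :=
  monotone_of_deriv_nonneg (fun z => (hasDerivAt_tailMass z).differentiableAt) fun z =>
    (hasDerivAt_tailMass z).deriv ▸ normPDF_nonneg z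

theorem sq_add_one_mul_normPDF_le_one (u : ℝ) : (u ^ 2 + 1) * normPDF u ≤ 1 := by
  rw [normPDF_eq]
  have h1 : 2 ≤ √(2 * Real.pi) := by
    rw [Real.le_sqrt (by norm_num) (by positivity)]
    nlinarith [Real.pi_gt_three]
  have h2 : u ^ 2 + 1 ≤ 2 * Real.exp (u ^ 2 / 2) := by
    nlinarith [Real.add_one_le_exp (u ^ 2 / 2)]
  have h3 : Real.exp (u ^ 2 / 2) * Real.exp (-u ^ 2 / 2) = 1 := by
    rw [← Real.exp_add, neg_div, add_neg_cancel, Real.exp_zero]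
  calc (u ^ 2 + 1) * ((√(2 * Real.pi))⁻¹ * Real.exp (-u ^ 2 / 2))
      ≤ (2 * Real.exp (u ^ 2 / 2)) * (2⁻¹ * Real.exp (-u ^ 2 / 2)) := by gcongr
    _ = 1 := by linear_combination h3

theorem tailMoment_sub_le (z w : ℝ) : tailMoment w ≤ tailMoment z + |w - z| := by
  have h := Convex.norm_image_sub_le_of_norm_hasDerivWithin_le (f := tailMoment) (C := 1)
    (s := Set.univ) (x := z) (y := w) (fun u _ => (hasDerivAt_tailMoment u).hasDerivWithinAt)
    (fun u _ => by
      rw [Real.norm_of_nonneg (mul_nonneg (by positivity) (normPDF_nonneg u))]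
      exact sq_add_one_mul_normPDF_le_one u)
    convex_univ trivial trivial
  rw [one_mul] at h
  have := (le_abs_self _).trans h
  rw [Real.norm_eq_abs] at this
  linarith

theorem tendsto_mul_normPDF_atTop : Tendsto (fun u => u * normPDF u) atTop (𝓝 0) := by
  refine tendsto_of_tendsto_of_tendsto_of_le_of_le' tendsto_const_nhds tendsto_inv_atTop_zero
    ?_ ?_
  · filter_upwards [eventually_ge_atTop 0] with u hu
    exact mul_nonneg hu (normPDF_nonneg u)
  · filter_upwards [eventually_gt_atTop 0] with u hu
    rw [← one_div, le_div_iff₀ hu]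
    nlinarith [sq_add_one_mul_normPDF_le_one u, normPDF_nonneg u]

/-- The derivative of the Gaussian density is dominated by a truncated second moment. For `w < 0`
this is `∫_a^∞ (u² - 1) g(u) du = a g(a)` with `a = -w`; for `w ≥ 0` the mass of `(-w, 0]`
suffices. -/
theorem abs_mul_normPDF_le_tailMoment (w : ℝ) : |w| * normPDF w ≤ tailMoment w := by
  have hi := integrable_sq_add_one_mul_normPDF
  have hi0 := integrable_gaussianPDFReal 0 1
  rcases le_or_gt 0 w with hw | hw
  · rw [abs_of_nonneg hw]
    calc w * normPDF w = ∫ _u in Set.Ioc (-w) 0, normPDF w := by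
          simp [hw]
      _ ≤ ∫ u in Set.Ioc (-w) 0, (u ^ 2 + 1) * normPDF u := by
          refine setIntegral_mono_on (by simp) hi.integrableOn measurableSet_Ioc fun u hu => ?_
          have h1 : normPDF w ≤ normPDF u := by
            rw [normPDF_eq, normPDF_eq]
            gcongr 2
            have : u ^ 2 ≤ w ^ 2 := by nlinarith [hu.1, hu.2]
            linarith
          nlinarith [normPDF_nonneg u, sq_nonneg u]
      _ ≤ tailMoment w := by
          refine setIntegral_mono_set hi.integrableOn (Eventually.of_forall fun u =>
            mul_nonneg (by positivity) (normPDF_nonneg u)) ?_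
          exact Set.Ioc_subset_Ioi_self.eventuallyLE
  · rw [abs_of_neg hw]
    have hi2 : IntegrableOn (fun u => (u ^ 2 - 1) * normPDF u) (Set.Ioi (-w)) := by
      refine ((integrable_sq_mul_normPDF.sub hi0).congr
        (Eventually.of_forall fun u => ?_)).integrableOn
      simp only [Pi.sub_apply]
      ring
    have h1 : ∫ u in Set.Ioi (-w), (u ^ 2 - 1) * normPDF u = -w * normPDF w := by
      have hd : ∀ u ∈ Set.Ici (-w), HasDerivAt (fun u => -(u * normPDF u))
          ((u ^ 2 - 1) * normPDF u) u := fun u _ => by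
        refine (((hasDerivAt_id u).mul (hasDerivAt_normPDF u)).neg).congr_deriv ?_
        simp only [id]
        ring
      have ht : Tendsto (fun u => -(u * normPDF u)) atTop (𝓝 0) := by
        simpa using tendsto_mul_normPDF_atTop.neg
      rw [integral_Ioi_of_hasDerivAt_of_tendsto' hd hi2 ht, normPDF_neg]
      ring
    rw [← h1]
    refine setIntegral_mono hi2 hi.integrableOn fun u => ?_
    have := normPDF_nonneg u
    simp only
    nlinarith

/-- Second differences of the distribution function, from a bound `B` on the derivative of the
density. -/
theorem tailMass_second_difference_le {c d B : ℝ} (hd : 0 ≤ d)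
    (hB : ∀ w, |w - c| ≤ d → |w| * normPDF w ≤ B) :
    tailMass (c + d) + tailMass (c - d) - 2 * tailMass c ≤ B * d ^ 2 := by
  have hlip : ∀ r ∈ Set.Icc 0 d, normPDF (c + r) - normPDF (c - r) ≤ 2 * B * r := by
    intro r hr
    have h := Convex.norm_image_sub_le_of_norm_hasDerivWithin_le (f := normPDF) (C := B)
      (s := Set.Icc (c - d) (c + d)) (x := c - r) (y := c + r)
      (fun u _ => (hasDerivAt_normPDF u).hasDerivWithinAt)
      (fun u hu => by
        rw [norm_mul, Real.norm_of_nonneg (normPDF_nonneg u), norm_neg, Real.norm_eq_abs]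
        exact hB u (abs_le.2 ⟨by linarith [hu.1], by linarith [hu.2]⟩))
      (convex_Icc _ _) ⟨by linarith [hr.2], by linarith [hr.1, hr.2]⟩
      ⟨by linarith [hr.1, hr.2], by linarith [hr.2]⟩
    have h2 := (le_abs_self _).trans h
    rw [Real.norm_eq_abs, show c + r - (c - r) = 2 * r by ring,
      abs_of_nonneg (by linarith [hr.1])] at h2
    linarith
  have hder : ∀ r, HasDerivAt (fun r => tailMass (c + r) + tailMass (c - r) - B * r ^ 2)
      (normPDF (c + r) - normPDF (c - r) - 2 * B * r) r := fun r => by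
    have h1 := (hasDerivAt_tailMass (c + r)).comp r ((hasDerivAt_id r).const_add c)
    have h2 := (hasDerivAt_tailMass (c - r)).comp r ((hasDerivAt_id r).const_sub c)
    refine ((h1.add h2).sub ((hasDerivAt_pow 2 r).const_mul B)).congr_deriv ?_
    push_cast
    ring
  have hanti : AntitoneOn (fun r => tailMass (c + r) + tailMass (c - r) - B * r ^ 2)
      (Set.Icc 0 d) := by
    refine antitoneOn_of_deriv_nonpos (convex_Icc _ _)
      (fun r _ => (hder r).continuousAt.continuousWithinAt)
      (fun r _ => (hder r).differentiableAt.differentiableWithinAt) fun r hr => ?_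
    rw [(hder r).deriv]
    linarith [hlip r (interior_subset hr)]
  have := hanti (Set.left_mem_Icc.2 hd) (Set.right_mem_Icc.2 hd) hd
  simp only [add_zero, sub_zero] at this
  linarith

/-- If `z₀` lies above the midpoint of `z₁` and `z₂`, both within `r` of `z₀`, the second difference
of the distribution function is at most quadratic in `r`. -/
theorem tailMass_add_sub_le {z₀ z₁ z₂ r : ℝ} (h1 : |z₁ - z₀| ≤ r) (h2 : |z₂ - z₀| ≤ r)
    (hmid : z₁ + z₂ ≤ 2 * z₀) :
    tailMass z₁ + tailMass z₂ - 2 * tailMass z₀ ≤ r ^ 2 * (tailMoment z₀ + r) := by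
  wlog h : z₂ ≤ z₁ generalizing z₁ z₂
  · have := this h2 h1 (by linarith) (le_of_not_ge h)
    linarith
  have hd : 0 ≤ (z₁ - z₂) / 2 := by linarith
  rw [abs_le] at h1 h2
  have hdr : (z₁ - z₂) / 2 ≤ r := by linarith
  have key := tailMass_second_difference_le (c := (z₁ + z₂) / 2) (B := tailMoment z₀ + r) hd
    fun w hw => by
      rw [abs_le] at hw
      refine (abs_mul_normPDF_le_tailMoment w).trans ((tailMoment_sub_le z₀ w).trans ?_)
      gcongr
      exact abs_le.2 ⟨by linarith, by linarith⟩
  -- replacing `z₀` by the midpoint only enlarges the second difference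
  have hm : tailMass ((z₁ + z₂) / 2) ≤ tailMass z₀ := monotone_tailMass (by linarith)
  have hpos : 0 ≤ tailMoment z₀ + r := add_nonneg
    (integral_nonneg fun u => mul_nonneg (by positivity) (normPDF_nonneg u)) (hd.trans hdr)
  rw [show (z₁ + z₂) / 2 + (z₁ - z₂) / 2 = z₁ by ring,
    show (z₁ + z₂) / 2 - (z₁ - z₂) / 2 = z₂ by ring] at key
  have : ((z₁ - z₂) / 2) ^ 2 ≤ r ^ 2 := by gcongr
  nlinarith

/-- A bound on second differences bounds the second derivative. -/
theorem second_deriv_le_of_second_difference_le {F F1 F2 : ℝ → ℝ}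
    (h1 : ∀ s, HasDerivAt F (F1 s) s) (h2 : ∀ s, HasDerivAt F1 (F2 s) s) (hc : ContinuousAt F2 0)
    {A B : ℝ} (h : ∀ s, 0 < s → F s + F (-s) - 2 * F 0 ≤ s ^ 2 * (A + B * s)) : F2 0 ≤ A := by
  by_contra! hlt
  obtain ⟨A', hA, hA'⟩ := exists_between hlt
  obtain ⟨ε, hε, hball⟩ := Metric.eventually_nhds_iff.1 (hc.eventually (lt_mem_nhds hA'))
  have hF2 : ∀ s, |s| < ε → A' < F2 s := fun s hs => hball (by simpa using hs)
  have hd1 : ∀ s, HasDerivAt (fun s => F1 s - F1 (-s) - 2 * A' * s)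
      (F2 s + F2 (-s) - 2 * A') s := fun s => by
    have h3 := (h2 (-s)).comp s (hasDerivAt_neg s)
    refine (((h2 s).sub h3).sub ((hasDerivAt_id s).const_mul (2 * A'))).congr_deriv ?_
    ring
  have hm1 : MonotoneOn (fun s => F1 s - F1 (-s) - 2 * A' * s) (Set.Ico 0 ε) := by
    refine monotoneOn_of_deriv_nonneg (convex_Ico _ _)
      (fun r _ => (hd1 r).continuousAt.continuousWithinAt)
      (fun r _ => (hd1 r).differentiableAt.differentiableWithinAt) fun r hr => ?_
    rw [(hd1 r).deriv]
    have hr := interior_subset hr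
    have := hF2 r (by rw [abs_of_nonneg hr.1]; exact hr.2)
    have := hF2 (-r) (by rw [abs_neg, abs_of_nonneg hr.1]; exact hr.2)
    linarith
  have hd0 : ∀ s, HasDerivAt (fun s => F s + F (-s) - A' * s ^ 2)
      (F1 s - F1 (-s) - 2 * A' * s) s := fun s => by
    have h3 := (h1 (-s)).comp s (hasDerivAt_neg s)
    refine (((h1 s).add h3).sub ((hasDerivAt_pow 2 s).const_mul A')).congr_deriv ?_
    push_cast
    ring
  have hm0 : MonotoneOn (fun s => F s + F (-s) - A' * s ^ 2) (Set.Ico 0 ε) := by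
    refine monotoneOn_of_deriv_nonneg (convex_Ico _ _)
      (fun r _ => (hd0 r).continuousAt.continuousWithinAt)
      (fun r _ => (hd0 r).differentiableAt.differentiableWithinAt) fun r hr => ?_
    rw [(hd0 r).deriv]
    have hr := interior_subset hr
    have := hm1 (Set.left_mem_Ico.2 hε) hr hr.1
    simpa using this
  have hlim : ∀ s ∈ Set.Ioo 0 ε, A' ≤ A + B * s := fun s hs => by
    have h3 := hm0 (Set.left_mem_Ico.2 hε) ⟨hs.1.le, hs.2⟩ hs.1.le
    have h4 := h s hs.1
    simp only [neg_zero] at h3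
    have h5 : s ^ 2 * A' ≤ s ^ 2 * (A + B * s) := by linarith
    exact le_of_mul_le_mul_left h5 (by have := hs.1; positivity)
  have ht : Tendsto (fun s => A + B * s) (𝓝[>] 0) (𝓝 (A + B * 0)) :=
    (Continuous.tendsto (by fun_prop) 0).mono_left nhdsWithin_le_nhds
  have := ge_of_tendsto ht (eventually_of_mem (Ioo_mem_nhdsGT hε) hlim)
  linarith

/-! ### Conditioning on all coordinates but one -/

section
variable {n : ℕ}

/-- The lead of `x i` over the largest of the other coordinates of `x + y'`. -/
noncomputable def leadGap (i : Fin (n + 1)) (x : Fin (n + 1) → ℝ) (y' : Fin n → ℝ) : ℝ :=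
  x i - ⨆ k, (x (i.succAbove k) + y' k)

/-- Integrating out coordinate `i` first. -/
theorem integral_stdNormal_succ {f : (Fin (n + 1) → ℝ) → ℝ} (hf : Integrable f (stdNormal (n + 1)))
    (i : Fin (n + 1)) :
    ∫ y, f y ∂stdNormal (n + 1)
      = ∫ y', ∫ u, f (i.insertNth u y') ∂gaussianReal 0 1 ∂stdNormal n := by
  have hmp := (measurePreserving_piFinSuccAbove (fun _ : Fin (n + 1) => gaussianReal 0 1) i).symm
  rw [← hmp.integral_comp', integral_prod_symm]
  · rfl
  · exact (hmp.integrable_comp_emb (MeasurableEquiv.measurableEmbedding _)).2 hf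

theorem measurable_leadGap (i : Fin (n + 1)) (x : Fin (n + 1) → ℝ) : Measurable (leadGap i x) :=
  measurable_const.sub (Measurable.iSup fun k => (measurable_pi_apply k).const_add _)

variable [NeZero n]

/-- Given the other coordinates, `i` leads when `Y_i` exceeds minus its gap. Ties only occur at the
excluded value of `u`. -/
theorem leadInd_insertNth (i : Fin (n + 1)) (x : Fin (n + 1) → ℝ) (y' : Fin n → ℝ) {u : ℝ}
    (hu : u ≠ -leadGap i x y') :
    leadInd i (x + i.insertNth u y') = (Set.Ioi (-leadGap i x y')).indicator 1 u := by
  have hk : ∀ k, (x + (i.insertNth u y' : Fin (n + 1) → ℝ)) (i.succAbove k)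
      = x (i.succAbove k) + y' k := fun k => by simp
  have hi : (x + (i.insertNth u y' : Fin (n + 1) → ℝ)) i = x i + u := by simp
  rcases lt_or_gt_of_ne hu with h | h
  · rw [Set.indicator_of_notMem (by simpa using h.le)]
    refine Set.indicator_of_notMem (fun hmem => ?_) _
    have h1 : ⨆ k, (x (i.succAbove k) + y' k) ≤ x i + u :=
      ciSup_le fun k => by rw [← hk, ← hi]; exact hmem.1 _
    rw [leadGap] at h
    linarith
  · rw [Set.indicator_of_mem (Set.mem_Ioi.2 h)]
    have h1 : ∀ k, (x + (i.insertNth u y' : Fin (n + 1) → ℝ)) (i.succAbove k)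
        < (x + (i.insertNth u y' : Fin (n + 1) → ℝ)) i := fun k => by
      rw [hk, hi]
      have := le_ciSup_fin (fun k => x (i.succAbove k) + y' k) k
      rw [leadGap] at h
      linarith
    have h2 : ∀ k, k ≠ i → (x + (i.insertNth u y' : Fin (n + 1) → ℝ)) k
        < (x + (i.insertNth u y' : Fin (n + 1) → ℝ)) i := fun k hki => by
      obtain ⟨j, rfl⟩ := Fin.exists_succAbove_eq hki
      exact h1 j
    have hmem : x + (i.insertNth u y' : Fin (n + 1) → ℝ) ∈ leadSet i := by
      refine ⟨fun k => ?_, fun k hki => h2 k hki.ne⟩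
      rcases eq_or_ne k i with rfl | hki
      · exact le_rfl
      · exact (h2 k hki).le
    exact Set.indicator_of_mem hmem _

theorem integral_mul_leadInd_insertNth (i : Fin (n + 1)) (x : Fin (n + 1) → ℝ) (y' : Fin n → ℝ)
    (h : ℝ → ℝ) : ∫ u, h u * leadInd i (x + i.insertNth u y') ∂gaussianReal 0 1
      = ∫ u in Set.Ioi (-leadGap i x y'), h u * normPDF u := by
  rw [integral_gaussianReal_eq_integral_smul one_ne_zero, ← integral_indicator measurableSet_Ioi]
  refine integral_congr_ae ?_
  have : ∀ᵐ u : ℝ, u ≠ -leadGap i x y' := by simp [ae_iff]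
  filter_upwards [this] with u hu
  rw [leadInd_insertNth i x y' hu, smul_eq_mul]
  by_cases hmem : u ∈ Set.Ioi (-leadGap i x y')
  · simp only [Set.indicator_of_mem hmem, Pi.one_apply]
    ring
  · simp only [Set.indicator_of_notMem hmem, mul_zero]

theorem leadProb_eq_integral_tailMass (i : Fin (n + 1)) (x : Fin (n + 1) → ℝ) :
    leadProb i x = ∫ y', tailMass (leadGap i x y') ∂stdNormal n := by
  rw [leadProb, gaussAvg, integral_stdNormal_succ (integrable_leadInd_add i x) i]
  congr 1
  ext y'
  have := integral_mul_leadInd_insertNth i x y' (fun _ => 1)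
  simpa only [one_mul, tailMass] using this

/-- `E [Y_i² + 1 ; i is the leading coordinate of x + Y]`. -/
noncomputable def leadMoment {N : ℕ} (i : Fin N) (x : Fin N → ℝ) : ℝ :=
  ∫ y, (y i ^ 2 + 1) * leadInd i (x + y) ∂stdNormal N

omit [NeZero n] in
theorem integrable_sq_add_one_mul_leadInd {N : ℕ} (i : Fin N) (x : Fin N → ℝ) :
    Integrable (fun y => (y i ^ 2 + 1) * leadInd i (x + y)) (stdNormal N) := by
  have h1 := (((expGrowth_eval i).pow 2).mul ((expGrowth_leadInd i).comp_add x)).integrable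
    (((measurable_pi_apply i).pow_const 2).mul (measurable_leadInd_add i x)).aestronglyMeasurable
  refine (h1.add (integrable_leadInd_add i x)).congr (Eventually.of_forall fun y => ?_)
  simp only [Pi.add_apply]
  ring

theorem leadMoment_eq_integral_tailMoment (i : Fin (n + 1)) (x : Fin (n + 1) → ℝ) :
    leadMoment i x = ∫ y', tailMoment (leadGap i x y') ∂stdNormal n := by
  rw [leadMoment, integral_stdNormal_succ (integrable_sq_add_one_mul_leadInd i x) i]
  congr 1
  ext y'
  have := integral_mul_leadInd_insertNth i x y' (fun u => u ^ 2 + 1)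
  simpa only [Fin.insertNth_apply_same, tailMoment] using this

omit [NeZero n] in
theorem integrable_tailMass_leadGap (i : Fin (n + 1)) (x : Fin (n + 1) → ℝ) :
    Integrable (fun y' => tailMass (leadGap i x y')) (stdNormal n) := by
  have hc : Continuous tailMass := continuous_iff_continuousAt.2 fun z =>
    (hasDerivAt_tailMass z).continuousAt
  refine Integrable.of_bound
    (hc.measurable.comp (measurable_leadGap i x)).aestronglyMeasurable (∫ u, normPDF u)
    (Eventually.of_forall fun y' => ?_)
  rw [tailMass, Real.norm_of_nonneg (integral_nonneg fun u => normPDF_nonneg u)]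
  exact setIntegral_le_integral (integrable_gaussianPDFReal 0 1)
    (Eventually.of_forall normPDF_nonneg)

omit [NeZero n] in
theorem integrable_tailMoment_leadGap (i : Fin (n + 1)) (x : Fin (n + 1) → ℝ) :
    Integrable (fun y' => tailMoment (leadGap i x y')) (stdNormal n) := by
  have hc : Continuous tailMoment := continuous_iff_continuousAt.2 fun z =>
    (hasDerivAt_tailMoment z).continuousAt
  have hp : ∀ u : ℝ, 0 ≤ (u ^ 2 + 1) * normPDF u := fun u =>
    mul_nonneg (by positivity) (normPDF_nonneg u)
  refine Integrable.of_bound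
    (hc.measurable.comp (measurable_leadGap i x)).aestronglyMeasurable
    (∫ u, (u ^ 2 + 1) * normPDF u) (Eventually.of_forall fun y' => ?_)
  rw [tailMoment, Real.norm_of_nonneg (integral_nonneg hp)]
  exact setIntegral_le_integral integrable_sq_add_one_mul_normPDF (Eventually.of_forall hp)

theorem leadGap_add_le (i : Fin (n + 1)) (x v : Fin (n + 1) → ℝ) {r : ℝ} (hv : ∀ k, |v k| ≤ r)
    (y' : Fin n → ℝ) : leadGap i (x + v) y' ≤ leadGap i x y' + 2 * r := by
  have h1 : ⨆ k, (x (i.succAbove k) + y' k)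
      ≤ (⨆ k, ((x + v) (i.succAbove k) + y' k)) + r := ciSup_le fun k => by
    have h2 := le_ciSup_fin (fun k => (x + v) (i.succAbove k) + y' k) k
    have h3 := (abs_le.1 (hv (i.succAbove k))).1
    simp only [Pi.add_apply] at h2 ⊢
    linarith
  have h4 := (abs_le.1 (hv i)).2
  simp only [leadGap]
  rw [Pi.add_apply]
  linarith

theorem abs_leadGap_add_sub_le (i : Fin (n + 1)) (x v : Fin (n + 1) → ℝ) {r : ℝ}
    (hv : ∀ k, |v k| ≤ r) (y' : Fin n → ℝ) :
    |leadGap i (x + v) y' - leadGap i x y'| ≤ 2 * r := by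
  have h1 := leadGap_add_le i x v hv y'
  have h2 := leadGap_add_le i (x + v) (-v) (r := r) (by simpa using hv) y'
  rw [add_neg_cancel_right] at h2
  exact abs_le.2 ⟨by linarith, by linarith⟩

/-- The gap is a concave function of `x`. -/
theorem leadGap_add_leadGap_le (i : Fin (n + 1)) (x v : Fin (n + 1) → ℝ) (y' : Fin n → ℝ) :
    leadGap i (x + v) y' + leadGap i (x + -v) y' ≤ 2 * leadGap i x y' := by
  have h1 : ⨆ k, (x (i.succAbove k) + y' k) ≤ ((⨆ k, ((x + v) (i.succAbove k) + y' k))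
      + ⨆ k, ((x + -v) (i.succAbove k) + y' k)) / 2 := ciSup_le fun k => by
    have h2 := le_ciSup_fin (fun k => (x + v) (i.succAbove k) + y' k) k
    have h3 := le_ciSup_fin (fun k => (x + -v) (i.succAbove k) + y' k) k
    simp only [Pi.add_apply, Pi.neg_apply] at h2 h3 ⊢
    linarith
  simp only [leadGap] at *
  rw [Pi.add_apply, Pi.add_apply, Pi.neg_apply]
  linarith

/-- The one-dimensional estimate `tailMass_add_sub_le`, applied to the gap given the other
coordinates. -/
theorem leadProb_second_difference_le (i : Fin (n + 1)) (x : Fin (n + 1) → ℝ)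
    {q : Fin (n + 1) → ℝ} (hq : q ∈ cube (n + 1)) {s : ℝ} (hs : 0 < s) :
    leadProb i (x + s • q) + leadProb i (x + (-s) • q) - 2 * leadProb i x
      ≤ s ^ 2 * (4 * leadMoment i x + 8 * s) := by
  have hv : ∀ k, |(s • q) k| ≤ s := fun k => by
    rw [Pi.smul_apply, smul_eq_mul, abs_mul, abs_of_pos hs]
    exact mul_le_of_le_one_right hs.le (hq k)
  have hpt : ∀ y', tailMass (leadGap i (x + s • q) y') + tailMass (leadGap i (x + (-s) • q) y')
      - 2 * tailMass (leadGap i x y') ≤ (2 * s) ^ 2 * (tailMoment (leadGap i x y') + 2 * s) := by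
    intro y'
    rw [neg_smul]
    exact tailMass_add_sub_le (abs_leadGap_add_sub_le i x _ hv y')
      (abs_leadGap_add_sub_le i x _ (by simpa using hv) y') (leadGap_add_leadGap_le i x _ y')
  have hI := integrable_tailMass_leadGap i (n := n)
  have hM := integrable_tailMoment_leadGap i x
  have key := integral_mono (((hI _).add (hI _)).sub ((hI x).const_mul 2))
    ((hM.add (integrable_const (2 * s))).const_mul ((2 * s) ^ 2)) hpt
  simp only [Pi.add_apply] at key
  rw [integral_const_mul, integral_add hM (integrable_const _), integral_sub' ((hI _).add (hI _))
    ((hI x).const_mul 2), integral_add' (hI _) (hI _), integral_const_mul, integral_const,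
    probReal_univ, one_smul] at key
  rw [leadMoment_eq_integral_tailMoment]
  simp only [leadProb_eq_integral_tailMass]
  linarith

end

section
variable {N : ℕ} [NeZero N]

theorem leadMoment_nonneg {N : ℕ} (i : Fin N) (x : Fin N → ℝ) : 0 ≤ leadMoment i x :=
  integral_nonneg fun y => mul_nonneg (by positivity) (leadInd_nonneg i _)

/-- Second directional derivatives of the leading probabilities are bounded above. The gap between
coordinate `i` and the others is concave along lines, and the distribution function of the
coordinate `Y_i` is increasing, so the curvature of the gap only contributes a nonpositive term. -/
theorem lineD2_leadInd_le (i : Fin N) (x : Fin N → ℝ) {q : Fin N → ℝ} (hq : q ∈ cube N) :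
    lineD2 (leadInd i) x q 0 ≤ 4 * leadMoment i x := by
  have hm := measurable_leadInd i
  have hg := expGrowth_leadInd i
  refine second_deriv_le_of_second_difference_le (B := 8)
    (hasDerivAt_gaussAvg_line hm hg x q) (hasDerivAt_lineD1 hm hg x q)
    (hasDerivAt_lineD2 hm hg x q 0).continuousAt fun s hs => ?_
  rw [zero_smul, add_zero]
  rcases Nat.exists_eq_succ_of_ne_zero (NeZero.ne N) with ⟨n, rfl⟩
  rcases Nat.eq_zero_or_pos n with rfl | hn
  · -- with a single coordinate the leading probability is constantly `1`
    have h1 : ∀ z, gaussAvg (leadInd i) z = 1 := fun z => by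
      have := sum_leadProb z
      rw [Fin.sum_univ_one] at this
      rw [← this, leadProb, Subsingleton.elim i 0]
    rw [h1, h1, h1]
    have := leadMoment_nonneg i x
    have : 0 ≤ s ^ 2 * (4 * leadMoment i x + 8 * s) := by positivity
    linarith
  · have : NeZero n := ⟨hn.ne'⟩
    exact leadProb_second_difference_le i x hq hs

theorem lineD2_sum_mul_leadInd (q x v : Fin N → ℝ) (s : ℝ) :
    lineD2 (fun y => ∑ i, q i * leadInd i y) x v s
      = ∑ i, q i * lineD2 (leadInd i) x v s := by
  have hJ : ∀ s, lineD1 (fun y => ∑ i, q i * leadInd i y) x v s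
      = ∑ i, q i * lineD1 (leadInd i) x v s := fun s => by
    have h1 := hasDerivAt_gaussAvg_line (measurable_sum_mul_leadInd q)
      (expGrowth_sum_mul_leadInd q) x v s
    simp only [gaussAvg_sum_mul_leadInd] at h1
    exact h1.unique (HasDerivAt.fun_sum fun i _ => (hasDerivAt_gaussAvg_line (measurable_leadInd i)
      (expGrowth_leadInd i) x v s).const_mul (q i))
  have h1 := hasDerivAt_lineD1 (measurable_sum_mul_leadInd q) (expGrowth_sum_mul_leadInd q) x v s
  rw [funext hJ] at h1
  exact h1.unique (HasDerivAt.fun_sum fun i _ => (hasDerivAt_lineD1 (measurable_leadInd i)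
      (expGrowth_leadInd i) x v s).const_mul (q i))

theorem sum_lineD2_leadInd (x v : Fin N → ℝ) (s : ℝ) : ∑ i, lineD2 (leadInd i) x v s = 0 := by
  have h0 : ∀ s, ∑ i, lineD1 (leadInd i) x v s = 0 := fun s => by
    have h1 : HasDerivAt (fun s : ℝ => ∑ i, leadProb i (x + s • v))
        (∑ i, lineD1 (leadInd i) x v s) s :=
      HasDerivAt.fun_sum fun i _ => hasDerivAt_gaussAvg_line (measurable_leadInd i)
        (expGrowth_leadInd i) x v s
    simp only [sum_leadProb] at h1
    exact h1.unique (hasDerivAt_const s 1)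
  have h1 : HasDerivAt (fun s : ℝ => ∑ i, lineD1 (leadInd i) x v s)
      (∑ i, lineD2 (leadInd i) x v s) s :=
    HasDerivAt.fun_sum fun i _ => hasDerivAt_lineD1 (measurable_leadInd i)
      (expGrowth_leadInd i) x v s
  simp only [h0] at h1
  exact h1.unique (hasDerivAt_const s 0)

/-- `E Y_I² ≤ C √N` whatever the index `I`, from `2 Y_I² ≤ Y_I⁴ / √N + √N`. -/
theorem sum_leadMoment_le (x : Fin N → ℝ) : ∑ i, leadMoment i x ≤ 50 * √N := by
  have hN : (1 : ℝ) ≤ N := Nat.one_le_cast.2 (NeZero.pos N)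
  have hr : 1 ≤ √(N : ℝ) := Real.one_le_sqrt.2 hN
  have hrr : √(N : ℝ) * √N = N := Real.mul_self_sqrt (by linarith)
  have h4 : ∀ i : Fin N, Integrable (fun y => y i ^ 4) (stdNormal N) ∧
      ∫ y, y i ^ 4 ∂stdNormal N ≤ 96 := fun i => by
    have h := integral_abs_pow_dotCLM_le (q := (Pi.single i 1 : Fin N → ℝ)) one_pos
      (by simp [Pi.single_apply]) 4
    have h1 : ∀ y : Fin N → ℝ, |dotCLM y (Pi.single i 1)| ^ 4 = y i ^ 4 := fun y => by
      rw [Even.pow_abs ⟨2, rfl⟩, dotCLM_apply]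
      simp [Pi.single_apply]
    simp only [h1] at h
    norm_num [Nat.factorial] at h
    exact h
  have hpt : ∀ y : Fin N → ℝ, ∑ i, (y i ^ 2 + 1) * leadInd i (x + y)
      ≤ (∑ i, y i ^ 4) / (2 * √N) + 2 * √N := fun y => by
    obtain ⟨i, -, h⟩ := sum_mul_leadInd (fun i => y i ^ 2 + 1) (x + y)
    rw [h]
    have h1 : y i ^ 4 ≤ ∑ i, y i ^ 4 :=
      Finset.single_le_sum (f := fun i => y i ^ 4) (fun _ _ => by positivity) (Finset.mem_univ i)
    have h2 : y i ^ 2 ≤ y i ^ 4 / (2 * √N) + √N := by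
      rw [← sub_nonneg]
      have : y i ^ 4 / (2 * √N) + √N - y i ^ 2
          = ((y i ^ 2 - √N) ^ 2 + √N * √N) / (2 * √N) := by
        field_simp
        ring
      rw [this]
      positivity
    have h3 : y i ^ 4 / (2 * √N) ≤ (∑ i, y i ^ 4) / (2 * √N) := by gcongr
    linarith
  calc ∑ i, leadMoment i x = ∫ y, ∑ i, (y i ^ 2 + 1) * leadInd i (x + y) ∂stdNormal N := by
        rw [integral_finsetSum _ fun i _ => integrable_sq_add_one_mul_leadInd i x]
        rfl
    _ ≤ ∫ y, ((∑ i, y i ^ 4) / (2 * √N) + 2 * √N) ∂stdNormal N :=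
        integral_mono (integrable_finsetSum _ fun i _ => integrable_sq_add_one_mul_leadInd i x)
          (((integrable_finsetSum _ fun i _ => (h4 i).1).div_const _).add (integrable_const _)) hpt
    _ = (∑ i, ∫ y, y i ^ 4 ∂stdNormal N) / (2 * √N) + 2 * √N := by
        rw [integral_add ((integrable_finsetSum _ fun i _ => (h4 i).1).div_const _)
          (integrable_const _), integral_div, integral_finsetSum _ fun i _ => (h4 i).1]
        simp
    _ ≤ (∑ _i : Fin N, 96) / (2 * √N) + 2 * √N := by
        gcongr with i
        exact (h4 i).2
    _ = 50 * √N := by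
        simp only [Finset.sum_const, Finset.card_univ, Fintype.card_fin, nsmul_eq_mul]
        nth_rewrite 1 [← hrr]
        field_simp
        ring

/-- The second derivatives of the leading probabilities sum to zero and are bounded above, hence
are summable in absolute value with a bound of the order of `√N`. -/
theorem abs_dirDeriv_three_maxAvg_le (x : Fin N → ℝ) {q : Fin N → ℝ} (hq : q ∈ cube N) :
    |dirDeriv 3 maxAvg x q| ≤ 400 * √N := by
  have h := dirDeriv_three_maxAvg_line x q 0
  rw [zero_smul, add_zero, lineD2_sum_mul_leadInd] at h
  rw [h]
  have h0 := sum_lineD2_leadInd x q 0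
  calc |∑ i, q i * lineD2 (leadInd i) x q 0|
      ≤ ∑ i, |lineD2 (leadInd i) x q 0| := by
        refine (Finset.abs_sum_le_sum_abs _ _).trans (Finset.sum_le_sum fun i _ => ?_)
        rw [abs_mul]
        exact mul_le_of_le_one_left (abs_nonneg _) (hq i)
    _ ≤ ∑ i, (8 * leadMoment i x - lineD2 (leadInd i) x q 0) := by
        refine Finset.sum_le_sum fun i _ => abs_le.2 ⟨?_, ?_⟩
        · have := leadMoment_nonneg i x
          linarith
        · have := lineD2_leadInd_le i x hq
          linarith
    _ = 8 * ∑ i, leadMoment i x := by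
        rw [Finset.sum_sub_distrib, h0, Finset.mul_sum, sub_zero]
    _ ≤ 400 * √N := by linarith [sum_leadMoment_le x]

end

/-! ### The heat potential -/

section
variable {N : ℕ}

/-- The substitution `y ↦ -σ y` turns the heat potential into a rescaled Gaussian average. -/
theorem heat_eq {κ t : ℝ} (hκ : 0 < κ) (ht : t < 0) (x : Fin N → ℝ) :
    heat κ x t = √(-2 * κ * t) * maxAvg ((√(-2 * κ * t))⁻¹ • x) := by
  have hpos : 0 < -2 * κ * t := by nlinarith
  set σ := √(-2 * κ * t) with hσ
  have hσ0 : 0 < σ := Real.sqrt_pos.2 hpos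
  have hsq : -2 * κ * t = σ ^ 2 := (Real.sq_sqrt hpos.le).symm
  rw [heat, hsq, maxAvg, gaussAvg, integral_stdNormal]
  have h1 := Measure.integral_comp_smul (volume : Measure (Fin N → ℝ))
    (fun y : Fin N → ℝ => Real.exp (-(∑ i, y i ^ 2) / (2 * σ ^ 2)) * ⨆ k, (x k - y k)) (-σ)
  rw [Module.finrank_fin_fun, abs_inv, abs_pow, abs_neg, abs_of_pos hσ0, smul_eq_mul] at h1
  have h2 : ∀ y : Fin N → ℝ, Real.exp (-(∑ i, (-σ • y) i ^ 2) / (2 * σ ^ 2)) *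
      ⨆ k, (x k - (-σ • y) k)
      = σ * (Real.exp (-(∑ i, y i ^ 2) / 2) * ⨆ i, (σ⁻¹ • x + y) i) := by
    intro y
    have h3 : ∑ i, (-σ • y) i ^ 2 = σ ^ 2 * ∑ i, y i ^ 2 := by
      rw [Finset.mul_sum]
      exact Finset.sum_congr rfl fun i _ => by simp [mul_pow]
    have h4 : ⨆ k, (x k - (-σ • y) k) = σ * ⨆ i, (σ⁻¹ • x + y) i := by
      rw [Real.mul_iSup_of_nonneg hσ0.le]
      congr 1
      ext k
      simp only [Pi.smul_apply, Pi.add_apply, smul_eq_mul]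
      field_simp
      ring
    rw [h3, h4, show -(σ ^ 2 * ∑ i, y i ^ 2) / (2 * σ ^ 2) = -(∑ i, y i ^ 2) / 2 by field_simp]
    ring
  simp only [h2] at h1
  rw [integral_const_mul] at h1
  have h5 : ∀ I : ℝ, I = σ ^ N * ((σ ^ N)⁻¹ * I) := fun I => by field_simp
  rw [h5 (∫ y : Fin N → ℝ, Real.exp (-(∑ i, y i ^ 2) / (2 * σ ^ 2)) * ⨆ k, (x k - y k)), ← h1]
  have h6 : (2 * Real.pi * σ ^ 2) ^ (-(N : ℝ) / 2)
      = (2 * Real.pi) ^ (-(N : ℝ) / 2) * (σ ^ N)⁻¹ := by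
    rw [Real.mul_rpow (by positivity) (by positivity), ← Real.rpow_natCast σ 2,
      ← Real.rpow_mul hσ0.le, ← Real.rpow_natCast σ N, ← Real.rpow_neg hσ0.le]
    congr 2
    push_cast
    ring
  rw [h6]
  simp only [stdNormalPDF, mul_assoc]
  rw [integral_const_mul]
  field_simp

theorem sqrt_neg_two_mul {κ s : ℝ} : √(-2 * κ * -s) = √(2 * κ * s) := by
  congr 1
  ring

theorem heat_neg_eq {κ s : ℝ} (hκ : 0 < κ) (hs : 0 < s) (x : Fin N → ℝ) :
    heat κ x (-s) = √(2 * κ * s) * maxAvg ((√(2 * κ * s))⁻¹ • x) := by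
  rw [heat_eq hκ (neg_lt_zero.2 hs), sqrt_neg_two_mul]

theorem heat_neg_eq_fun {κ s : ℝ} (hκ : 0 < κ) (hs : 0 < s) :
    (fun x : Fin N → ℝ => heat κ x (-s))
      = fun x => √(2 * κ * s) * maxAvg ((√(2 * κ * s))⁻¹ • x) :=
  funext fun x => heat_neg_eq hκ hs x

variable [NeZero N]

theorem contDiff_scale_maxAvg (k : ℕ) (σ : ℝ) :
    ContDiff ℝ k fun x : Fin N → ℝ => σ * maxAvg (σ⁻¹ • x) :=
  contDiff_const.mul ((contDiff_maxAvg k).comp (contDiff_const_smul σ⁻¹))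

theorem dirDeriv_scale_maxAvg (k : ℕ) (σ : ℝ) (x q : Fin N → ℝ) :
    dirDeriv k (fun x : Fin N → ℝ => σ * maxAvg (σ⁻¹ • x)) x q
      = σ * (σ⁻¹ ^ k * dirDeriv k maxAvg (σ⁻¹ • x) q) := by
  have h1 : ContDiff ℝ k (fun x : Fin N → ℝ => maxAvg (σ⁻¹ • x)) :=
    (contDiff_maxAvg k).comp (contDiff_const_smul σ⁻¹)
  have h2 := (σ⁻¹ • ContinuousLinearMap.id ℝ (Fin N → ℝ)).iteratedFDeriv_comp_right
    (contDiff_maxAvg (N := N) k) x (le_refl (k : WithTop ℕ∞))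
  have h3 : (maxAvg ∘ (σ⁻¹ • ContinuousLinearMap.id ℝ (Fin N → ℝ)))
      = fun x : Fin N → ℝ => maxAvg (σ⁻¹ • x) := by
    ext x
    simp
  rw [h3] at h2
  have h4 := iteratedFDeriv_const_smul_apply (a := σ) h1.contDiffAt (i := k) (x := x)
  simp only [dirDeriv]
  have h5 : (fun x : Fin N → ℝ => σ * maxAvg (σ⁻¹ • x))
      = σ • fun x : Fin N → ℝ => maxAvg (σ⁻¹ • x) := rfl
  rw [h5, h4, h2]
  simp [ContinuousMultilinearMap.map_smul_univ]

theorem thirdBound_sqrt {κ : ℝ} (hκ : 0 < κ) : ThirdBound N κ (200 * κ⁻¹ * √N) := by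
  intro t ht y q hq
  obtain ⟨s, rfl⟩ : ∃ s, t = -s := ⟨-t, by ring⟩
  have hs : 0 < s := by linarith
  have hσ : 0 < √(2 * κ * s) := Real.sqrt_pos.2 (by positivity)
  have hsq : √(2 * κ * s) ^ 2 = 2 * κ * s := Real.sq_sqrt (by positivity)
  rw [heat_neg_eq_fun hκ hs]
  have h := dirDeriv_scale_maxAvg 3 √(2 * κ * s) y q
  rw [dirDeriv] at h
  rw [h, ← mul_assoc, abs_mul, abs_neg, abs_of_pos hs]
  have h1 : √(2 * κ * s) * (√(2 * κ * s))⁻¹ ^ 3 = (2 * κ * s)⁻¹ := by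
    nth_rewrite 3 [← hsq]
    field_simp
  rw [h1, abs_of_pos (by positivity)]
  calc (2 * κ * s)⁻¹ * |dirDeriv 3 maxAvg ((√(2 * κ * s))⁻¹ • y) q|
      ≤ (2 * κ * s)⁻¹ * (400 * √N) := by
        gcongr
        exact abs_dirDeriv_three_maxAvg_le _ hq
    _ = _ := by
        field_simp
        ring

theorem fourthBound_mul_sqrt {κ : ℝ} (hκ : 0 < κ) :
    FourthBound N κ (36 * κ ^ (-3 / 2 : ℝ) * (N * √N)) := by
  intro t ht y q hq
  obtain ⟨s, rfl⟩ : ∃ s, t = -s := ⟨-t, by ring⟩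
  have hs : 0 < s := by linarith
  have hσ : 0 < √(2 * κ * s) := Real.sqrt_pos.2 (by positivity)
  have hsq : √(2 * κ * s) ^ 2 = 2 * κ * s := Real.sq_sqrt (by positivity)
  rw [heat_neg_eq_fun hκ hs]
  have h := dirDeriv_scale_maxAvg 4 √(2 * κ * s) y q
  rw [dirDeriv] at h
  rw [h, ← mul_assoc, abs_mul, abs_neg, abs_of_pos hs]
  have h1 : √(2 * κ * s) * (√(2 * κ * s))⁻¹ ^ 4 = (√(2 * κ * s) ^ 3)⁻¹ := by
    field_simp
  have h32 : ∀ a : ℝ, 0 < a → a ^ (3 / 2 : ℝ) = √a ^ 3 := fun a ha => by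
    rw [Real.sqrt_eq_rpow, ← Real.rpow_natCast, ← Real.rpow_mul ha.le]
    norm_num
  rw [h1, abs_of_pos (by positivity), neg_div, Real.rpow_neg hκ.le, h32 κ hκ, h32 s hs]
  have h2 : √κ ^ 3 * √s ^ 3 ≤ √(2 * κ * s) ^ 3 := by
    rw [← mul_pow, ← Real.sqrt_mul hκ.le]
    gcongr
    nlinarith [mul_pos hκ hs]
  have hk : 0 < √κ := Real.sqrt_pos.2 hκ
  have hss : 0 < √s := Real.sqrt_pos.2 hs
  calc (√(2 * κ * s) ^ 3)⁻¹ * |dirDeriv 4 maxAvg ((√(2 * κ * s))⁻¹ • y) q|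
      ≤ (√κ ^ 3 * √s ^ 3)⁻¹ * (36 * (N * √N)) := by
        gcongr
        exact abs_dirDeriv_four_maxAvg_le _ hq
    _ = _ := by
        field_simp

/-! ### Values and time derivative of the heat potential -/

omit [NeZero N] in
theorem gaussMax_eq : gaussMax N = maxAvg (0 : Fin N → ℝ) := by
  simp [gaussMax, maxAvg, gaussAvg]

/-- Jensen's inequality. -/
theorem maxAvg_ge (x : Fin N → ℝ) : ⨆ i, x i ≤ maxAvg x := by
  have hi : Integrable (fun y => ∑ j, y j * leadInd j x) (stdNormal N) :=
    integrable_finsetSum _ fun j _ => (integrable_eval_stdNormal j).mul_const _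
  have h := integral_mono ((integrable_const (⨆ i, x i)).add hi) (integrable_ciSup_add x)
    (fun y => ciSup_add_ge x y)
  rw [integral_add' (integrable_const _) hi,
    integral_finsetSum _ fun j _ => (integrable_eval_stdNormal j).mul_const _] at h
  simp only [integral_mul_const, integral_eval_stdNormal, integral_const, probReal_univ, one_smul,
    zero_mul, Finset.sum_const_zero, add_zero] at h
  exact h

theorem gaussMax_nonneg : 0 ≤ gaussMax N := by
  have := maxAvg_ge (0 : Fin N → ℝ)
  rw [gaussMax_eq]
  simpa using this

theorem maxAvg_le (x : Fin N → ℝ) : maxAvg x ≤ (⨆ i, x i) + gaussMax N := by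
  have h0 := integrable_ciSup_add (0 : Fin N → ℝ)
  have h := integral_mono (integrable_ciSup_add x) ((integrable_const (⨆ i, x i)).add h0)
    (fun y => show ⨆ i, (x + y) i ≤ (⨆ i, x i) + ⨆ i, (0 + y) i from ciSup_le fun i => by
      rw [zero_add]
      exact add_le_add (le_ciSup_fin x i) (le_ciSup_fin y i))
  rw [integral_add' (integrable_const _) h0, integral_const, probReal_univ, one_smul] at h
  rw [gaussMax_eq]
  exact h

/-- The maximum of `z + Y` is its leading coordinate. By `sum_crossMean` and Gaussian integration by
parts `leadMean` is the Laplacian of `maxAvg`. -/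
theorem maxAvg_eq_add_leadMean (z : Fin N → ℝ) :
    maxAvg z = ∑ i, z i * leadProb i z + leadMean z := by
  have h1 : ∀ y, ⨆ i, (z + y) i = ∑ i, (z i * leadInd i (z + y) + y i * leadInd i (z + y)) :=
    fun y => by
      rw [← sum_self_mul_leadInd]
      exact Finset.sum_congr rfl fun i _ => by rw [Pi.add_apply]; ring
  simp only [maxAvg, gaussAvg, h1]
  rw [integral_finsetSum _ fun i _ => ((integrable_leadInd_add i z).const_mul (z i)).fun_add
    (integrable_eval_mul_leadInd i i z), leadMean, ← Finset.sum_add_distrib]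
  refine Finset.sum_congr rfl fun i _ => ?_
  rw [integral_add ((integrable_leadInd_add i z).const_mul _) (integrable_eval_mul_leadInd i i z),
    integral_const_mul]
  rfl

/-- The Laplacian of the convex function `maxAvg` is nonnegative. -/
theorem leadMean_nonneg (z : Fin N → ℝ) : 0 ≤ leadMean z := by
  refine Finset.sum_nonneg fun j _ => ?_
  have h0 := sum_crossMean j z
  rw [← Finset.add_sum_erase _ _ (Finset.mem_univ j)] at h0
  have : ∑ i ∈ Finset.univ.erase j, crossMean i j z ≤ 0 := Finset.sum_nonpos fun i hi =>
    crossMean_nonpos (Finset.ne_of_mem_erase hi).symm z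
  linarith

theorem leadMean_le (z : Fin N → ℝ) : leadMean z ≤ gaussMax N := by
  rw [gaussMax_eq, leadMean]
  simp only [crossMean, maxAvg, gaussAvg]
  rw [← integral_finsetSum _ fun i _ => integrable_eval_mul_leadInd i i z]
  refine integral_mono (integrable_finsetSum _ fun i _ => integrable_eval_mul_leadInd i i z)
    (integrable_ciSup_add 0) fun y => ?_
  simp only [zero_add]
  exact sum_mul_leadInd_le y (z + y)

theorem ciSup_le_heat {κ s : ℝ} (hκ : 0 < κ) (hs : 0 < s) (x : Fin N → ℝ) :
    ⨆ i, x i ≤ heat κ x (-s) := by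
  have hσ : 0 < √(2 * κ * s) := Real.sqrt_pos.2 (by positivity)
  rw [heat_neg_eq hκ hs]
  calc ⨆ i, x i = √(2 * κ * s) * ⨆ i, ((√(2 * κ * s))⁻¹ • x) i := by
        rw [Real.mul_iSup_of_nonneg hσ.le]
        congr 1
        ext i
        rw [Pi.smul_apply, smul_eq_mul, mul_inv_cancel_left₀ hσ.ne']
    _ ≤ _ := by gcongr; exact maxAvg_ge _

theorem heat_le {κ s : ℝ} (hκ : 0 < κ) (hs : 0 < s) (x : Fin N → ℝ) :
    heat κ x (-s) ≤ (⨆ i, x i) + √(2 * κ * s) * gaussMax N := by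
  have hσ : 0 < √(2 * κ * s) := Real.sqrt_pos.2 (by positivity)
  rw [heat_neg_eq hκ hs]
  calc _ ≤ √(2 * κ * s) * ((⨆ i, ((√(2 * κ * s))⁻¹ • x) i) + gaussMax N) := by
        gcongr
        exact maxAvg_le _
    _ = _ := by
        rw [mul_add, Real.mul_iSup_of_nonneg hσ.le]
        congr 2
        ext i
        rw [Pi.smul_apply, smul_eq_mul, mul_inv_cancel_left₀ hσ.ne']

theorem hasFDerivAt_heat {κ s : ℝ} (hκ : 0 < κ) (hs : 0 < s) (x : Fin N → ℝ) :
    HasFDerivAt (fun x => heat κ x (-s))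
      (∑ i, leadProb i ((√(2 * κ * s))⁻¹ • x) •
        (ContinuousLinearMap.proj i : (Fin N → ℝ) →L[ℝ] ℝ)) x := by
  have hσ : 0 < √(2 * κ * s) := Real.sqrt_pos.2 (by positivity)
  rw [heat_neg_eq_fun hκ hs]
  have h := ((hasFDerivAt_maxAvg ((√(2 * κ * s))⁻¹ • x)).comp x
    ((hasFDerivAt_id x).const_smul (√(2 * κ * s))⁻¹)).const_mul √(2 * κ * s)
  refine h.congr_fderiv ?_
  ext v
  simp [Finset.mul_sum]
  refine Finset.sum_congr rfl fun i _ => ?_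
  field_simp

theorem hasDerivAt_sqrt_mul {κ s : ℝ} (hκ : 0 < κ) (hs : 0 < s) :
    HasDerivAt (fun s => √(2 * κ * s)) (κ / √(2 * κ * s)) s := by
  refine (((hasDerivAt_id s).const_mul (2 * κ)).sqrt (by simp only [id]; positivity)).congr_deriv ?_
  simp only [id, mul_one]
  rw [mul_div_mul_left _ _ two_ne_zero]

/-- The heat equation, with the Laplacian expressed through `leadMean`. -/
theorem hasDerivAt_heat {κ s : ℝ} (hκ : 0 < κ) (hs : 0 < s) (x : Fin N → ℝ) :
    HasDerivAt (fun s => heat κ x (-s))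
      (κ / √(2 * κ * s) * leadMean ((√(2 * κ * s))⁻¹ • x)) s := by
  have hσ : 0 < √(2 * κ * s) := Real.sqrt_pos.2 (by positivity)
  have h1 := hasDerivAt_sqrt_mul hκ hs
  have h2 := (hasFDerivAt_maxAvg ((√(2 * κ * s))⁻¹ • x)).comp_hasDerivAt s
    ((h1.inv hσ.ne').smul_const x)
  have h3 := h1.mul h2
  have h4 : HasDerivAt (fun s => heat κ x (-s)) _ s := h3.congr_of_eventuallyEq (by
    filter_upwards [lt_mem_nhds hs] with r hr
    rw [heat_neg_eq hκ hr]
    rfl)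
  refine h4.congr_deriv ?_
  rw [Function.comp_apply, Pi.inv_apply, maxAvg_eq_add_leadMean]
  simp [mul_add, Finset.mul_sum]
  rw [add_right_comm, ← Finset.sum_add_distrib]
  simp
  refine Finset.sum_eq_zero fun i _ => ?_
  field_simp
  ring

end

/-! ### Taylor expansion along a line -/

section
variable {N : ℕ}

theorem iteratedDeriv_line {f : (Fin N → ℝ) → ℝ} (k : ℕ) (hf : ContDiff ℝ k f) (x v : Fin N → ℝ) :
    iteratedDeriv k (fun s : ℝ => f (x + s • v)) = fun s => dirDeriv k f (x + s • v) v := by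
  induction k with
  | zero => simp [dirDeriv_zero]
  | succ k ih =>
    have hk : ContDiff ℝ k f := hf.of_le (by exact_mod_cast Nat.le_succ k)
    rw [iteratedDeriv_succ, ih hk]
    ext s
    exact (hasDerivAt_dirDeriv hf x v s).deriv

/-- Taylor's formula with Lagrange remainder in the direction `v`. -/
theorem taylor_dirDeriv {f : (Fin N → ℝ) → ℝ} (n : ℕ) (hf : ContDiff ℝ (n + 1 : ℕ) f)
    (x v : Fin N → ℝ) : ∃ y, f (x + v)
      = ∑ k ∈ Finset.range (n + 1), dirDeriv k f x v / k.factorial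
        + dirDeriv (n + 1) f y v / (n + 1).factorial := by
  have hl : ContDiff ℝ (n + 1 : ℕ) fun s : ℝ => f (x + s • v) :=
    hf.comp (contDiff_const.add (contDiff_id.smul contDiff_const))
  obtain ⟨s, -, hs⟩ := taylor_mean_remainder_lagrange_iteratedDeriv (n := n) zero_ne_one
    (f := fun s : ℝ => f (x + s • v)) (by exact_mod_cast hl.contDiffOn)
  refine ⟨x + s • v, ?_⟩
  rw [iteratedDeriv_line (n + 1) hf] at hs
  rw [taylor_within_apply, one_smul, sub_zero, one_pow, mul_one] at hs
  rw [sub_eq_iff_eq_add.1 hs, add_comm]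
  congr 1
  refine Finset.sum_congr rfl fun k hk => ?_
  have hkn : k ≤ n + 1 := (Finset.mem_range.1 hk).le
  have hfk : ContDiff ℝ k f := hf.of_le (by exact_mod_cast hkn)
  rw [iteratedDerivWithin_eq_iteratedDeriv (uniqueDiffOn_uIcc zero_ne_one)
    (hl.of_le (by exact_mod_cast hkn)).contDiffAt Set.left_mem_uIcc, iteratedDeriv_line k hfk]
  simp [div_eq_inv_mul]

theorem dirDeriv_neg (k : ℕ) (f : (Fin N → ℝ) → ℝ) (x v : Fin N → ℝ) :
    dirDeriv k f x (-v) = (-1) ^ k * dirDeriv k f x v := by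
  have := (iteratedFDeriv ℝ k f x).map_smul_univ (fun _ => (-1 : ℝ)) (fun _ => v)
  simpa [dirDeriv] using this

end

/-! ### The Laplace transform of the heat potential -/

/-- The average of `f` over `(δ, ∞)` with respect to the probability density `e^{δ - s}`. -/
noncomputable def expAvg (δ : ℝ) (f : ℝ → ℝ) : ℝ :=
  Real.exp δ * ∫ s in Set.Ioi δ, Real.exp (-s) * f s

/-- Integrability with respect to `e^{-s} ds` on `(δ, ∞)`. -/
def ExpIntegrable (δ : ℝ) (f : ℝ → ℝ) : Prop :=
  IntegrableOn (fun s => Real.exp (-s) * f s) (Set.Ioi δ)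

section
variable {δ : ℝ} {f g : ℝ → ℝ}

theorem expIntegrable_const (c : ℝ) : ExpIntegrable δ fun _ => c :=
  (integrableOn_exp_neg_Ioi δ).mul_const c

theorem ExpIntegrable.add (hf : ExpIntegrable δ f) (hg : ExpIntegrable δ g) :
    ExpIntegrable δ fun s => f s + g s := by
  simpa only [ExpIntegrable, IntegrableOn, mul_add] using Integrable.fun_add hf hg

theorem ExpIntegrable.const_mul (hf : ExpIntegrable δ f) (c : ℝ) :
    ExpIntegrable δ fun s => c * f s := by
  simpa only [ExpIntegrable, IntegrableOn, mul_left_comm _ c] using Integrable.const_mul hf c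

theorem ExpIntegrable.sum {ι : Type*} {t : Finset ι} {F : ι → ℝ → ℝ}
    (hF : ∀ i ∈ t, ExpIntegrable δ (F i)) : ExpIntegrable δ fun s => ∑ i ∈ t, F i s := by
  simp only [ExpIntegrable, Finset.mul_sum]
  exact integrable_finsetSum _ hF

theorem ExpIntegrable.of_bounded (hm : AEStronglyMeasurable f (volume.restrict (Set.Ioi δ)))
    {B : ℝ} (hB : ∀ s, δ < s → |f s| ≤ B) : ExpIntegrable δ f := by
  refine Integrable.mono' ((integrableOn_exp_neg_Ioi δ).mul_const B)
    ((by fun_prop : Measurable fun s : ℝ => Real.exp (-s)).aestronglyMeasurable.mul hm) ?_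
  filter_upwards [ae_restrict_mem measurableSet_Ioi] with s hs
  rw [norm_mul, Real.norm_of_nonneg (Real.exp_pos _).le]
  gcongr
  exact hB s hs

theorem expAvg_const (c : ℝ) : expAvg δ (fun _ => c) = c := by
  rw [expAvg, integral_mul_const, ← mul_assoc, integral_exp_neg_Ioi', one_mul]

theorem expAvg_add (hf : ExpIntegrable δ f) (hg : ExpIntegrable δ g) :
    expAvg δ (fun s => f s + g s) = expAvg δ f + expAvg δ g := by
  simp only [expAvg, mul_add]
  rw [integral_add hf hg, mul_add]

theorem expAvg_const_mul (c : ℝ) : expAvg δ (fun s => c * f s) = c * expAvg δ f := by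
  simp only [expAvg, mul_left_comm _ c]
  rw [integral_const_mul, mul_left_comm]

theorem expAvg_sum {ι : Type*} {t : Finset ι} {F : ι → ℝ → ℝ}
    (hF : ∀ i ∈ t, ExpIntegrable δ (F i)) :
    expAvg δ (fun s => ∑ i ∈ t, F i s) = ∑ i ∈ t, expAvg δ (F i) := by
  simp only [expAvg, Finset.mul_sum]
  rw [integral_finsetSum _ hF, Finset.mul_sum]

theorem expAvg_mono (hf : ExpIntegrable δ f) (hg : ExpIntegrable δ g)
    (h : ∀ s, δ < s → f s ≤ g s) : expAvg δ f ≤ expAvg δ g := by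
  refine mul_le_mul_of_nonneg_left ?_ (Real.exp_pos δ).le
  exact setIntegral_mono_on hf hg measurableSet_Ioi fun s hs =>
    mul_le_mul_of_nonneg_left (h s hs) (Real.exp_pos _).le

end

theorem heatHat_eq_expAvg {N : ℕ} (δ κ : ℝ) (x : Fin N → ℝ) :
    heatHat δ κ x = expAvg δ fun s => heat κ x (-s) := by
  rw [heatHat, expAvg, ← integral_comp_neg_Ioi]

section
variable {N : ℕ} [NeZero N] {δ κ : ℝ}

theorem expIntegrable_sqrt (hδ : 0 < δ) : ExpIntegrable δ fun s => √s :=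
  (integral_exp_neg_mul_sqrt hδ).1

theorem sqrt_two_mul_mul (hκ : 0 < κ) (s : ℝ) : √(2 * κ * s) = √(2 * κ) * √s :=
  Real.sqrt_mul (by positivity) s

theorem abs_heat_le (hκ : 0 < κ) {s : ℝ} (hs : 0 < s) (x : Fin N → ℝ) :
    |heat κ x (-s)| ≤ ‖x‖ + √(2 * κ) * gaussMax N * √s := by
  have h1 := ciSup_le_heat hκ hs x
  have h2 := heat_le hκ hs x
  have h3 := abs_le.1 (abs_ciSup_le_norm x)
  rw [sqrt_two_mul_mul hκ] at h2
  have h4 : 0 ≤ √(2 * κ) * gaussMax N * √s :=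
    mul_nonneg (mul_nonneg (Real.sqrt_nonneg _) gaussMax_nonneg) (Real.sqrt_nonneg _)
  exact abs_le.2 ⟨by linarith [h3.1], by linarith [h3.2]⟩

theorem continuousOn_heat (hδ : 0 < δ) (hκ : 0 < κ) (x : Fin N → ℝ) :
    ContinuousOn (fun s => heat κ x (-s)) (Set.Ioi δ) := fun _ hs =>
  (hasDerivAt_heat hκ (hδ.trans hs) x).continuousAt.continuousWithinAt

theorem expIntegrable_heat (hδ : 0 < δ) (hκ : 0 < κ) (x : Fin N → ℝ) :
    ExpIntegrable δ fun s => heat κ x (-s) := by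
  refine Integrable.mono' ((expIntegrable_const ‖x‖).add
    ((expIntegrable_sqrt hδ).const_mul (√(2 * κ) * gaussMax N)))
    ((by fun_prop : Measurable fun s : ℝ => Real.exp (-s)).aestronglyMeasurable.mul
      ((continuousOn_heat hδ hκ x).aestronglyMeasurable measurableSet_Ioi)) ?_
  filter_upwards [ae_restrict_mem measurableSet_Ioi] with s hs
  rw [norm_mul, Real.norm_of_nonneg (Real.exp_pos _).le]
  gcongr
  exact abs_heat_le hκ (hδ.trans hs) x

/-- The Laplacian `Δφ(x, -s)` of the heat potential. -/
noncomputable def heatLaplacian (κ : ℝ) (x : Fin N → ℝ) (s : ℝ) : ℝ :=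
  (√(2 * κ * s))⁻¹ * leadMean ((√(2 * κ * s))⁻¹ • x)

omit [NeZero N] in
theorem continuous_leadProb (i : Fin N) : Continuous (leadProb i) :=
  (contDiff_gaussAvg 0 (measurable_leadInd i).aestronglyMeasurable
    (expGrowth_leadInd i)).continuous

theorem continuous_leadMean : Continuous (leadMean (N := N)) := by
  have h : (leadMean (N := N)) = fun z => maxAvg z - ∑ i, z i * leadProb i z := by
    ext z
    rw [maxAvg_eq_add_leadMean]
    ring
  rw [h]
  exact (contDiff_maxAvg 0).continuous.sub (continuous_finsetSum _ fun i _ =>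
    (continuous_apply i).mul (continuous_leadProb i))

omit [NeZero N] in
theorem continuousOn_inv_sqrt_smul (hδ : 0 < δ) (hκ : 0 < κ) (x : Fin N → ℝ) :
    ContinuousOn (fun s => (√(2 * κ * s))⁻¹ • x) (Set.Ioi δ) := by
  have hc : Continuous fun s => √(2 * κ * s) := by fun_prop
  refine ContinuousOn.smul (hc.continuousOn.inv₀ fun s hs => ?_) continuousOn_const
  have : 0 < s := hδ.trans hs
  positivity

theorem expIntegrable_heatLaplacian (hδ : 0 < δ) (hκ : 0 < κ) (x : Fin N → ℝ) :
    ExpIntegrable δ (heatLaplacian κ x) := by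
  refine ExpIntegrable.of_bounded (B := (√(2 * κ * δ))⁻¹ * gaussMax N) ?_ fun s hs => ?_
  · have hc : Continuous fun s => √(2 * κ * s) := by fun_prop
    refine ContinuousOn.aestronglyMeasurable (ContinuousOn.mul (hc.continuousOn.inv₀
      fun s hs => ?_) (continuous_leadMean.comp_continuousOn
        (continuousOn_inv_sqrt_smul hδ hκ x))) measurableSet_Ioi
    have : 0 < s := hδ.trans hs
    positivity
  · have : 0 < s := hδ.trans hs
    rw [heatLaplacian, abs_mul, abs_of_pos (by positivity), abs_of_nonneg (leadMean_nonneg _)]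
    have hp : 0 < √(2 * κ * δ) := by positivity
    have hN := gaussMax_nonneg (N := N)
    gcongr
    exacts [leadMean_nonneg _, leadMean_le _]

/-- Integration by parts in time, from the heat equation `hasDerivAt_heat`. -/
theorem expAvg_heatLaplacian (hδ : 0 < δ) (hκ : 0 < κ) (x : Fin N → ℝ) :
    κ * expAvg δ (heatLaplacian κ x) = heatHat δ κ x - heat κ x (-δ) := by
  have hd : ∀ s ∈ Set.Ici δ, HasDerivAt (fun s => Real.exp (-s) * heat κ x (-s))
      (Real.exp (-s) * (κ * heatLaplacian κ x s + -1 * heat κ x (-s))) s := fun s hs => by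
    have hs0 : 0 < s := lt_of_lt_of_le hδ hs
    refine ((hasDerivAt_neg s).exp.mul (hasDerivAt_heat hκ hs0 x)).congr_deriv ?_
    rw [heatLaplacian]
    ring
  have hi1 := (expIntegrable_heatLaplacian hδ hκ x).const_mul κ
  have hi2 := (expIntegrable_heat hδ hκ x).const_mul (-1)
  have ht : Tendsto (fun s => Real.exp (-s) * heat κ x (-s)) atTop (𝓝 0) := by
    have h0 : Tendsto (fun s => ‖x‖ * Real.exp (-s)
        + √(2 * κ) * gaussMax N * (Real.exp (-s) * √s)) atTop (𝓝 0) := by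
      simpa using (Real.tendsto_exp_neg_atTop_nhds_zero.const_mul ‖x‖).add
        (tendsto_exp_neg_mul_sqrt.const_mul (√(2 * κ) * gaussMax N))
    refine squeeze_zero_norm' ?_ h0
    filter_upwards [eventually_gt_atTop 0] with s hs
    rw [norm_mul, Real.norm_of_nonneg (Real.exp_pos _).le]
    calc _ ≤ Real.exp (-s) * (‖x‖ + √(2 * κ) * gaussMax N * √s) := by
          gcongr
          exact abs_heat_le hκ hs x
      _ = _ := by ring
  have h := integral_Ioi_of_hasDerivAt_of_tendsto' hd (hi1.add hi2) ht
  have h2 : expAvg δ (fun s => κ * heatLaplacian κ x s + -1 * heat κ x (-s))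
      = - heat κ x (-δ) := by
    rw [expAvg, h, zero_sub, mul_neg, ← mul_assoc, ← Real.exp_add, add_neg_cancel, Real.exp_zero,
      one_mul]
  rw [expAvg_add hi1 hi2, expAvg_const_mul, expAvg_const_mul, ← heatHat_eq_expAvg] at h2
  linarith

/-- The probability that `i` leads, averaged in time: the `i`-th partial derivative of `heatHat`. -/
noncomputable def hatProb (δ κ : ℝ) (i : Fin N) (x : Fin N → ℝ) : ℝ :=
  expAvg δ fun s => leadProb i ((√(2 * κ * s))⁻¹ • x)

theorem leadProb_le_one (i : Fin N) (x : Fin N → ℝ) : leadProb i x ≤ 1 := by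
  rw [← sum_leadProb x]
  exact Finset.single_le_sum (f := fun i => leadProb i x) (fun i _ => leadProb_nonneg i x)
    (Finset.mem_univ i)

theorem expIntegrable_leadProb (hδ : 0 < δ) (hκ : 0 < κ) (i : Fin N) (x : Fin N → ℝ) :
    ExpIntegrable δ fun s => leadProb i ((√(2 * κ * s))⁻¹ • x) :=
  ExpIntegrable.of_bounded (B := 1) (((continuous_leadProb i).comp_continuousOn
    (continuousOn_inv_sqrt_smul hδ hκ x)).aestronglyMeasurable measurableSet_Ioi) fun s _ => by
    rw [abs_of_nonneg (leadProb_nonneg _ _)]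
    exact leadProb_le_one _ _

omit [NeZero N] in
theorem hatProb_nonneg (i : Fin N) (x : Fin N → ℝ) : 0 ≤ hatProb δ κ i x :=
  mul_nonneg (Real.exp_pos δ).le (integral_nonneg fun _ =>
    mul_nonneg (Real.exp_pos _).le (leadProb_nonneg _ _))

theorem sum_hatProb (hδ : 0 < δ) (hκ : 0 < κ) (x : Fin N → ℝ) :
    ∑ i, hatProb δ κ i x = 1 := by
  simp only [hatProb]
  rw [← expAvg_sum fun i _ => expIntegrable_leadProb hδ hκ i x]
  simp only [sum_leadProb]
  exact expAvg_const 1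

omit [NeZero N] in
theorem norm_sum_smul_proj_le (c : Fin N → ℝ) :
    ‖∑ i, c i • (ContinuousLinearMap.proj i : (Fin N → ℝ) →L[ℝ] ℝ)‖ ≤ ∑ i, |c i| := by
  refine ContinuousLinearMap.opNorm_le_bound _ (Finset.sum_nonneg fun _ _ => abs_nonneg _)
    fun v => ?_
  simp only [sum_apply, smul_apply, ContinuousLinearMap.proj_apply,
    smul_eq_mul, Finset.sum_mul]
  refine (norm_sum_le _ _).trans (Finset.sum_le_sum fun i _ => ?_)
  rw [norm_mul]
  exact mul_le_mul_of_nonneg_left (norm_le_pi_norm v i) (norm_nonneg _)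

omit [NeZero N] in
theorem integral_sum_smul_const {α E : Type*} [MeasurableSpace α] [NormedAddCommGroup E]
    [NormedSpace ℝ E] [CompleteSpace E] {μ : Measure α} {c : Fin N → α → ℝ} (e : Fin N → E)
    (hc : ∀ i, Integrable (c i) μ) : Integrable (fun s => ∑ i, c i s • e i) μ ∧
      ∫ s, ∑ i, c i s • e i ∂μ = ∑ i, (∫ s, c i s ∂μ) • e i := by
  refine ⟨integrable_finsetSum _ fun i _ => (hc i).smul_const _, ?_⟩
  rw [integral_finsetSum _ fun i _ => (hc i).smul_const _]
  exact Finset.sum_congr rfl fun i _ => integral_smul_const _ _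

/-- Differentiation under the integral over time; the gradients are probability vectors, hence
uniformly bounded. -/
theorem hasFDerivAt_heatHat (hδ : 0 < δ) (hκ : 0 < κ) (x : Fin N → ℝ) :
    HasFDerivAt (heatHat δ κ)
      (∑ i, hatProb δ κ i x • (ContinuousLinearMap.proj i : (Fin N → ℝ) →L[ℝ] ℝ)) x := by
  obtain ⟨L, hL⟩ : ∃ L : (Fin N → ℝ) → ℝ → ((Fin N → ℝ) →L[ℝ] ℝ), L = fun x s =>
      ∑ i, (Real.exp (-s) * leadProb i ((√(2 * κ * s))⁻¹ • x)) •
        (ContinuousLinearMap.proj i : (Fin N → ℝ) →L[ℝ] ℝ) := ⟨_, rfl⟩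
  have hint : ∀ x, Integrable (L x) (volume.restrict (Set.Ioi δ)) ∧
      ∫ s in Set.Ioi δ, L x s = ∑ i, (∫ s in Set.Ioi δ,
        Real.exp (-s) * leadProb i ((√(2 * κ * s))⁻¹ • x)) •
          (ContinuousLinearMap.proj i : (Fin N → ℝ) →L[ℝ] ℝ) := fun x => by
    rw [hL]
    exact integral_sum_smul_const _ fun i => expIntegrable_leadProb hδ hκ i x
  have hbound : ∀ᵐ s ∂(volume.restrict (Set.Ioi δ)), ∀ x ∈ (Set.univ : Set (Fin N → ℝ)),
      ‖L x s‖ ≤ Real.exp (-s) := by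
    refine Eventually.of_forall fun s x _ => ?_
    rw [hL]
    refine (norm_sum_smul_proj_le _).trans_eq ?_
    have h1 : ∀ i, |Real.exp (-s) * leadProb i ((√(2 * κ * s))⁻¹ • x)|
        = Real.exp (-s) * leadProb i ((√(2 * κ * s))⁻¹ • x) := fun i =>
      abs_of_nonneg (mul_nonneg (Real.exp_pos _).le (leadProb_nonneg _ _))
    simp only [h1]
    rw [← Finset.mul_sum, sum_leadProb, mul_one]
  have hdiff : ∀ᵐ s ∂(volume.restrict (Set.Ioi δ)), ∀ x ∈ (Set.univ : Set (Fin N → ℝ)),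
      HasFDerivAt (fun x => Real.exp (-s) * heat κ x (-s)) (L x s) x := by
    filter_upwards [ae_restrict_mem measurableSet_Ioi] with s hs x _
    refine ((hasFDerivAt_heat hκ (hδ.trans hs) x).const_mul (Real.exp (-s))).congr_fderiv ?_
    simp only [hL, Finset.smul_sum, smul_smul]
  have h := hasFDerivAt_integral_of_dominated_of_fderiv_le univ_mem
    (Eventually.of_forall fun x => (expIntegrable_heat hδ hκ x).aestronglyMeasurable)
    (expIntegrable_heat hδ hκ x) (hint x).1.aestronglyMeasurable hbound
    (integrableOn_exp_neg_Ioi δ) hdiff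
  have h3 : (fun x : Fin N → ℝ => Real.exp δ * ∫ s in Set.Ioi δ, Real.exp (-s) * heat κ x (-s))
      = heatHat δ κ := by
    ext x
    rw [heatHat_eq_expAvg, expAvg]
  have h2 := h.const_mul (Real.exp δ)
  rw [h3] at h2
  refine h2.congr_fderiv ?_
  rw [(hint x).2, Finset.smul_sum]
  exact Finset.sum_congr rfl fun i _ => by rw [smul_smul, hatProb, expAvg]

theorem ciSup_le_heatHat (hδ : 0 < δ) (hκ : 0 < κ) (x : Fin N → ℝ) :
    ⨆ i, x i ≤ heatHat δ κ x := by
  rw [heatHat_eq_expAvg, ← expAvg_const (δ := δ) (⨆ i, x i)]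
  exact expAvg_mono (expIntegrable_const _) (expIntegrable_heat hδ hκ x) fun s hs =>
    ciSup_le_heat hκ (hδ.trans hs) x

theorem expAvg_sqrt (hδ : 0 < δ) :
    expAvg δ (fun s => √s) = √δ + Real.exp δ * (√Real.pi / 2) * erfc √δ := by
  rw [expAvg, (integral_exp_neg_mul_sqrt hδ).2]
  have : Real.exp δ * Real.exp (-δ) = 1 := by rw [← Real.exp_add, add_neg_cancel, Real.exp_zero]
  linear_combination √δ * this

theorem heatHat_le (hδ : 0 < δ) (hκ : 0 < κ) (x : Fin N → ℝ) :
    heatHat δ κ x ≤ (⨆ i, x i) + √(2 * κ) * gaussMax N * expAvg δ fun s => √s := by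
  have hi := (expIntegrable_sqrt hδ).const_mul (√(2 * κ) * gaussMax N)
  have h0 := expAvg_add (expIntegrable_const (⨆ i, x i)) hi
  rw [expAvg_const, expAvg_const_mul] at h0
  rw [heatHat_eq_expAvg, ← h0]
  refine expAvg_mono (expIntegrable_heat hδ hκ x) ((expIntegrable_const _).add hi) fun s hs => ?_
  have := heat_le hκ (hδ.trans hs) x
  rw [sqrt_two_mul_mul hκ] at this
  linarith

omit [NeZero N] in
/-- The value of the transformed potential at the origin. -/
theorem heatHat_zero (hδ : 0 < δ) (hκ : 0 < κ) :
    heatHat δ κ (0 : Fin N → ℝ) = √(2 * κ) * gaussMax N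
      * (√δ + Real.exp δ * (√Real.pi / 2) * erfc √δ) := by
  rw [heatHat_eq_expAvg, ← expAvg_sqrt hδ, ← expAvg_const_mul, expAvg, expAvg]
  congr 1
  refine setIntegral_congr_fun measurableSet_Ioi fun s hs => ?_
  rw [heat_neg_eq hκ (hδ.trans hs), smul_zero, ← gaussMax_eq, sqrt_two_mul_mul hκ]
  ring

theorem heat_add_const (κ : ℝ) (x : Fin N → ℝ) (c : ℝ) {s : ℝ} (hκ : 0 < κ) (hs : 0 < s) :
    heat κ (fun i => x i + c) (-s) = heat κ x (-s) + c := by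
  have hσ : 0 < √(2 * κ * s) := Real.sqrt_pos.2 (by positivity)
  rw [heat_neg_eq hκ hs, heat_neg_eq hκ hs]
  have h : ∀ z : Fin N → ℝ, ∀ c : ℝ, ⨆ i, (z i + c) = (⨆ i, z i) + c := fun z c =>
    (ciSup_add (Set.finite_range z).bddAbove c).symm
  have h1 : maxAvg ((√(2 * κ * s))⁻¹ • fun i => x i + c)
      = maxAvg ((√(2 * κ * s))⁻¹ • x) + (√(2 * κ * s))⁻¹ * c := by
    have h2 : ∀ y : Fin N → ℝ, ⨆ i, ((√(2 * κ * s))⁻¹ • (fun i => x i + c) + y) i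
        = (⨆ i, ((√(2 * κ * s))⁻¹ • x + y) i) + (√(2 * κ * s))⁻¹ * c := fun y => by
      rw [← h]
      congr 1
      ext i
      simp only [Pi.smul_apply, Pi.add_apply, smul_eq_mul]
      ring
    simp only [maxAvg, gaussAvg, h2]
    rw [integral_add (integrable_ciSup_add _) (integrable_const _)]
    simp
  rw [h1]
  field_simp

theorem heatHat_add_const (hδ : 0 < δ) (hκ : 0 < κ) (x : Fin N → ℝ) (c : ℝ) :
    heatHat δ κ (fun i => x i + c) = heatHat δ κ x + c := by
  have h : expAvg δ (fun s => heat κ (fun i => x i + c) (-s))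
      = expAvg δ fun s => heat κ x (-s) + c := by
    rw [expAvg, expAvg]
    congr 1
    refine setIntegral_congr_fun measurableSet_Ioi fun s hs => ?_
    rw [heat_add_const κ x c hκ (hδ.trans hs)]
  rw [heatHat_eq_expAvg, heatHat_eq_expAvg, h,
    expAvg_add (expIntegrable_heat hδ hκ x) (expIntegrable_const c), expAvg_const]

end

/-! ### Second moments of the balanced sign vectors -/

/-- The balanced sign vectors as a finite set. -/
noncomputable def balancedFinset (N : ℕ) : Finset (Fin N → ℝ) := (balancedSigns_finite N).toFinset

section
variable {N : ℕ}

theorem mem_balancedFinset {q : Fin N → ℝ} : q ∈ balancedFinset N ↔ q ∈ balancedSigns N :=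
  Set.Finite.mem_toFinset _

theorem card_balancedFinset_pos (N : ℕ) : (0 : ℝ) < (balancedFinset N).card :=
  Nat.cast_pos.2 (Finset.card_pos.2 ((Set.Finite.toFinset_nonempty _).2 (balancedSigns_nonempty N)))

theorem neg_mem_balancedFinset {q : Fin N → ℝ} (hq : q ∈ balancedFinset N) :
    -q ∈ balancedFinset N := by
  rw [mem_balancedFinset] at *
  refine ⟨fun i => ?_, ?_⟩
  · rcases hq.1 i with h | h <;> simp [h]
  · simp only [Pi.neg_apply, Finset.sum_neg_distrib, neg_eq_iff_eq_neg, neg_neg, neg_zero]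
    rcases hq.2 with ⟨h, h'⟩ | h
    · exact Or.inl ⟨h, h'.symm⟩
    · exact Or.inr h

theorem sum_balancedFinset_neg (f : (Fin N → ℝ) → ℝ) :
    ∑ q ∈ balancedFinset N, f (-q) = ∑ q ∈ balancedFinset N, f q :=
  Finset.sum_nbij' (fun q => -q) (fun q => -q) (fun _ => neg_mem_balancedFinset)
    (fun _ => neg_mem_balancedFinset) (fun q _ => neg_neg q) (fun q _ => neg_neg q)
    (fun _ _ => rfl)

theorem comp_mem_balancedFinset (e : Equiv.Perm (Fin N)) {q : Fin N → ℝ}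
    (hq : q ∈ balancedFinset N) : q ∘ e ∈ balancedFinset N := by
  rw [mem_balancedFinset] at *
  refine ⟨fun i => hq.1 _, ?_⟩
  simp only [Function.comp_apply, Equiv.sum_comp e q]
  exact hq.2

theorem sum_balancedFinset_comp (e : Equiv.Perm (Fin N)) (f : (Fin N → ℝ) → ℝ) :
    ∑ q ∈ balancedFinset N, f (q ∘ e) = ∑ q ∈ balancedFinset N, f q :=
  Finset.sum_nbij' (fun q => q ∘ e) (fun q => q ∘ e.symm) (fun _ => comp_mem_balancedFinset e)
    (fun _ => comp_mem_balancedFinset e.symm) (fun q _ => by ext; simp) (fun q _ => by ext; simp)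
    (fun _ _ => rfl)

theorem sum_balancedFinset_odd {f : (Fin N → ℝ) → ℝ} (hf : ∀ q, f (-q) = -f q) :
    ∑ q ∈ balancedFinset N, f q = 0 := by
  have h := sum_balancedFinset_neg f
  simp only [hf, Finset.sum_neg_distrib] at h
  linarith

theorem sum_balancedFinset_eval (i : Fin N) : ∑ q ∈ balancedFinset N, q i = 0 :=
  sum_balancedFinset_odd (f := fun q => q i) fun _ => rfl

theorem sum_balancedFinset_sq (i : Fin N) :
    ∑ q ∈ balancedFinset N, q i * q i = (balancedFinset N).card := by
  have h : ∀ q ∈ balancedFinset N, q i * q i = 1 := fun q hq => by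
    rcases (mem_balancedFinset.1 hq).1 i with h | h <;> rw [h] <;> norm_num
  rw [Finset.sum_congr rfl h]
  simp

open Classical in
/-- The factor `κ_s δ / (1 - δ)`. Half the averaged second derivative over the balanced signs is
`signFactor N` times the Laplacian. -/
noncomputable def signFactor (N : ℕ) : ℝ :=
  if N = 2 then 1 else if Odd N then 1 / 2 + 1 / (2 * (N : ℝ)) else 1 / 2 + 1 / (2 * (N : ℝ) - 2)

theorem kappaS_eq (N : ℕ) (δ : ℝ) : kappaS N δ = (1 - δ) / δ * signFactor N := by
  unfold kappaS signFactor
  split_ifs <;> ring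

theorem sum_balancedFinset_mul_eq {i j k : Fin N} (hj : j ≠ i) (hk : k ≠ i) :
    ∑ q ∈ balancedFinset N, q i * q j = ∑ q ∈ balancedFinset N, q i * q k := by
  rw [← sum_balancedFinset_comp (Equiv.swap j k)]
  refine Finset.sum_congr rfl fun q _ => ?_
  rw [Function.comp_apply, Function.comp_apply, Equiv.swap_apply_of_ne_of_ne hj.symm hk.symm,
    Equiv.swap_apply_left]

theorem sum_balancedFinset_mul_sum (i j : Fin N) :
    ∑ q ∈ balancedFinset N, q i * ∑ k, q k = ∑ q ∈ balancedFinset N, q j * ∑ k, q k := by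
  rw [← sum_balancedFinset_comp (Equiv.swap i j)]
  refine Finset.sum_congr rfl fun q _ => ?_
  simp only [Function.comp_apply, Equiv.swap_apply_left, Equiv.sum_comp]

/-- The covariance of two different coordinates. By exchangeability it is determined by the value
of `∑ i, q i`. -/
theorem sum_balancedFinset_mul {i j : Fin N} (hij : j ≠ i) :
    ∑ q ∈ balancedFinset N, q i * q j = (balancedFinset N).card * (1 - 2 * signFactor N) := by
  set c := ∑ q ∈ balancedFinset N, q i * q j with hc
  set b : ℝ := ((balancedFinset N).card : ℝ)
  have hN : 2 ≤ N := by
    have := Fin.val_ne_of_ne hij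
    omega
  have hN' : (2 : ℝ) ≤ N := by exact_mod_cast hN
  have hrow : ∑ q ∈ balancedFinset N, q i * ∑ k, q k = b + (N - 1) * c := by
    simp only [Finset.mul_sum]
    rw [Finset.sum_comm, ← Finset.add_sum_erase _ _ (Finset.mem_univ i), sum_balancedFinset_sq]
    congr 1
    rw [Finset.sum_congr rfl fun k hk => sum_balancedFinset_mul_eq (Finset.ne_of_mem_erase hk) hij]
    rw [Finset.sum_const, Finset.card_erase_of_mem (Finset.mem_univ i), Finset.card_univ,
      Fintype.card_fin, nsmul_eq_mul, Nat.cast_sub (by omega), Nat.cast_one]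
  have htot : N * (b + (N - 1) * c) = ∑ q ∈ balancedFinset N, (∑ k, q k) * ∑ k, q k := by
    have h1 : ∀ q : Fin N → ℝ, (∑ k, q k) * ∑ k, q k = ∑ l, q l * ∑ k, q k := fun q =>
      Finset.sum_mul _ _ _
    simp only [h1]
    rw [Finset.sum_comm, Finset.sum_congr rfl fun l _ => sum_balancedFinset_mul_sum l i, hrow]
    rw [Finset.sum_const, Finset.card_univ, Fintype.card_fin, nsmul_eq_mul]
  rcases Nat.even_or_odd N with he | ho
  · have h0 : ∑ q ∈ balancedFinset N, (∑ k, q k) * ∑ k, q k = 0 := by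
      refine Finset.sum_eq_zero fun q hq => ?_
      rcases (mem_balancedFinset.1 hq).2 with ⟨h, -⟩ | ⟨-, h⟩
      · exact absurd he (Nat.not_even_iff_odd.2 h)
      · rw [h, mul_zero]
    rw [h0] at htot
    have h1 : b + (N - 1) * c = 0 := by
      rcases mul_eq_zero.1 htot with h | h
      · linarith
      · exact h
    have h2 : signFactor N = 1 / 2 + 1 / (2 * (N : ℝ) - 2) := by
      unfold signFactor
      split_ifs with h h'
      · rw [h]
        norm_num
      · exact absurd he (Nat.not_even_iff_odd.2 h')
      · rfl
    have h3 : (N : ℝ) - 1 ≠ 0 := by linarith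
    have h4 : (2 : ℝ) * N - 2 = 2 * (N - 1) := by ring
    rw [h2, h4]
    field_simp
    linear_combination h1
  · have h0 : ∑ q ∈ balancedFinset N, (∑ k, q k) * ∑ k, q k = b := by
      have : ∀ q ∈ balancedFinset N, (∑ k, q k) * ∑ k, q k = 1 := fun q hq => by
        rcases (mem_balancedFinset.1 hq).2 with ⟨-, h | h⟩ | ⟨h, -⟩
        · rw [h, mul_one]
        · rw [h]; norm_num
        · exact absurd h (Nat.not_even_iff_odd.2 ho)
      rw [Finset.sum_congr rfl this]
      simp [b]
    rw [h0] at htot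
    have h2 : signFactor N = 1 / 2 + 1 / (2 * (N : ℝ)) := by
      unfold signFactor
      rw [if_neg (fun h => by subst h; exact absurd ho (by decide)), if_pos ho]
    have h3 : (N : ℝ) - 1 ≠ 0 := by linarith
    have h4 : (N : ℝ) ≠ 0 := by linarith
    have h5 : ((N : ℝ) - 1) * (N * c + b) = 0 := by linear_combination htot
    have h6 : N * c + b = 0 := (mul_eq_zero.1 h5).resolve_left h3
    rw [h2]
    field_simp
    linear_combination h6

/-- On average over the balanced signs, the second derivative is a multiple of the Laplacian. -/
theorem sum_dirDeriv_two_maxAvg [NeZero N] (z : Fin N → ℝ) :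
    ∑ q ∈ balancedFinset N, dirDeriv 2 maxAvg z q
      = (balancedFinset N).card * (2 * signFactor N * leadMean z) := by
  have h1 : ∑ q ∈ balancedFinset N, dirDeriv 2 maxAvg z q
      = ∑ j, ∑ i, (∑ q ∈ balancedFinset N, q i * q j) * crossMean i j z := by
    simp only [dirDeriv_two_maxAvg, Finset.sum_mul]
    rw [Finset.sum_comm, Finset.sum_comm (s := Finset.univ) (t := Finset.univ)]
    refine Finset.sum_congr rfl fun i _ => ?_
    rw [Finset.sum_comm]
  have h2 : ∀ i j, (∑ q ∈ balancedFinset N, q i * q j) = (balancedFinset N).card *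
      ((1 - 2 * signFactor N) + if i = j then 2 * signFactor N else 0) := fun i j => by
    split_ifs with h
    · rw [h, sum_balancedFinset_sq]
      ring
    · rw [sum_balancedFinset_mul (Ne.symm h), add_zero]
  rw [h1, leadMean, Finset.mul_sum, Finset.mul_sum]
  refine Finset.sum_congr rfl fun j _ => ?_
  simp only [h2, add_mul, mul_add, mul_assoc, Finset.sum_add_distrib, ← Finset.mul_sum,
    sum_crossMean, mul_zero, zero_add]
  simp only [ite_mul, zero_mul, Finset.sum_ite_eq', Finset.mem_univ, if_true]
  ring

theorem signFactor_bounds [NeZero N] : 1 / 2 ≤ signFactor N ∧ signFactor N ≤ 1 := by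
  have hN : (1 : ℝ) ≤ N := Nat.one_le_cast.2 (NeZero.pos N)
  unfold signFactor
  split_ifs with h h'
  · norm_num
  · constructor
    · have : 0 ≤ 1 / (2 * (N : ℝ)) := by positivity
      linarith
    · have : 1 / (2 * (N : ℝ)) ≤ 1 / 2 := one_div_le_one_div_of_le (by norm_num) (by linarith)
      linarith
  · have h4 : (4 : ℝ) ≤ N := by
      have := NeZero.pos N
      have he := Nat.not_odd_iff_even.1 h'
      obtain ⟨k, hk⟩ := he
      have : 4 ≤ N := by omega
      exact_mod_cast this
    constructor
    · have : 0 ≤ 1 / (2 * (N : ℝ) - 2) := one_div_nonneg.2 (by linarith)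
      linarith
    · have : 1 / (2 * (N : ℝ) - 2) ≤ 1 / 2 := one_div_le_one_div_of_le (by norm_num) (by linarith)
      linarith

end

/-! ### The potentials over one round -/

section
variable {N : ℕ} [NeZero N] {δ κ : ℝ}

theorem contDiff_heat (k : ℕ) (hκ : 0 < κ) {s : ℝ} (hs : 0 < s) :
    ContDiff ℝ k fun x : Fin N → ℝ => heat κ x (-s) := by
  rw [heat_neg_eq_fun hκ hs]
  exact contDiff_scale_maxAvg k _

theorem dirDeriv_one_heat (hκ : 0 < κ) {s : ℝ} (hs : 0 < s) (x q : Fin N → ℝ) :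
    dirDeriv 1 (fun x => heat κ x (-s)) x q
      = ∑ i, q i * leadProb i ((√(2 * κ * s))⁻¹ • x) := by
  rw [dirDeriv_one, (hasFDerivAt_heat hκ hs x).fderiv]
  simp [mul_comm]

theorem dirDeriv_two_heat (hκ : 0 < κ) {s : ℝ} (hs : 0 < s) (x q : Fin N → ℝ) :
    dirDeriv 2 (fun x => heat κ x (-s)) x q
      = (√(2 * κ * s))⁻¹ * dirDeriv 2 maxAvg ((√(2 * κ * s))⁻¹ • x) q := by
  have hσ : 0 < √(2 * κ * s) := Real.sqrt_pos.2 (by positivity)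
  rw [heat_neg_eq_fun hκ hs, dirDeriv_scale_maxAvg]
  field_simp

omit [NeZero N] in
theorem ThirdBound.nonneg {K : ℝ} (h : ThirdBound N κ K) : 0 ≤ K := by
  have := h (-1) (by norm_num) 0 0 (fun i => by simp)
  simpa using (abs_nonneg _).trans this

omit [NeZero N] in
theorem ThirdBound.abs_dirDeriv_le {K : ℝ} (h : ThirdBound N κ K) {s : ℝ} (hs : 0 < s)
    (y : Fin N → ℝ) {q : Fin N → ℝ} (hq : q ∈ cube N) :
    |dirDeriv 3 (fun x => heat κ x (-s)) y q| ≤ K * (1 / s) := by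
  have := h (-s) (by linarith) y q hq
  rwa [abs_neg, abs_of_pos hs, div_eq_mul_one_div] at this

theorem neg_mem_cube {N : ℕ} {q : Fin N → ℝ} (hq : q ∈ cube N) : -q ∈ cube N := fun i => by
  rw [Pi.neg_apply, abs_neg]
  exact hq i

/-- Second-order Taylor expansion of the heat potential. -/
theorem heat_sub_eq (hκ : 0 < κ) {s : ℝ} (hs : 0 < s) (x q : Fin N → ℝ) :
    ∃ y, heat κ (x - q) (-s) = heat κ x (-s) - ∑ i, q i * leadProb i ((√(2 * κ * s))⁻¹ • x)
      + (√(2 * κ * s))⁻¹ * dirDeriv 2 maxAvg ((√(2 * κ * s))⁻¹ • x) q / 2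
      + dirDeriv 3 (fun x => heat κ x (-s)) y (-q) / 6 := by
  obtain ⟨y, hy⟩ := taylor_dirDeriv 2 (contDiff_heat 3 hκ hs) x (-q)
  refine ⟨y, ?_⟩
  rw [← sub_eq_add_neg] at hy
  rw [hy]
  simp only [Finset.sum_range_succ, Finset.sum_range_zero, dirDeriv_zero, Nat.factorial]
  rw [dirDeriv_neg 1, dirDeriv_neg 2, dirDeriv_one_heat hκ hs, dirDeriv_two_heat hκ hs]
  push_cast
  ring

/-- One step `q` of the adversary against the leading probabilities: the first-order term cancels,
and on the cube the second-order term is at most the Laplacian, which integration by parts turns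
into the cost of stopping. -/
theorem heatHat_sub_le (hδ : 0 < δ) (hδ1 : δ < 1) (hκ : 0 < κ) {K : ℝ} (hK : ThirdBound N κ K)
    (x : Fin N → ℝ) {q : Fin N → ℝ} (hq : q ∈ cube N) :
    heatHat δ κ (x - q) + ∑ i, q i * hatProb δ κ i x
      ≤ heatHat δ κ x + (heatHat δ κ x - heat κ x (-δ)) / κ
        + K / 6 * (1 + Real.log (1 / δ)) := by
  have hP := fun i => (expIntegrable_leadProb hδ hκ i x).const_mul (q i)
  have hPs := ExpIntegrable.sum (t := Finset.univ) fun i _ => hP i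
  have hV := expIntegrable_heat hδ hκ x
  have hV' := expIntegrable_heat hδ hκ (x - q)
  have hL := expIntegrable_heatLaplacian hδ hκ x
  have hr : ExpIntegrable δ fun s => K / 6 * (1 / s) :=
    ExpIntegrable.const_mul (integrableOn_exp_neg_div hδ) _
  have key := expAvg_mono (hV'.add hPs) ((hV.add hL).add hr) fun s hs => by
    have hs0 : 0 < s := hδ.trans hs
    obtain ⟨y, hy⟩ := heat_sub_eq hκ hs0 x q
    have h3 := (abs_le.1 (hK.abs_dirDeriv_le hs0 y (neg_mem_cube hq))).2
    have h2 := dirDeriv_two_maxAvg_le ((√(2 * κ * s))⁻¹ • x) hq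
    have hσ : 0 ≤ (√(2 * κ * s))⁻¹ := by positivity
    have h4 := mul_le_mul_of_nonneg_left h2 hσ
    rw [hy, heatLaplacian]
    linarith
  rw [expAvg_add hV' hPs, expAvg_add (hV.add hL) hr, expAvg_add hV hL,
    expAvg_sum fun i _ => hP i, expAvg_const_mul, ← heatHat_eq_expAvg, ← heatHat_eq_expAvg] at key
  simp only [expAvg_const_mul] at key
  have h1 := expAvg_heatLaplacian hδ hκ x
  have h2 : expAvg δ (heatLaplacian κ x) = (heatHat δ κ x - heat κ x (-δ)) / κ := by
    rw [← h1]
    field_simp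
  have h3 : expAvg δ (fun s => 1 / s) ≤ 1 + Real.log (1 / δ) := integral_exp_neg_div_le hδ hδ1
  have h4 : K / 6 * expAvg δ (fun s => 1 / s) ≤ K / 6 * (1 + Real.log (1 / δ)) := by
    have := hK.nonneg
    gcongr
  have h5 : expAvg δ (fun s => heatLaplacian κ x s) = expAvg δ (heatLaplacian κ x) := rfl
  rw [h5, h2] at key
  simp only [hatProb]
  linarith

omit [NeZero N] in
theorem sum_balancedFinset_linear (c : Fin N → ℝ) :
    ∑ q ∈ balancedFinset N, ∑ i, q i * c i = 0 :=
  sum_balancedFinset_odd (f := fun q => ∑ i, q i * c i) fun q => by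
    simp [Finset.sum_neg_distrib]

/-- Integrated form of a lower bound for the average of the heat potential over one step of the
balanced walk, with a remainder `r`. -/
theorem sum_heatHat_sub_ge (hδ : 0 < δ) (hκ : 0 < κ) (x : Fin N → ℝ) {r : ℝ → ℝ}
    (hr : ExpIntegrable δ r)
    (h : ∀ s, δ < s → (balancedFinset N).card * (heat κ x (-s)
      + signFactor N * heatLaplacian κ x s - r s) ≤ ∑ q ∈ balancedFinset N, heat κ (x - q) (-s)) :
    (balancedFinset N).card * (heatHat δ κ x
      + signFactor N * ((heatHat δ κ x - heat κ x (-δ)) / κ) - expAvg δ r)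
      ≤ ∑ q ∈ balancedFinset N, heatHat δ κ (x - q) := by
  have hV := expIntegrable_heat hδ hκ x
  have hL := (expIntegrable_heatLaplacian hδ hκ x).const_mul (signFactor N)
  have hr' := hr.const_mul (-1)
  have hV' := fun q => expIntegrable_heat hδ hκ (x - q)
  have key := expAvg_mono (((hV.add hL).add hr').const_mul (balancedFinset N).card)
    (ExpIntegrable.sum (t := balancedFinset N) fun q _ => hV' q) fun s hs => by
    refine le_trans (le_of_eq ?_) (h s hs)
    ring
  rw [expAvg_const_mul, expAvg_add (hV.add hL) hr', expAvg_add hV hL, expAvg_const_mul,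
    expAvg_const_mul, expAvg_sum fun q _ => hV' q, ← heatHat_eq_expAvg] at key
  have h1 := expAvg_heatLaplacian hδ hκ x
  have h2 : expAvg δ (heatLaplacian κ x) = (heatHat δ κ x - heat κ x (-δ)) / κ := by
    rw [← h1]
    field_simp
  rw [← h2]
  simp only [heatHat_eq_expAvg δ κ (x - _)]
  have h5 : expAvg δ (fun s => heatLaplacian κ x s) = expAvg δ (heatLaplacian κ x) := rfl
  rw [h5] at key
  linarith

theorem sum_dirDeriv_two_heat (x : Fin N → ℝ) (s : ℝ) :
    ∑ q ∈ balancedFinset N, (√(2 * κ * s))⁻¹ * dirDeriv 2 maxAvg ((√(2 * κ * s))⁻¹ • x) q / 2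
      = (balancedFinset N).card * (signFactor N * heatLaplacian κ x s) := by
  rw [← Finset.sum_div, ← Finset.mul_sum, sum_dirDeriv_two_maxAvg, heatLaplacian]
  ring

/-- With third derivatives: the first-order term cancels by symmetry. -/
theorem sum_heat_sub_ge_third (hκ : 0 < κ) {K : ℝ} (hK : ThirdBound N κ K) (x : Fin N → ℝ) {s : ℝ}
    (hs : 0 < s) : (balancedFinset N).card * (heat κ x (-s) + signFactor N * heatLaplacian κ x s
      - K / 6 * (1 / s)) ≤ ∑ q ∈ balancedFinset N, heat κ (x - q) (-s) := by
  have h1 : ∑ q ∈ balancedFinset N, (heat κ x (-s)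
      - ∑ i, q i * leadProb i ((√(2 * κ * s))⁻¹ • x)
      + (√(2 * κ * s))⁻¹ * dirDeriv 2 maxAvg ((√(2 * κ * s))⁻¹ • x) q / 2 - K / 6 * (1 / s))
      ≤ ∑ q ∈ balancedFinset N, heat κ (x - q) (-s) := by
    refine Finset.sum_le_sum fun q hq => ?_
    obtain ⟨y, hy⟩ := heat_sub_eq hκ hs x q
    have hc := neg_mem_cube (balancedSigns_subset_cube N (mem_balancedFinset.1 hq))
    have h3 := (abs_le.1 (hK.abs_dirDeriv_le hs y hc)).1
    rw [hy]
    linarith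
  rw [Finset.sum_sub_distrib, Finset.sum_add_distrib, Finset.sum_sub_distrib,
    sum_balancedFinset_linear, sum_dirDeriv_two_heat] at h1
  simp only [Finset.sum_const, nsmul_eq_mul] at h1
  linarith

/-- With fourth derivatives: the odd terms of the Taylor expansion cancel by symmetry. -/
theorem sum_heat_sub_ge_fourth (hκ : 0 < κ) {K : ℝ} (hK : FourthBound N κ K) (x : Fin N → ℝ)
    {s : ℝ} (hs : 0 < s) :
    (balancedFinset N).card * (heat κ x (-s) + signFactor N * heatLaplacian κ x s
      - K / 24 * (1 / s ^ (3 / 2 : ℝ))) ≤ ∑ q ∈ balancedFinset N, heat κ (x - q) (-s) := by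
  have h1 : ∑ q ∈ balancedFinset N, (heat κ x (-s)
      - ∑ i, q i * leadProb i ((√(2 * κ * s))⁻¹ • x)
      + (√(2 * κ * s))⁻¹ * dirDeriv 2 maxAvg ((√(2 * κ * s))⁻¹ • x) q / 2
      + dirDeriv 3 (fun x => heat κ x (-s)) x (-q) / 6 - K / 24 * (1 / s ^ (3 / 2 : ℝ)))
      ≤ ∑ q ∈ balancedFinset N, heat κ (x - q) (-s) := by
    refine Finset.sum_le_sum fun q hq => ?_
    obtain ⟨y, hy⟩ := taylor_dirDeriv 3 (contDiff_heat 4 hκ hs) x (-q)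
    rw [← sub_eq_add_neg] at hy
    rw [hy]
    simp only [Finset.sum_range_succ, Finset.sum_range_zero, dirDeriv_zero, Nat.factorial]
    rw [dirDeriv_neg 1, dirDeriv_neg 2, dirDeriv_one_heat hκ hs, dirDeriv_two_heat hκ hs]
    have h4 := hK (-s) (by linarith) y (-q)
      (mem_balancedFinset.1 (neg_mem_balancedFinset hq)).1
    rw [abs_neg, abs_of_pos hs, div_eq_mul_one_div] at h4
    have h5 := (abs_le.1 h4).1
    have h6 : dirDeriv 4 (fun x => heat κ x (-s)) y (-q)
      = iteratedFDeriv ℝ 4 (fun x => heat κ x (-s)) y fun _ => -q := rfl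
    rw [← h6] at h5
    push_cast
    linarith
  have hodd : ∑ q ∈ balancedFinset N, dirDeriv 3 (fun x => heat κ x (-s)) x (-q) / 6 = 0 :=
    sum_balancedFinset_odd (f := fun q => dirDeriv 3 (fun x => heat κ x (-s)) x (-q) / 6)
      fun q => by
        rw [dirDeriv_neg 3 _ _ (-q)]
        ring
  rw [Finset.sum_sub_distrib, Finset.sum_add_distrib, Finset.sum_add_distrib,
    Finset.sum_sub_distrib, sum_balancedFinset_linear, sum_dirDeriv_two_heat, hodd] at h1
  simp only [Finset.sum_const, nsmul_eq_mul] at h1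
  linarith

theorem kappaS_pos (hδ : 0 < δ) (hδ1 : δ < 1) : 0 < kappaS N δ := by
  rw [kappaS_eq]
  have := (signFactor_bounds (N := N)).1
  have : 0 < (1 - δ) / δ := div_pos (by linarith) hδ
  positivity

theorem kappaU_pos (hδ : 0 < δ) (hδ1 : δ < 1) : 0 < kappaU δ := div_pos (by linarith) hδ

/-- The average of the potential `û^h` over one round of the heat adversary, weighted with the
probability `1 - δ` to continue, is at least the potential less the reward for stopping, up to
the error term. -/
theorem heatLower_step (hδ : 0 < δ) (hδ1 : δ < 1) {E : ℝ} (hE : IsLowerErr N δ E)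
    (x : Fin N → ℝ) :
    (balancedFinset N).card * (heatLower δ x - δ * ((⨆ i, x i) + E))
      ≤ (1 - δ) * ∑ q ∈ balancedFinset N, heatLower δ (x - q) := by
  have hκ := kappaS_pos (N := N) hδ hδ1
  have hb := card_balancedFinset_pos N
  have hγ : 0 < signFactor N := by linarith [(signFactor_bounds (N := N)).1]
  have hd : 0 < 1 - δ := by linarith
  obtain ⟨r, hr⟩ : ∃ r : ℝ, (1 - δ) * r ≤ δ * E ∧ (balancedFinset N).card *
      (heatHat δ (kappaS N δ) x + signFactor N *
        ((heatHat δ (kappaS N δ) x - heat (kappaS N δ) x (-δ)) / kappaS N δ) - r)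
      ≤ ∑ q ∈ balancedFinset N, heatHat δ (kappaS N δ) (x - q) := by
    rcases hE with ⟨K, hK, rfl⟩ | ⟨K, hK, rfl⟩
    · refine ⟨_, ?_, sum_heatHat_sub_ge hδ hκ x
        (ExpIntegrable.const_mul (integrableOn_exp_neg_div hδ) _)
        fun s hs => sum_heat_sub_ge_third hκ hK x (hδ.trans hs)⟩
      rw [expAvg_const_mul, err3]
      have h1 : expAvg δ (fun s => 1 / s) ≤ 1 + Real.log (1 / δ) := integral_exp_neg_div_le hδ hδ1
      have h2 := hK.nonneg
      calc (1 - δ) * (K / 6 * expAvg δ fun s => 1 / s)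
          ≤ (1 - δ) * (K / 6 * (1 + Real.log (1 / δ))) := by gcongr
        _ = _ := by field_simp
    · refine ⟨_, ?_, sum_heatHat_sub_ge hδ hκ x
        (ExpIntegrable.const_mul (integral_exp_neg_div_rpow hδ).1 _)
        fun s hs => sum_heat_sub_ge_fourth hκ hK x (hδ.trans hs)⟩
      rw [expAvg_const_mul, err4, expAvg, (integral_exp_neg_div_rpow hδ).2]
      apply le_of_eq
      field_simp
  have hfac : (1 - δ) * (signFactor N / kappaS N δ) = δ := by
    rw [kappaS_eq]
    field_simp
  have hheat := heat_le hκ hδ x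
  simp only [heatLower, heatConst, Finset.sum_sub_distrib, Finset.sum_const, nsmul_eq_mul]
  set b : ℝ := ((balancedFinset N).card : ℝ)
  set A := heatHat δ (kappaS N δ) x
  set H := heat (kappaS N δ) x (-δ)
  set C := √(2 * kappaS N δ * δ) * gaussMax N
  have h1 := mul_le_mul_of_nonneg_left hr.2 hd.le
  have h2 : (1 - δ) * (b * (A + signFactor N * ((A - H) / kappaS N δ) - r))
      = b * (A - δ * H - (1 - δ) * r) := by
    linear_combination b * (A - H) * hfac
  rw [h2] at h1
  have h3 : b * (A - δ * ((⨆ i, x i) + C) - δ * E) ≤ b * (A - δ * H - (1 - δ) * r) := by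
    have := hr.1
    have h4 : δ * H ≤ δ * ((⨆ i, x i) + C) := by gcongr
    exact mul_le_mul_of_nonneg_left (by linarith) (Nat.cast_nonneg _)
  linarith

/-- The potential `ŵ^h` after one round of the heat player against any vector `q`, weighted with
the probability `1 - δ` to continue, is at most the potential less the reward for stopping, up to
the error term. -/
theorem heatUpper_step (hδ : 0 < δ) (hδ1 : δ < 1) {E : ℝ} (hE : IsUpperErr N δ E)
    (x : Fin N → ℝ) {q : Fin N → ℝ} (hq : q ∈ cube N) :
    (1 - δ) * (heatUpper δ (x - q) + ∑ i, q i * hatProb δ (kappaU δ) i x)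
      ≤ heatUpper δ x - δ * ((⨆ i, x i) - E) := by
  obtain ⟨K, hK, rfl⟩ := hE
  have hκ := kappaU_pos hδ hδ1
  have hd : 0 < 1 - δ := by linarith
  have key := mul_le_mul_of_nonneg_left (heatHat_sub_le hδ hδ1 hκ hK x hq) hd.le
  have hheat := ciSup_le_heat hκ hδ x
  have hC : 0 ≤ heatConst N δ (kappaU δ) := mul_nonneg (Real.sqrt_nonneg _) gaussMax_nonneg
  have hfac : (1 - δ) / kappaU δ = δ := by
    rw [kappaU]
    field_simp
  have herr : δ * err3 δ K = (1 - δ) * (K / 6 * (1 + Real.log (1 / δ))) := by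
    rw [err3]
    field_simp
  simp only [heatUpper]
  set A := heatHat δ (kappaU δ) x
  set H := heat (kappaU δ) x (-δ)
  set C := heatConst N δ (kappaU δ)
  have h2 : (1 - δ) * (A + (A - H) / kappaU δ + K / 6 * (1 + Real.log (1 / δ)))
      = A - δ * H + δ * err3 δ K := by
    rw [herr]
    linear_combination (A - H) * hfac
  rw [h2] at key
  have h3 : δ * (⨆ i, x i) ≤ δ * H := by gcongr
  have h4 : 0 ≤ δ * C := by positivity
  linarith

end

/-! ### The law of the game -/

section
variable {N : ℕ}

instance (p : Player N) (t : ℕ) : IsMarkovKernel (p.kernel t) := p.markov t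

instance (a : Adversary N) (t : ℕ) : IsMarkovKernel (a.kernel t) := a.markov t

theorem measurable_snoc (t : ℕ) : Measurable fun z : History N t × Round N =>
    (Fin.snoc (α := fun _ => Round N) z.1 z.2 : History N (t + 1)) := by
  refine measurable_pi_lambda _ fun τ => ?_
  induction τ using Fin.lastCases with
  | last => simpa using measurable_snd
  | cast τ =>
    simp only [Fin.snoc_castSucc]
    exact (measurable_pi_apply τ).comp measurable_fst

instance isProbabilityMeasure_law (p : Player N) (a : Adversary N) :
    ∀ t, IsProbabilityMeasure (law p a t)
  | 0 => by
    rw [law]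
    infer_instance
  | t + 1 => by
    have := isProbabilityMeasure_law p a t
    rw [law]
    exact Measure.isProbabilityMeasure_map (measurable_snoc t).aemeasurable

theorem cumRegret_snoc {t : ℕ} (h : History N t) (z : Round N) :
    cumRegret (Fin.snoc (α := fun _ => Round N) h z : History N (t + 1))
      = cumRegret h + fun i => z.1 z.2 - z.1 i := by
  funext i
  simp [cumRegret, Fin.sum_univ_castSucc]
  ring

theorem measurableSet_cube : MeasurableSet (cube N) := by
  have : cube N = ⋂ i, {q : Fin N → ℝ | |q i| ≤ 1} := by
    ext q
    simp [cube]
  rw [this]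
  exact MeasurableSet.iInter fun i =>
    measurableSet_le (measurable_pi_apply i).abs measurable_const

theorem ae_law_mem_cube (p : Player N) (a : Adversary N) :
    ∀ t, ∀ᵐ h ∂(law p a t), ∀ τ, (h τ).1 ∈ cube N
  | 0 => by simp
  | t + 1 => by
    have hm : ∀ t : ℕ, MeasurableSet {h : History N t | ∀ τ, (h τ).1 ∈ cube N} := fun t => by
      simp only [Set.ofPred_forall]
      exact MeasurableSet.iInter fun τ =>
        (measurable_fst.comp (measurable_pi_apply τ)) measurableSet_cube
    rw [law, ae_map_iff (measurable_snoc t).aemeasurable (hm _)]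
    refine (Measure.ae_compProd_iff (measurable_snoc t (hm (t + 1)))).2 ?_
    filter_upwards [ae_law_mem_cube p a t] with h hh
    rw [Kernel.prod_apply]
    filter_upwards [Measure.quasiMeasurePreserving_fst.ae (a.mem_cube t h)] with z hz
    intro τ
    induction τ using Fin.lastCases with
    | last => simpa using hz
    | cast τ => simpa using hh τ

theorem norm_le_one_of_mem_cube {q : Fin N → ℝ} (hq : q ∈ cube N) : ‖q‖ ≤ 1 :=
  (pi_norm_le_iff_of_nonneg zero_le_one).2 hq

theorem norm_cumRegret_le {t : ℕ} {h : History N t} (hh : ∀ τ, (h τ).1 ∈ cube N) :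
    ‖cumRegret h‖ ≤ 2 * t := by
  refine (pi_norm_le_iff_of_nonneg (by positivity)).2 fun i => ?_
  refine (Finset.abs_sum_le_sum_abs _ _).trans ?_
  refine (Finset.sum_le_card_nsmul _ _ 2 fun τ _ => ?_).trans (by simp [mul_comm])
  have h1 := abs_le.1 (hh τ (h τ).2)
  have h2 := abs_le.1 (hh τ i)
  exact abs_le.2 ⟨by linarith, by linarith⟩

/-- The properties that the maximum of the coordinates shares with the potentials: measurability,
growth, and the law `f (x + c 𝟙) = f x + c`. -/
structure IsPotential (f : (Fin N → ℝ) → ℝ) : Prop where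
  measurable : Measurable f
  bound : ∃ A, ∀ y, |f y| ≤ A + ‖y‖
  add_const : ∀ (y : Fin N → ℝ) (c : ℝ), f (fun i => y i + c) = f y + c

variable {f : (Fin N → ℝ) → ℝ}

theorem ae_law_norm_le (p : Player N) (a : Adversary N) (x : Fin N → ℝ) (t : ℕ) :
    ∀ᵐ h ∂(law p a t), ‖x + cumRegret h‖ ≤ ‖x‖ + 2 * t := by
  filter_upwards [ae_law_mem_cube p a t] with h hh
  exact (norm_add_le _ _).trans (by linarith [norm_cumRegret_le hh])

theorem IsPotential.integrable_law (hf : IsPotential f) (p : Player N) (a : Adversary N)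
    (x : Fin N → ℝ) (t : ℕ) : Integrable (fun h => f (x + cumRegret h)) (law p a t) := by
  obtain ⟨A, hA⟩ := hf.bound
  refine Integrable.of_bound (hf.measurable.comp (measurable_cumRegret x)).aestronglyMeasurable
    (A + (‖x‖ + 2 * t)) ?_
  filter_upwards [ae_law_norm_le p a x t] with h hh
  exact (hA _).trans (by linarith)

theorem IsPotential.abs_integral_law_le {A : ℝ} (hA : ∀ y, |f y| ≤ A + ‖y‖) (p : Player N)
    (a : Adversary N) (x : Fin N → ℝ) (t : ℕ) :
    |∫ h, f (x + cumRegret h) ∂(law p a t)| ≤ A + ‖x‖ + 2 * t := by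
  have := norm_integral_le_of_norm_le_const (μ := law p a t)
    (f := fun h => f (x + cumRegret h)) (C := A + ‖x‖ + 2 * t) (by
      filter_upwards [ae_law_norm_le p a x t] with h hh
      exact (hA _).trans (by linarith))
  simpa using this

theorem sum_real_singleton {μ : Measure (Fin N)} [IsProbabilityMeasure μ] :
    ∑ i, μ.real {i} = 1 := by
  simp

/-- Since `q_I 𝟙` only adds a constant to the cumulative regret, the player enters the expectation
of a potential through the mean of `q_I` alone. -/
theorem integral_round (hf : IsPotential f) {μ : Measure (Fin N → ℝ)} [IsProbabilityMeasure μ]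
    (hμ : ∀ᵐ q ∂μ, q ∈ cube N) (ν : Measure (Fin N)) [IsProbabilityMeasure ν] (y : Fin N → ℝ) :
    Integrable (fun q => ∑ i, ν.real {i} * q i + f (y - q)) μ ∧
    ∫ z : Round N, f (y + fun i => z.1 z.2 - z.1 i) ∂(μ.prod ν)
      = ∫ q, (∑ i, ν.real {i} * q i + f (y - q)) ∂μ := by
  obtain ⟨A, hA⟩ := hf.bound
  have hshift : ∀ z : Round N, f (y + fun i => z.1 z.2 - z.1 i) = z.1 z.2 + f (y - z.1) :=
    fun z => by
      rw [add_comm (z.1 z.2), ← hf.add_const]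
      congr 1
      funext i
      simp only [Pi.add_apply, Pi.sub_apply]
      ring
  have hmf : Measurable fun q => f (y - q) :=
    hf.measurable.comp (measurable_const.sub measurable_id)
  have hbf : ∀ q ∈ cube N, |f (y - q)| ≤ A + (‖y‖ + 1) := fun q hq =>
    (hA _).trans (by linarith [norm_sub_le y q, norm_le_one_of_mem_cube hq])
  have hint : Integrable (fun z : Round N => z.1 z.2 + f (y - z.1)) (μ.prod ν) := by
    have hm : Measurable fun z : Round N => z.1 z.2 :=
      measurable_from_prod_countable_left fun k => measurable_pi_apply k
    refine Integrable.of_bound (hm.add (hmf.comp measurable_fst)).aestronglyMeasurable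
      (1 + (A + (‖y‖ + 1))) ?_
    filter_upwards [Measure.quasiMeasurePreserving_fst.ae hμ] with z hz
    exact (norm_add_le _ _).trans (add_le_add (hz _) (hbf _ hz))
  have hinner : ∀ q : Fin N → ℝ, ∫ i, (q i + f (y - q)) ∂ν
      = ∑ i, ν.real {i} * q i + f (y - q) := fun q => by
    rw [integral_fintype (Integrable.of_finite)]
    simp only [smul_eq_mul, mul_add, Finset.sum_add_distrib]
    rw [← Finset.sum_mul, sum_real_singleton, one_mul]
  refine ⟨?_, ?_⟩
  · have := hint.integral_prod_left
    simpa only [hinner] using this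
  · simp only [hshift]
    rw [integral_prod _ hint]
    simp only [hinner]

/-- The effect of one round on the expectation of a potential. -/
theorem integral_law_succ (hf : IsPotential f) (p : Player N) (a : Adversary N)
    (x : Fin N → ℝ) (t : ℕ) :
    Integrable (fun h => ∫ q, (∑ i, (p.kernel t h).real {i} * q i + f (x + cumRegret h - q))
      ∂(a.kernel t h)) (law p a t) ∧
    ∫ h, f (x + cumRegret h) ∂(law p a (t + 1))
      = ∫ h, ∫ q, (∑ i, (p.kernel t h).real {i} * q i + f (x + cumRegret h - q))
        ∂(a.kernel t h) ∂(law p a t) := by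
  have hm : Measurable fun h : History N (t + 1) => f (x + cumRegret h) :=
    hf.measurable.comp (measurable_cumRegret x)
  have hint := hf.integrable_law p a x (t + 1)
  have hround := fun h => (integral_round hf (a.mem_cube t h) (p.kernel t h) (x + cumRegret h)).2
  rw [law] at hint ⊢
  rw [integrable_map_measure hm.aestronglyMeasurable (measurable_snoc t).aemeasurable] at hint
  rw [integral_map (measurable_snoc t).aemeasurable hm.aestronglyMeasurable]
  simp only [Function.comp_def, cumRegret_snoc, ← add_assoc] at hint ⊢
  rw [Measure.integral_compProd hint]
  rw [Measure.compProd] at hint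
  have hi := hint.integral_compProd
  simp only [Kernel.const_apply, Kernel.prodMkLeft_apply, Kernel.prod_apply, hround] at hi ⊢
  exact ⟨hi, trivial⟩

end

/-! ### Geometric sums -/

section
variable {δ : ℝ}

theorem tsum_geometric_weight (hδ : 0 < δ) (hδ1 : δ < 1) : ∑' n : ℕ, δ * (1 - δ) ^ n = 1 := by
  rw [tsum_mul_left, tsum_geometric_of_lt_one (by linarith) (by linarith), sub_sub_cancel,
    mul_inv_cancel₀ hδ.ne']

theorem summable_geometric_weight (hδ : 0 < δ) (hδ1 : δ < 1) :
    Summable fun n : ℕ => δ * (1 - δ) ^ n :=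
  (summable_geometric_of_lt_one (by linarith) (by linarith)).mul_left _

theorem summable_geometric_weight_linear (hδ : 0 < δ) (hδ1 : δ < 1) (A B : ℝ) :
    Summable fun n : ℕ => δ * (1 - δ) ^ n * (A + B * n) := by
  have hn : ‖1 - δ‖ < 1 := by
    rw [Real.norm_eq_abs, abs_lt]
    constructor <;> linarith
  have h1 := (summable_geometric_weight hδ hδ1).mul_right A
  have h2 := (summable_pow_mul_geometric_of_norm_lt_one 1 hn).mul_left (δ * B)
  refine (h1.add h2).congr fun n => ?_
  rw [pow_one]
  ring

theorem summable_geometric_weight_mul (hδ : 0 < δ) (hδ1 : δ < 1) {F : ℕ → ℝ} {A B : ℝ}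
    (hF : ∀ n, |F n| ≤ A + B * n) : Summable fun n : ℕ => δ * (1 - δ) ^ n * F n := by
  have hd : 0 ≤ 1 - δ := by linarith
  refine Summable.of_norm_bounded (summable_geometric_weight_linear hδ hδ1 A B) fun n => ?_
  rw [norm_mul, Real.norm_of_nonneg (by positivity)]
  exact mul_le_mul_of_nonneg_left (hF n) (by positivity)

theorem tendsto_pow_mul_linear (hδ : 0 < δ) (hδ1 : δ < 1) {w : ℕ → ℝ} {A B : ℝ}
    (hw : ∀ n, |w n| ≤ A + B * n) : Tendsto (fun n => (1 - δ) ^ n * w n) atTop (𝓝 0) := by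
  have h := (summable_geometric_weight_mul hδ hδ1 hw).tendsto_atTop_zero.const_mul δ⁻¹
  rw [mul_zero] at h
  refine h.congr fun n => ?_
  field_simp

/-- A potential that decreases on average bounds the geometrically stopped rewards from above. -/
theorem tsum_le_of_step (hδ : 0 < δ) (hδ1 : δ < 1) {w F : ℕ → ℝ} {E A B A' B' : ℝ}
    (hw : ∀ n, |w n| ≤ A + B * n) (hF : ∀ n, |F n| ≤ A' + B' * n)
    (h : ∀ n, (1 - δ) * w (n + 1) ≤ w n - δ * (F n - E)) :
    ∑' n, δ * (1 - δ) ^ n * F n ≤ w 0 + E := by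
  have hd : 0 ≤ 1 - δ := by linarith
  have hp : ∀ n, ∑ k ∈ Finset.range n, δ * (1 - δ) ^ k * (F k - E) ≤ w 0 - (1 - δ) ^ n * w n := by
    intro n
    induction n with
    | zero => simp
    | succ n ih =>
      rw [Finset.sum_range_succ, pow_succ]
      have := mul_le_mul_of_nonneg_left (h n) (pow_nonneg hd n)
      linarith
  have hs1 := summable_geometric_weight_mul hδ hδ1 hF
  have hs2 := (summable_geometric_weight hδ hδ1).mul_right E
  have hs : HasSum (fun k => δ * (1 - δ) ^ k * (F k - E))
      (∑' n, δ * (1 - δ) ^ n * F n - E) := by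
    have := hs1.hasSum.sub hs2.hasSum
    rw [tsum_mul_right, tsum_geometric_weight hδ hδ1, one_mul] at this
    simpa only [mul_sub] using this
  have hlim : Tendsto (fun n => w 0 - (1 - δ) ^ n * w n) atTop (𝓝 (w 0 - 0)) :=
    tendsto_const_nhds.sub (tendsto_pow_mul_linear hδ hδ1 hw)
  have := le_of_tendsto_of_tendsto' hs.tendsto_sum_nat hlim hp
  linarith

/-- A potential that increases on average bounds the geometrically stopped rewards from below. -/
theorem le_tsum_of_step (hδ : 0 < δ) (hδ1 : δ < 1) {w F : ℕ → ℝ} {E A B A' B' : ℝ}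
    (hw : ∀ n, |w n| ≤ A + B * n) (hF : ∀ n, |F n| ≤ A' + B' * n)
    (h : ∀ n, w n - δ * (F n + E) ≤ (1 - δ) * w (n + 1)) :
    w 0 - E ≤ ∑' n, δ * (1 - δ) ^ n * F n := by
  have := tsum_le_of_step hδ hδ1 (w := fun n => -w n) (F := fun n => -F n) (E := E)
    (fun n => by rw [abs_neg]; exact hw n) (fun n => by rw [abs_neg]; exact hF n)
    (fun n => by have := h n; linarith)
  simp only [mul_neg, tsum_neg] at this
  linarith

end

/-! ### Regret and potentials -/

section
variable {N : ℕ} [NeZero N] {δ : ℝ}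

theorem ciSup_add_const (y : Fin N → ℝ) (c : ℝ) : (⨆ i, (y i + c)) = (⨆ i, y i) + c :=
  le_antisymm (ciSup_le fun i => by linarith [le_ciSup_fin y i]) (by
    rw [← le_sub_iff_add_le]
    exact ciSup_le fun i => by linarith [le_ciSup_fin (fun i => y i + c) i])

theorem isPotential_ciSup : IsPotential fun y : Fin N → ℝ => ⨆ i, y i where
  measurable := measurable_ciSup_fin
  bound := ⟨0, fun y => by simpa using abs_ciSup_le_norm y⟩
  add_const := ciSup_add_const

theorem continuous_heatHat (hδ : 0 < δ) {κ : ℝ} (hκ : 0 < κ) :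
    Continuous (heatHat δ κ : (Fin N → ℝ) → ℝ) :=
  continuous_iff_continuousAt.2 fun x => (hasFDerivAt_heatHat hδ hκ x).continuousAt

theorem isPotential_heatHat_add (hδ : 0 < δ) {κ : ℝ} (hκ : 0 < κ) (c : ℝ) :
    IsPotential fun y : Fin N → ℝ => heatHat δ κ y + c where
  measurable := ((continuous_heatHat hδ hκ).add continuous_const).measurable
  bound := by
    refine ⟨|√(2 * κ) * gaussMax N * expAvg δ fun s => √s| + |c|, fun y => ?_⟩
    have h1 := abs_le.1 (abs_ciSup_le_norm y)
    have h2 := ciSup_le_heatHat hδ hκ y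
    have h3 := heatHat_le hδ hκ y
    have h4 := le_abs_self (√(2 * κ) * gaussMax N * expAvg δ fun s => √s)
    have h5 := abs_nonneg (√(2 * κ) * gaussMax N * expAvg δ fun s => √s)
    have h6 := abs_le.1 (le_refl |c|)
    exact abs_le.2 ⟨by linarith, by linarith⟩
  add_const y b := by
    rw [heatHat_add_const hδ hκ]
    ring

theorem isPotential_heatLower (hδ : 0 < δ) (hδ1 : δ < 1) :
    IsPotential (heatLower δ : (Fin N → ℝ) → ℝ) :=
  isPotential_heatHat_add hδ (kappaS_pos hδ hδ1) (-heatConst N δ (kappaS N δ))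

theorem isPotential_heatUpper (hδ : 0 < δ) (hδ1 : δ < 1) :
    IsPotential (heatUpper δ : (Fin N → ℝ) → ℝ) :=
  isPotential_heatHat_add hδ (kappaU_pos hδ hδ1) (heatConst N δ (kappaU δ))

theorem abs_fixedRegretFrom_le (p : Player N) (a : Adversary N) (x : Fin N → ℝ) (n : ℕ) :
    |fixedRegretFrom p a x n| ≤ ‖x‖ + 2 * n := by
  have := IsPotential.abs_integral_law_le (f := fun y : Fin N → ℝ => ⨆ i, y i) (A := 0)
    (fun y => by simpa using abs_ciSup_le_norm y) p a x n
  rw [zero_add] at this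
  exact this

omit [NeZero N] in
theorem integral_law_zero (f : (Fin N → ℝ) → ℝ) (p : Player N) (a : Adversary N) (x : Fin N → ℝ) :
    ∫ h, f (x + cumRegret h) ∂(law p a 0) = f x := by
  have h0 : cumRegret (Fin.elim0 : History N 0) = 0 := by
    funext i
    simp [cumRegret]
  rw [law, integral_dirac, h0, add_zero]

omit [NeZero N] in
theorem fixedRegretFrom_zero (p : Player N) (a : Adversary N) (x : Fin N → ℝ) :
    fixedRegretFrom p a x 0 = ⨆ i, x i :=
  integral_law_zero (fun y => ⨆ i, y i) p a x

theorem fixedRegretFrom_eq (p : Player N) (a : Adversary N) (n : ℕ) :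
    fixedRegret p a n = fixedRegretFrom p a 0 n := by
  unfold fixedRegret fixedRegretFrom
  congr 1
  funext h
  have h1 := ciSup_add_const (fun i => -∑ τ, (h τ).1 i) (∑ τ, (h τ).1 (h τ).2)
  have h2 : (⨆ i, -∑ τ, (h τ).1 i) = -⨅ i, ∑ τ, (h τ).1 i := by
    refine le_antisymm (ciSup_le fun i => neg_le_neg (ciInf_le (Set.finite_range _).bddBelow i)) ?_
    rw [neg_le]
    exact le_ciInf fun i => neg_le.1 (le_ciSup_fin (fun i => -∑ τ, (h τ).1 i) i)
  rw [h2] at h1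
  rw [sub_eq_neg_add, ← h1]
  congr 1
  funext i
  simp only [cumRegret, Finset.sum_sub_distrib, Pi.zero_apply]
  ring

theorem regret_eq_regretFrom (p : Player N) (a : Adversary N) :
    regret δ p a = regretFrom δ p a 0 := by
  simp only [regret, regretFrom, fixedRegretFrom_eq]

theorem summable_fixedRegretFrom (hδ : 0 < δ) (hδ1 : δ < 1) (p : Player N) (a : Adversary N)
    (x : Fin N → ℝ) : Summable fun n => δ * (1 - δ) ^ n * fixedRegretFrom p a x n :=
  summable_geometric_weight_mul hδ hδ1 (abs_fixedRegretFrom_le p a x)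

theorem abs_fixedRegretFrom_succ_le (p : Player N) (a : Adversary N) (x : Fin N → ℝ) (n : ℕ) :
    |fixedRegretFrom p a x (n + 1)| ≤ ‖x‖ + 2 + 2 * n := by
  have := abs_fixedRegretFrom_le p a x (n + 1)
  push_cast at this
  linarith

theorem summable_fixedRegretFrom_succ (hδ : 0 < δ) (hδ1 : δ < 1) (p : Player N) (a : Adversary N)
    (x : Fin N → ℝ) : Summable fun n => δ * (1 - δ) ^ n * fixedRegretFrom p a x (n + 1) :=
  summable_geometric_weight_mul hδ hδ1 (abs_fixedRegretFrom_succ_le p a x)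

/-- The game in which the decision to stop is taken before each round. -/
theorem tsum_fixedRegretFrom (hδ : 0 < δ) (hδ1 : δ < 1) (p : Player N) (a : Adversary N)
    (x : Fin N → ℝ) :
    ∑' n, δ * (1 - δ) ^ n * fixedRegretFrom p a x n
      = δ * (⨆ i, x i) + (1 - δ) * regretFrom δ p a x := by
  rw [(summable_fixedRegretFrom hδ hδ1 p a x).tsum_eq_zero_add, pow_zero, mul_one,
    fixedRegretFrom_zero, regretFrom, ← tsum_mul_left]
  congr 1
  refine tsum_congr fun n => ?_
  ring

/-- The regret is bounded uniformly in both strategies. -/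
theorem abs_regretFrom_le (hδ : 0 < δ) (hδ1 : δ < 1) (p : Player N) (a : Adversary N)
    (x : Fin N → ℝ) :
    |regretFrom δ p a x| ≤ ∑' n : ℕ, δ * (1 - δ) ^ n * (‖x‖ + 2 + 2 * n) := by
  have hd : 0 ≤ 1 - δ := by linarith
  rw [← Real.norm_eq_abs, regretFrom]
  refine tsum_of_norm_bounded (summable_geometric_weight_linear hδ hδ1 _ _).hasSum fun n => ?_
  rw [norm_mul, Real.norm_of_nonneg (by positivity)]
  exact mul_le_mul_of_nonneg_left (abs_fixedRegretFrom_succ_le p a x n) (by positivity)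

theorem fixedRegretFrom_succ_le (p : Player N) (a : Adversary N) (x : Fin N → ℝ) (n : ℕ) :
    fixedRegretFrom p a x (n + 1) ≤ fixedRegretFrom p a x n + 2 := by
  have hstep := integral_law_succ isPotential_ciSup p a x n
  have hint := isPotential_ciSup.integrable_law p a x n
  have h2 : ∫ h, ((⨆ i, (x + cumRegret h) i) + 2) ∂(law p a n) = fixedRegretFrom p a x n + 2 := by
    rw [integral_add hint (integrable_const _)]
    simp [fixedRegretFrom]
  rw [← h2]
  refine hstep.2.le.trans (integral_mono hstep.1 (hint.add (integrable_const 2)) fun h => ?_)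
  have hround := (integral_round isPotential_ciSup (a.mem_cube n h) (p.kernel n h)
    (x + cumRegret h)).1
  refine (integral_mono_ae hround (integrable_const ((⨆ i, (x + cumRegret h) i) + 2)) ?_).trans_eq
    (by simp)
  filter_upwards [a.mem_cube n h] with q hq
  have h3 : ∑ i, (p.kernel n h).real {i} * q i ≤ 1 := by
    rw [← sum_real_singleton (μ := p.kernel n h)]
    exact Finset.sum_le_sum fun i _ =>
      mul_le_of_le_one_right measureReal_nonneg (abs_le.1 (hq i)).2
  have h4 : (⨆ i, (x + cumRegret h - q) i) ≤ (⨆ i, (x + cumRegret h) i) + 1 :=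
    ciSup_le fun i => by
      have := le_ciSup_fin (x + cumRegret h) i
      have := (abs_le.1 (hq i)).1
      simp only [Pi.sub_apply]
      linarith
  linarith

/-- Stopping before each round costs at most the regret `2` of one round. -/
theorem regretFrom_le_tsum_add_two (hδ : 0 < δ) (hδ1 : δ < 1) (p : Player N) (a : Adversary N)
    (x : Fin N → ℝ) :
    regretFrom δ p a x ≤ ∑' n, δ * (1 - δ) ^ n * fixedRegretFrom p a x n + 2 := by
  have hd : 0 ≤ 1 - δ := by linarith
  have hs := summable_fixedRegretFrom hδ hδ1 p a x
  have hs2 := (summable_geometric_weight hδ hδ1).mul_right 2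
  have h2 : ∑' n : ℕ, δ * (1 - δ) ^ n * 2 = 2 := by
    rw [tsum_mul_right, tsum_geometric_weight hδ hδ1, one_mul]
  rw [← h2, ← hs.tsum_add hs2, regretFrom]
  refine (summable_fixedRegretFrom_succ hδ hδ1 p a x).tsum_le_tsum (fun n => ?_) (hs.add hs2)
  rw [← mul_add]
  exact mul_le_mul_of_nonneg_left (fixedRegretFrom_succ_le p a x n) (by positivity)

end

/-! ### The heat adversary -/

section
variable {N : ℕ} [NeZero N] {δ : ℝ}

theorem integral_uniformOn_balancedSigns (N : ℕ) (f : (Fin N → ℝ) → ℝ) :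
    ∫ q, f q ∂(uniformOn (balancedSigns N))
      = ((balancedFinset N).card : ℝ)⁻¹ * ∑ q ∈ balancedFinset N, f q := by
  have hset : balancedSigns N = (balancedFinset N : Set (Fin N → ℝ)) := by simp [balancedFinset]
  have hc := card_balancedFinset_pos N
  rw [hset, uniformOn, ProbabilityTheory.cond, integral_smul_measure,
    setIntegral_finset, Measure.count_apply_finset]
  · simp [Measure.real]
  · rw [← (balancedFinset N : Set (Fin N → ℝ)).biUnion_of_singleton]
    simp

omit [NeZero N] in
theorem sum_balancedFinset_round (p : Fin N → ℝ) (g : (Fin N → ℝ) → ℝ) :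
    ∑ q ∈ balancedFinset N, (∑ i, p i * q i + g q) = ∑ q ∈ balancedFinset N, g q := by
  rw [Finset.sum_add_distrib, Finset.sum_comm]
  simp [← Finset.mul_sum, sum_balancedFinset_eval]

omit [NeZero N] in
/-- Against the heat adversary the choice of the player has no influence on the expectation of a
potential. -/
theorem integral_law_heatAdversary_succ {f : (Fin N → ℝ) → ℝ} (hf : IsPotential f) (p : Player N)
    (x : Fin N → ℝ) (t : ℕ) :
    Integrable (fun h => ((balancedFinset N).card : ℝ)⁻¹ *
      ∑ q ∈ balancedFinset N, f (x + cumRegret h - q)) (law p (heatAdversary N) t) ∧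
    ∫ h, f (x + cumRegret h) ∂(law p (heatAdversary N) (t + 1))
      = ∫ h, ((balancedFinset N).card : ℝ)⁻¹ *
        ∑ q ∈ balancedFinset N, f (x + cumRegret h - q) ∂(law p (heatAdversary N) t) := by
  have h := integral_law_succ hf p (heatAdversary N) x t
  have hk : ∀ y, (heatAdversary N).kernel t y = uniformOn (balancedSigns N) := fun y => by
    simp [heatAdversary]
  simpa only [hk, integral_uniformOn_balancedSigns, sum_balancedFinset_round] using h

/-- Against the heat adversary the expected regret does not decrease. -/
theorem fixedRegretFrom_le_succ (p : Player N) (x : Fin N → ℝ) (n : ℕ) :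
    fixedRegretFrom p (heatAdversary N) x n ≤ fixedRegretFrom p (heatAdversary N) x (n + 1) := by
  have hstep := integral_law_heatAdversary_succ isPotential_ciSup p x n
  have hint := isPotential_ciSup.integrable_law p (heatAdversary N) x n
  refine (integral_mono hint hstep.1 fun h => ?_).trans hstep.2.ge
  refine ciSup_le fun i => ?_
  have hb := card_balancedFinset_pos N
  have h1 : ∑ q ∈ balancedFinset N, (x + cumRegret h - q) i
      ≤ ∑ q ∈ balancedFinset N, ⨆ j, (x + cumRegret h - q) j :=
    Finset.sum_le_sum fun q _ => le_ciSup_fin (x + cumRegret h - q) i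
  simp only [Pi.sub_apply, Finset.sum_sub_distrib, sum_balancedFinset_eval, Finset.sum_const,
    nsmul_eq_mul, sub_zero] at h1
  rw [inv_mul_eq_div, le_div_iff₀ hb, mul_comm]
  exact h1

theorem ciSup_le_fixedRegretFrom (p : Player N) (x : Fin N → ℝ) (n : ℕ) :
    (⨆ i, x i) ≤ fixedRegretFrom p (heatAdversary N) x n := by
  have := monotone_nat_of_le_succ (fixedRegretFrom_le_succ p x) n.zero_le
  rwa [fixedRegretFrom_zero] at this

theorem ciSup_le_regretFrom (hδ : 0 < δ) (hδ1 : δ < 1) (p : Player N) (x : Fin N → ℝ) :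
    (⨆ i, x i) ≤ regretFrom δ p (heatAdversary N) x := by
  have hd : 0 ≤ 1 - δ := by linarith
  rw [← one_mul (⨆ i, x i), ← tsum_geometric_weight hδ hδ1, ← tsum_mul_right, regretFrom]
  refine ((summable_geometric_weight hδ hδ1).mul_right _).tsum_le_tsum (fun n => ?_)
    (summable_fixedRegretFrom_succ hδ hδ1 p _ x)
  exact mul_le_mul_of_nonneg_left (ciSup_le_fixedRegretFrom p x (n + 1)) (by positivity)

/-- The potential `û^h` bounds the regret against the heat adversary from below. -/
theorem heatLower_sub_le (hδ : 0 < δ) (hδ1 : δ < 1) {E : ℝ} (hE : IsLowerErr N δ E) (p : Player N)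
    (x : Fin N → ℝ) :
    heatLower δ x - E ≤ δ * (⨆ i, x i) + (1 - δ) * regretFrom δ p (heatAdversary N) x := by
  have hf := isPotential_heatLower (N := N) hδ hδ1
  obtain ⟨A, hA⟩ := hf.bound
  have hb := card_balancedFinset_pos N
  rw [← tsum_fixedRegretFrom hδ hδ1]
  refine le_trans (le_of_eq ?_) (le_tsum_of_step hδ hδ1
    (w := fun n => ∫ h, heatLower δ (x + cumRegret h) ∂(law p (heatAdversary N) n)) (E := E)
    (IsPotential.abs_integral_law_le hA p _ x) (abs_fixedRegretFrom_le p _ x) fun n => ?_)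
  · simp only [integral_law_zero]
  have hstep := integral_law_heatAdversary_succ hf p x n
  have hint := hf.integrable_law p (heatAdversary N) x n
  have hintm := isPotential_ciSup.integrable_law p (heatAdversary N) x n
  have hm : fixedRegretFrom p (heatAdversary N) x n
      = ∫ h, (⨆ i, (x + cumRegret h) i) ∂(law p (heatAdversary N) n) := rfl
  have hE' : fixedRegretFrom p (heatAdversary N) x n + E
      = ∫ h, ((⨆ i, (x + cumRegret h) i) + E) ∂(law p (heatAdversary N) n) := by
    rw [integral_add hintm (integrable_const _), hm]
    simp
  have hi2 : Integrable (fun h => δ * ((⨆ i, (x + cumRegret h) i) + E))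
      (law p (heatAdversary N) n) := (hintm.add (integrable_const E)).const_mul δ
  rw [hstep.2, hE', ← integral_const_mul, ← integral_const_mul, ← integral_sub hint hi2]
  refine integral_mono (hint.sub hi2) (hstep.1.const_mul _) fun h => ?_
  have := heatLower_step hδ hδ1 hE (x + cumRegret h)
  beta_reduce
  rw [mul_left_comm, inv_mul_eq_div, le_div_iff₀ hb, mul_comm]
  exact this

instance : Nonempty (Player N) :=
  ⟨⟨fun _ => Kernel.const _ (Measure.dirac 0), fun _ => inferInstance⟩⟩

omit [NeZero N] in
instance : Nonempty (Adversary N) := ⟨heatAdversary N⟩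

theorem bddBelow_regretFrom (hδ : 0 < δ) (hδ1 : δ < 1) (x : Fin N → ℝ) :
    BddBelow (Set.range fun p : Player N => regretFrom δ p (heatAdversary N) x) :=
  ⟨⨆ i, x i, by
    rintro _ ⟨p, rfl⟩
    exact ciSup_le_regretFrom hδ hδ1 p x⟩

theorem bddAbove_regretFrom (hδ : 0 < δ) (hδ1 : δ < 1) (p : Player N) (x : Fin N → ℝ) :
    BddAbove (Set.range fun a : Adversary N => regretFrom δ p a x) :=
  ⟨_, by
    rintro _ ⟨a, rfl⟩
    exact (abs_le.1 (abs_regretFrom_le hδ hδ1 p a x)).2⟩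

theorem ciSup_le_adversaryValue (hδ : 0 < δ) (hδ1 : δ < 1) (x : Fin N → ℝ) :
    (⨆ i, x i) ≤ adversaryValue δ (heatAdversary N) x :=
  le_ciInf fun p => ciSup_le_regretFrom hδ hδ1 p x

theorem heatLower_sub_le_adversaryValue_delayed (hδ : 0 < δ) (hδ1 : δ < 1) {E : ℝ}
    (hE : IsLowerErr N δ E) (x : Fin N → ℝ) :
    heatLower δ x - E ≤ δ * (⨆ i, x i) + (1 - δ) * adversaryValue δ (heatAdversary N) x := by
  have hd : 0 < 1 - δ := by linarith
  have h : (heatLower δ x - E - δ * (⨆ i, x i)) / (1 - δ)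
      ≤ adversaryValue δ (heatAdversary N) x := le_ciInf fun p => by
    rw [div_le_iff₀ hd]
    linarith [heatLower_sub_le hδ hδ1 hE p x]
  rw [div_le_iff₀ hd] at h
  linarith

theorem heatLower_sub_le_adversaryValue (hδ : 0 < δ) (hδ1 : δ < 1) {E : ℝ}
    (hE : IsLowerErr N δ E) (x : Fin N → ℝ) :
    heatLower δ x - E ≤ adversaryValue δ (heatAdversary N) x := by
  have h1 := heatLower_sub_le_adversaryValue_delayed hδ hδ1 hE x
  have h2 := mul_le_mul_of_nonneg_left (ciSup_le_adversaryValue hδ hδ1 x) hδ.le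
  linarith

theorem heatLower_zero (hδ : 0 < δ) (hδ1 : δ < 1) :
    heatLower δ (0 : Fin N → ℝ)
      = √(2 * kappaS N δ) * gaussMax N * (Real.exp δ * (√Real.pi / 2) * erfc √δ) := by
  rw [heatLower, heatHat_zero hδ (kappaS_pos hδ hδ1), heatConst,
    sqrt_two_mul_mul (kappaS_pos hδ hδ1)]
  ring

omit [NeZero N] in
theorem heatUpper_zero (hδ : 0 < δ) (hδ1 : δ < 1) :
    heatUpper δ (0 : Fin N → ℝ) = √(2 * (1 - δ) / δ) * gaussMax N *
      (Real.exp δ * (√Real.pi / 2) * erfc √δ + 2 * √δ) := by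
  rw [heatUpper, heatHat_zero hδ (kappaU_pos hδ hδ1), heatConst,
    sqrt_two_mul_mul (kappaU_pos hδ hδ1), kappaU, mul_div_assoc]
  ring

theorem heatLower_zero_sub_le_regret (hδ : 0 < δ) (hδ1 : δ < 1) {E : ℝ} (hE : IsLowerErr N δ E)
    (p : Player N) : heatLower δ (0 : Fin N → ℝ) - E ≤ regret δ p (heatAdversary N) := by
  have h1 := heatLower_sub_le hδ hδ1 hE p 0
  have h2 := mul_le_mul_of_nonneg_left (ciSup_le_regretFrom hδ hδ1 p 0) hδ.le
  rw [regret_eq_regretFrom]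
  linarith

end

/-! ### The heat player -/

section
variable {N : ℕ} [NeZero N] {δ : ℝ}

theorem hasFDerivAt_heatUpper (hδ : 0 < δ) (hδ1 : δ < 1) (x : Fin N → ℝ) :
    HasFDerivAt (heatUpper δ) (∑ i, hatProb δ (kappaU δ) i x •
      (ContinuousLinearMap.proj i : (Fin N → ℝ) →L[ℝ] ℝ)) x :=
  (hasFDerivAt_heatHat hδ (kappaU_pos hδ hδ1) x).add_const _

omit [NeZero N] in
theorem sum_smul_proj_single (c : Fin N → ℝ) (i : Fin N) :
    (∑ j, c j • (ContinuousLinearMap.proj j : (Fin N → ℝ) →L[ℝ] ℝ))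
      (Pi.single i 1 : Fin N → ℝ) = c i := by
  simp [Pi.single_apply]

theorem measurable_hatProb (hδ : 0 < δ) (hδ1 : δ < 1) (i : Fin N) :
    Measurable (hatProb δ (kappaU δ) i : (Fin N → ℝ) → ℝ) := by
  have h : (hatProb δ (kappaU δ) i : (Fin N → ℝ) → ℝ)
      = fun x => fderiv ℝ (heatUpper δ) x (Pi.single i 1 : Fin N → ℝ) := funext fun x => by
    rw [(hasFDerivAt_heatUpper hδ hδ1 x).fderiv, sum_smul_proj_single]
  rw [h]
  exact measurable_fderiv_apply_const ℝ _ _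

theorem IsHeatPlayer.real_singleton {p : MarkovPlayer N} (hp : IsHeatPlayer δ p) (hδ : 0 < δ)
    (hδ1 : δ < 1) (x : Fin N → ℝ) (i : Fin N) :
    (p.kernel x).real {i} = hatProb δ (kappaU δ) i x := by
  have h := congrArg (fun L => L (Pi.single i 1 : Fin N → ℝ))
    ((hp x).unique (hasFDerivAt_heatUpper hδ hδ1 x))
  simpa only [sum_smul_proj_single] using h

/-- The kernel that follows expert `i` with probability `∂_i ŵ^h(x)`. -/
noncomputable def heatKernel (N : ℕ) [NeZero N] (hδ : 0 < δ) (hδ1 : δ < 1) :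
    Kernel (Fin N → ℝ) (Fin N) where
  toFun x := ∑ i, ENNReal.ofReal (hatProb δ (kappaU δ) i x) • Measure.dirac i
  measurable' := by
    refine Measure.measurable_of_measurable_coe _ fun s _ => ?_
    simp only [Measure.coe_finsetSum, Finset.sum_apply, Measure.smul_apply, smul_eq_mul]
    exact Finset.measurable_sum _ fun i _ =>
      (measurable_hatProb hδ hδ1 i).ennreal_ofReal.mul_const _

theorem heatKernel_singleton (hδ : 0 < δ) (hδ1 : δ < 1) (x : Fin N → ℝ) (i : Fin N) :
    heatKernel N hδ hδ1 x {i} = ENNReal.ofReal (hatProb δ (kappaU δ) i x) := by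
  simp [heatKernel, Set.indicator_apply]

theorem isMarkovKernel_heatKernel (hδ : 0 < δ) (hδ1 : δ < 1) :
    IsMarkovKernel (heatKernel N hδ hδ1) := ⟨fun x => ⟨by
  have h := sum_hatProb hδ (kappaU_pos hδ hδ1) x
  simp only [heatKernel, Kernel.coe_mk, Measure.coe_finsetSum, Finset.sum_apply,
    Measure.smul_apply, measure_univ, smul_eq_mul, mul_one]
  rw [← ENNReal.ofReal_sum_of_nonneg fun i _ => hatProb_nonneg i x, h, ENNReal.ofReal_one]⟩⟩

/-- The gradient of `ŵ^h` is a probability vector, and its coefficients are determined by it. -/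
theorem existsUnique_isHeatPlayer (hδ : 0 < δ) (hδ1 : δ < 1) :
    ∃! p : MarkovPlayer N, IsHeatPlayer δ p := by
  refine ⟨⟨heatKernel N hδ hδ1, isMarkovKernel_heatKernel hδ hδ1⟩, fun x => ?_, ?_⟩
  · have h : ∀ i, (heatKernel N hδ hδ1 x).real {i} = hatProb δ (kappaU δ) i x := fun i => by
      rw [Measure.real, heatKernel_singleton, ENNReal.toReal_ofReal (hatProb_nonneg i x)]
    simp only [h]
    exact hasFDerivAt_heatUpper hδ hδ1 x
  · rintro ⟨k, hk⟩ hp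
    congr 1
    refine Kernel.ext fun x => Measure.ext_of_singleton fun i => ?_
    rw [heatKernel_singleton, ← hp.real_singleton hδ hδ1 x i, Measure.real,
      ENNReal.ofReal_toReal (measure_ne_top _ _)]

/-- The potential `ŵ^h` bounds the regret of the heat player from above. -/
theorem IsHeatPlayer.le_heatUpper_add {p : MarkovPlayer N} (hp : IsHeatPlayer δ p) (hδ : 0 < δ)
    (hδ1 : δ < 1) {E : ℝ} (hE : IsUpperErr N δ E) (a : Adversary N) (x : Fin N → ℝ) :
    δ * (⨆ i, x i) + (1 - δ) * regretFrom δ (p.toPlayer x) a x ≤ heatUpper δ x + E := by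
  have hf := isPotential_heatUpper (N := N) hδ hδ1
  have hd : 0 ≤ 1 - δ := by linarith
  obtain ⟨A, hA⟩ := hf.bound
  rw [← tsum_fixedRegretFrom hδ hδ1]
  refine (tsum_le_of_step hδ hδ1
    (w := fun n => ∫ h, heatUpper δ (x + cumRegret h) ∂(law (p.toPlayer x) a n)) (E := E)
    (IsPotential.abs_integral_law_le hA _ a x) (abs_fixedRegretFrom_le _ a x)
    fun n => ?_).trans_eq ?_
  swap
  · simp only [integral_law_zero]
  have hstep := integral_law_succ hf (p.toPlayer x) a x n
  have hint := hf.integrable_law (p.toPlayer x) a x n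
  have hintm := isPotential_ciSup.integrable_law (p.toPlayer x) a x n
  have hm : fixedRegretFrom (p.toPlayer x) a x n
      = ∫ h, (⨆ i, (x + cumRegret h) i) ∂(law (p.toPlayer x) a n) := rfl
  have hE' : fixedRegretFrom (p.toPlayer x) a x n - E
      = ∫ h, ((⨆ i, (x + cumRegret h) i) - E) ∂(law (p.toPlayer x) a n) := by
    rw [integral_sub hintm (integrable_const _), hm]
    simp
  have hi2 : Integrable (fun h => δ * ((⨆ i, (x + cumRegret h) i) - E))
      (law (p.toPlayer x) a n) := (hintm.sub (integrable_const E)).const_mul δ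
  rw [hstep.2, hE', ← integral_const_mul, ← integral_const_mul, ← integral_sub hint hi2]
  refine integral_mono (hstep.1.const_mul _) (hint.sub hi2) fun h => ?_
  beta_reduce
  have hround := (integral_round hf (a.mem_cube n h) ((p.toPlayer x).kernel n h)
    (x + cumRegret h)).1
  rw [← integral_const_mul]
  refine (integral_mono_ae (hround.const_mul _) (integrable_const
    (heatUpper δ (x + cumRegret h) - δ * ((⨆ i, (x + cumRegret h) i) - E))) ?_).trans_eq (by simp)
  filter_upwards [a.mem_cube n h] with q hq
  have hk : ∀ i, ((p.toPlayer x).kernel n h).real {i}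
      = hatProb δ (kappaU δ) i (x + cumRegret h) := fun i => by
    rw [← hp.real_singleton hδ hδ1]
    rfl
  have hs := heatUpper_step hδ hδ1 hE (x + cumRegret h) hq
  simp only [hk, mul_comm (hatProb _ _ _ _)]
  rwa [add_comm] at hs

theorem IsHeatPlayer.regretFrom_le {p : MarkovPlayer N} (hp : IsHeatPlayer δ p) (hδ : 0 < δ)
    (hδ1 : δ < 1) {E : ℝ} (hE : IsUpperErr N δ E) (a : Adversary N) (x : Fin N → ℝ) :
    regretFrom δ (p.toPlayer x) a x ≤ heatUpper δ x + (E + 2) := by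
  have h1 := regretFrom_le_tsum_add_two hδ hδ1 (p.toPlayer x) a x
  rw [tsum_fixedRegretFrom hδ hδ1] at h1
  linarith [hp.le_heatUpper_add hδ hδ1 hE a x]

theorem IsHeatPlayer.playerValue_le {p : MarkovPlayer N} (hp : IsHeatPlayer δ p) (hδ : 0 < δ)
    (hδ1 : δ < 1) {E : ℝ} (hE : IsUpperErr N δ E) (x : Fin N → ℝ) :
    playerValue δ p x ≤ heatUpper δ x + (E + 2) :=
  ciSup_le fun a => hp.regretFrom_le hδ hδ1 hE a x

theorem IsHeatPlayer.delayed_playerValue_le {p : MarkovPlayer N} (hp : IsHeatPlayer δ p)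
    (hδ : 0 < δ) (hδ1 : δ < 1) {E : ℝ} (hE : IsUpperErr N δ E) (x : Fin N → ℝ) :
    δ * (⨆ i, x i) + (1 - δ) * playerValue δ p x ≤ heatUpper δ x + E := by
  have hd : 0 < 1 - δ := by linarith
  have h : playerValue δ p x ≤ (heatUpper δ x + E - δ * (⨆ i, x i)) / (1 - δ) :=
    ciSup_le fun a => by
      rw [le_div_iff₀ hd]
      linarith [hp.le_heatUpper_add hδ hδ1 hE a x]
  rw [le_div_iff₀ hd] at h
  linarith

theorem IsHeatPlayer.regret_le {p : MarkovPlayer N} (hp : IsHeatPlayer δ p) (hδ : 0 < δ)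
    (hδ1 : δ < 1) {E : ℝ} (hE : IsUpperErr N δ E) (a : Adversary N) :
    regret δ (p.toPlayer 0) a ≤ heatUpper δ (0 : Fin N → ℝ) + (E + 2) ∧
    (1 - δ) * regret δ (p.toPlayer 0) a ≤ heatUpper δ (0 : Fin N → ℝ) + E := by
  rw [regret_eq_regretFrom]
  have h := hp.le_heatUpper_add hδ hδ1 hE a 0
  simp only [Pi.zero_apply, ciSup_const, mul_zero, zero_add] at h
  exact ⟨hp.regretFrom_le hδ hδ1 hE a 0, h⟩

end

/-! ### The expected maximum of a Gaussian vector -/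

section

theorem integral_Ioi_mul_normPDF (z : ℝ) : ∫ u in Set.Ioi z, u * normPDF u = normPDF z := by
  have hd : ∀ u ∈ Set.Ici z, HasDerivAt (fun u => -normPDF u) (u * normPDF u) u := fun u _ => by
    have := (hasDerivAt_normPDF u).neg
    rwa [neg_mul, neg_neg] at this
  have hi : Integrable fun u => u * normPDF u := by
    refine integrable_sq_add_one_mul_normPDF.mono'
      (continuous_id.mul continuous_normPDF).aestronglyMeasurable (ae_of_all _ fun u => ?_)
    rw [Real.norm_eq_abs, abs_mul, abs_of_nonneg (normPDF_nonneg u)]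
    refine mul_le_mul_of_nonneg_right (abs_le.2 ⟨?_, ?_⟩) (normPDF_nonneg u)
    · nlinarith [sq_nonneg (u + 1)]
    · nlinarith [sq_nonneg (u - 1)]
  have ht : Tendsto (fun u => -normPDF u) atTop (𝓝 0) := by
    have h1 : Tendsto normPDF atTop (𝓝 0) := by
      refine tendsto_of_tendsto_of_tendsto_of_le_of_le' tendsto_const_nhds
        tendsto_mul_normPDF_atTop (Eventually.of_forall normPDF_nonneg) ?_
      filter_upwards [eventually_ge_atTop 1] with u hu
      exact le_mul_of_one_le_left (normPDF_nonneg u) hu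
    simpa using h1.neg
  rw [integral_Ioi_of_hasDerivAt_of_tendsto' hd hi.integrableOn ht]
  ring

theorem integral_normPDF_mul_self : ∫ u, normPDF u * normPDF u = (2 * √Real.pi)⁻¹ := by
  have h : ∀ u, normPDF u * normPDF u = (2 * Real.pi)⁻¹ * Real.exp (-1 * u ^ 2) := fun u => by
    have h2 : √(2 * Real.pi) * √(2 * Real.pi) = 2 * Real.pi :=
      Real.mul_self_sqrt (by positivity)
    rw [normPDF_eq, mul_mul_mul_comm, ← mul_inv, h2, ← Real.exp_add]
    congr 2
    ring
  simp only [h]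
  rw [integral_const_mul, integral_gaussian, div_one, mul_inv, mul_inv, mul_assoc]
  congr 1
  have := Real.mul_self_sqrt Real.pi_pos.le
  have hs := Real.sqrt_pos.2 Real.pi_pos
  field_simp
  nlinarith

/-- Conditionally on the other coordinate `v`, the integral over `u > v` of `u` against the Gaussian
density is the density at `v`. -/
theorem crossMean_two (i : Fin 2) : crossMean i i (0 : Fin 2 → ℝ) = (2 * √Real.pi)⁻¹ := by
  rw [crossMean, integral_stdNormal_succ (integrable_eval_mul_leadInd i i 0) i]
  have h : ∀ y' : Fin 1 → ℝ, ∫ u, (i.insertNth u y' : Fin 2 → ℝ) i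
      * leadInd i (0 + (i.insertNth u y' : Fin 2 → ℝ)) ∂gaussianReal 0 1 = normPDF (y' 0) :=
    fun y' => by
      have := integral_mul_leadInd_insertNth i 0 y' fun u => u
      simp only [Fin.insertNth_apply_same]
      rw [this, integral_Ioi_mul_normPDF, normPDF_neg, leadGap]
      simp [normPDF_neg]
  simp only [h]
  have hmp := measurePreserving_eval (fun _ : Fin 1 => gaussianReal 0 1) 0
  have h1 : ∫ y' : Fin 1 → ℝ, normPDF (y' 0) ∂stdNormal 1 = ∫ u, normPDF u ∂gaussianReal 0 1 := by
    rw [← hmp.map_eq, integral_map (measurable_pi_apply 0).aemeasurable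
      continuous_normPDF.aestronglyMeasurable]
  rw [h1, ← integral_normPDF_mul_self, integral_gaussianReal_eq_integral_smul one_ne_zero]
  simp only [smul_eq_mul]

theorem gaussMax_two : gaussMax 2 = 1 / √Real.pi := by
  rw [gaussMax_eq, maxAvg_eq_add_leadMean, leadMean]
  simp only [crossMean_two, Pi.zero_apply, zero_mul, Finset.sum_const_zero, zero_add,
    Finset.sum_const, Finset.card_univ, Fintype.card_fin, nsmul_eq_mul]
  have hs := Real.sqrt_pos.2 Real.pi_pos
  field_simp
  norm_num

theorem integrable_ciSup {N : ℕ} [NeZero N] : Integrable (fun y => ⨆ i, y i) (stdNormal N) := by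
  simpa using integrable_ciSup_add (0 : Fin N → ℝ)

/-- Dropping a coordinate does not increase the maximum. -/
theorem gaussMax_le_succ (n : ℕ) [NeZero n] : gaussMax n ≤ gaussMax (n + 1) := by
  have hm : Measurable fun y : Fin (n + 1) → ℝ => ⨆ i : Fin n, y i.succ :=
    measurable_ciSup_fin.comp (measurable_pi_lambda _ fun i => measurable_pi_apply _)
  have hi : Integrable (fun y : Fin (n + 1) → ℝ => ⨆ i : Fin n, y i.succ) (stdNormal (n + 1)) := by
    refine ExpGrowth.integrable (ExpGrowth.of_linear (A := 0) (B := 1) le_rfl zero_le_one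
      fun y => ?_) hm.aestronglyMeasurable
    refine (abs_ciSup_le_norm (fun i : Fin n => y i.succ)).trans ?_
    rw [zero_add, one_mul]
    exact (pi_norm_le_iff_of_nonneg (norm_nonneg y)).2 fun i => norm_le_pi_norm y i.succ
  have h := integral_stdNormal_succ hi 0
  have h' : ∀ (u : ℝ) (y' : Fin n → ℝ) (i : Fin n),
      ((0 : Fin (n + 1)).insertNth u y' : Fin (n + 1) → ℝ) i.succ = y' i := fun u y' i => by
    simp [Fin.insertNth_zero']
  simp only [h', integral_const, probReal_univ, one_smul] at h
  rw [gaussMax, ← h]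
  exact integral_mono hi integrable_ciSup fun y =>
    ciSup_le fun i => le_ciSup_fin y i.succ

theorem half_le_gaussMax {N : ℕ} (hN : 2 ≤ N) : 1 / 2 ≤ gaussMax N := by
  induction N, hN using Nat.le_induction with
  | base =>
    rw [gaussMax_two]
    have : √Real.pi ≤ 2 := Real.sqrt_le_iff.2 ⟨by norm_num, by linarith [Real.pi_le_four]⟩
    exact one_div_le_one_div_of_le (Real.sqrt_pos.2 Real.pi_pos) this
  | succ n hn ih =>
    have : NeZero n := ⟨by omega⟩
    exact ih.trans (gaussMax_le_succ n)

/-- The mass of `(u, u + 1]`, where the density is at least its value at `u + 1`. -/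
theorem normPDF_le_measureReal_Ioi {u : ℝ} (hu : 0 ≤ u) :
    normPDF (u + 1) ≤ (gaussianReal 0 1).real (Set.Ioi u) := by
  have hi : Integrable normPDF := integrable_gaussianPDFReal 0 1
  rw [Measure.real, gaussianReal_apply_eq_integral _ one_ne_zero,
    ENNReal.toReal_ofReal (integral_nonneg fun _ => normPDF_nonneg _)]
  have h1 := setIntegral_mono_set (s := Set.Ioc u (u + 1)) (t := Set.Ioi u) hi.integrableOn
    (ae_of_all _ normPDF_nonneg) (LE.le.eventuallyLE Set.Ioc_subset_Ioi_self)
  refine le_trans ?_ h1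
  have h2 := setIntegral_ge_of_const_le (μ := volume) (f := normPDF) (s := Set.Ioc u (u + 1))
    (c := normPDF (u + 1)) measurableSet_Ioc (by simp) (fun v hv => ?_) hi.integrableOn
  · simpa using h2
  · rw [normPDF_eq, normPDF_eq]
    gcongr
    · linarith [hv.1]
    · exact hv.2

/-- A coordinate above `u` appears with probability at least one half once the expected number of
such coordinates is at least one. -/
theorem half_le_measureReal_exists_gt {N : ℕ} {u : ℝ}
    (h : 1 ≤ N * (gaussianReal 0 1).real (Set.Ioi u)) :
    1 / 2 ≤ (stdNormal N).real {y | ∃ i, u < y i} := by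
  set p := (gaussianReal 0 1).real (Set.Ioi u)
  have hset : {y : Fin N → ℝ | ∃ i, u < y i} = (Set.univ.pi fun _ => Set.Iic u)ᶜ := by
    ext y
    simp [Pi.le_def]
  have hm : MeasurableSet (Set.univ.pi fun _ : Fin N => Set.Iic u) :=
    MeasurableSet.univ_pi fun _ => measurableSet_Iic
  have hr : (gaussianReal 0 1).real (Set.Iic u) = 1 - p := by
    rw [← Set.compl_Ioi, probReal_compl_eq_one_sub measurableSet_Ioi]
  have hpi : (stdNormal N).real (Set.univ.pi fun _ : Fin N => Set.Iic u) = (1 - p) ^ N := by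
    rw [Measure.real, Measure.pi_pi, ENNReal.toReal_prod]
    simp [← hr, Measure.real]
  rw [hset, probReal_compl_eq_one_sub hm, hpi]
  have hp1 : p ≤ 1 := measureReal_le_one
  have h1 : (1 - p) ^ N ≤ Real.exp (-p) ^ N :=
    pow_le_pow_left₀ (by linarith) (by linarith [Real.add_one_le_exp (-p)]) _
  have h2 : Real.exp (-p) ^ N ≤ Real.exp (-1) := by
    rw [← Real.exp_nat_mul]
    exact Real.exp_le_exp.2 (by linarith)
  have h3 : Real.exp (-1) ≤ 1 / 2 := by
    rw [Real.exp_neg, inv_eq_one_div]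
    exact one_div_le_one_div_of_le (by norm_num) (by linarith [Real.add_one_le_exp 1])
  linarith

/-- The maximum is at least `u` on the event and at least `-|y 0|` everywhere. -/
theorem le_gaussMax_of_half_le {N : ℕ} [NeZero N] {u : ℝ}
    (h : 1 / 2 ≤ (stdNormal N).real {y | ∃ i, u < y i}) (hu : 0 ≤ u) :
    u / 2 - 4 ≤ gaussMax N := by
  have hm : MeasurableSet {y : Fin N → ℝ | ∃ i, u < y i} := by
    simp only [Set.ofPred_exists]
    exact MeasurableSet.iUnion fun i => measurableSet_lt measurable_const (measurable_pi_apply i)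
  have h1 := integral_abs_pow_dotCLM_le (q := (Pi.single 0 1 : Fin N → ℝ)) one_pos
      (by simp [Pi.single_apply]) 1
  have h2 : ∀ y : Fin N → ℝ, |dotCLM y (Pi.single 0 1)| ^ 1 = |y 0| := fun y => by
    rw [pow_one, dotCLM_apply]
    simp [Pi.single_apply]
  simp only [h2] at h1
  norm_num at h1
  have hi : Integrable ({y : Fin N → ℝ | ∃ i, u < y i}.indicator fun _ => u) (stdNormal N) :=
    (integrable_const u).indicator hm
  have h3 := integral_mono (hi.sub h1.1) integrable_ciSup (fun y => by
    have h0 := le_ciSup_fin y 0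
    have h0' := neg_abs_le (y 0)
    by_cases hy : y ∈ {y : Fin N → ℝ | ∃ i, u < y i}
    · obtain ⟨i, hi⟩ := hy
      have hy : y ∈ {y : Fin N → ℝ | ∃ i, u < y i} := ⟨i, hi⟩
      have := le_ciSup_fin y i
      simp only [Pi.sub_apply, Set.indicator_of_mem hy]
      linarith [abs_nonneg (y 0)]
    · simp only [Pi.sub_apply, Set.indicator_of_notMem hy]
      linarith)
  rw [integral_sub' hi h1.1, integral_indicator_const _ hm, smul_eq_mul] at h3
  have h4 : 1 / 2 * u ≤ (stdNormal N).real {y | ∃ i, u < y i} * u := by gcongr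
  change _ ≤ gaussMax N at h3
  linarith [h1.2]

/-- The level `u = √(log N) - 1` is exceeded by one coordinate with probability at least `1 / N`,
when `N` is large. For `√(log N) ≤ 10` the bound `half_le_gaussMax` suffices. -/
theorem sqrt_log_le_gaussMax {N : ℕ} (hN : 2 ≤ N) : 1 / 20 * √(Real.log N) ≤ gaussMax N := by
  set L := √(Real.log N) with hL
  have hhalf := half_le_gaussMax hN
  rcases le_total L 10 with h | h
  · linarith
  have : NeZero N := ⟨by omega⟩
  have hN0 : (0 : ℝ) < N := by exact_mod_cast (by omega : 0 < N)
  have hlog : 0 ≤ Real.log N := Real.log_natCast_nonneg N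
  have hLL : L ^ 2 = Real.log N := Real.sq_sqrt hlog
  have hu : 0 ≤ L - 1 := by linarith
  have hN100 : (101 : ℝ) ≤ N := by
    have := Real.log_le_sub_one_of_pos hN0
    nlinarith
  have hpdf : normPDF (L - 1 + 1) = (√(2 * Real.pi))⁻¹ * (√N)⁻¹ := by
    rw [sub_add_cancel, normPDF_eq, hLL, neg_div, Real.exp_neg, Real.exp_half, Real.exp_log hN0]
  have hp : 1 ≤ N * (gaussianReal 0 1).real (Set.Ioi (L - 1)) := by
    refine le_trans ?_ (mul_le_mul_of_nonneg_left (normPDF_le_measureReal_Ioi hu) hN0.le)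
    have hs : √(2 * Real.pi) ≤ √N :=
      Real.sqrt_le_sqrt (by linarith [Real.pi_le_four])
    have hsN : 0 < √(N : ℝ) := Real.sqrt_pos.2 hN0
    have hsp : 0 < √(2 * Real.pi) := Real.sqrt_pos.2 (by positivity)
    have hsq : √(N : ℝ) * √N = N := Real.mul_self_sqrt hN0.le
    rw [hpdf, ← mul_inv, ← div_eq_mul_inv, le_div_iff₀ (by positivity), one_mul]
    nlinarith
  have := le_gaussMax_of_half_le (half_le_measureReal_exists_gt hp) hu
  linarith

end

/-! ### The size of the error terms -/

section
variable {N : ℕ} [NeZero N] {δ : ℝ}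

theorem one_le_one_add_log_inv (hδ : 0 < δ) (hδ1 : δ < 1) : 1 ≤ 1 + Real.log (1 / δ) := by
  have := Real.log_nonneg (one_le_one_div hδ hδ1.le)
  linarith

theorem one_le_sqrt_natCast : 1 ≤ √(N : ℝ) :=
  Real.one_le_sqrt.2 (Nat.one_le_cast.2 (NeZero.pos N))

theorem err3_kappaS_le (hδ : 0 < δ) (hδ1 : δ < 1) :
    err3 δ (200 * (kappaS N δ)⁻¹ * √N) ≤ 67 * (√N * (1 + Real.log (1 / δ))) := by
  have hγ := (signFactor_bounds (N := N)).1
  have hd : 0 < 1 - δ := by linarith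
  have hl := one_le_one_add_log_inv hδ hδ1
  have h1 : err3 δ (200 * (kappaS N δ)⁻¹ * √N)
      = 100 / 3 * (signFactor N)⁻¹ * (√N * (1 + Real.log (1 / δ))) := by
    have : signFactor N ≠ 0 := by linarith
    rw [err3, kappaS_eq]
    field_simp
    ring
  rw [h1]
  have h2 : (signFactor N)⁻¹ ≤ 2 := by
    rw [inv_le_comm₀ (by linarith) (by norm_num)]
    linarith
  have h3 : 0 ≤ √(N : ℝ) * (1 + Real.log (1 / δ)) := by positivity
  exact mul_le_mul_of_nonneg_right (by linarith) h3

/-- The term with `erfc` is dropped, and `κ_s ≥ 1 / (4δ)`. -/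
theorem err4_kappaS_le (hδ : 0 < δ) (hδ1 : δ ≤ 1 / 2) :
    err4 δ (36 * kappaS N δ ^ (-3 / 2 : ℝ) * (N * √N)) ≤ 24 * (N * √N) := by
  have hγ := (signFactor_bounds (N := N)).1
  have hκ : 0 < kappaS N δ := kappaS_pos hδ (by linarith)
  have hs := Real.sqrt_pos.2 hδ
  have hκ' : 1 / (4 * δ) ≤ kappaS N δ := by
    rw [kappaS_eq, div_mul_eq_mul_div, div_le_div_iff₀ (by positivity) hδ]
    have : 1 / 4 ≤ (1 - δ) * signFactor N := by nlinarith
    nlinarith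
  have h1 : kappaS N δ ^ (-3 / 2 : ℝ) ≤ 8 * (δ * √δ) := by
    calc kappaS N δ ^ (-3 / 2 : ℝ) ≤ (1 / (4 * δ)) ^ (-3 / 2 : ℝ) :=
          Real.rpow_le_rpow_of_nonpos (by positivity) hκ' (by norm_num)
      _ = (4 * δ) ^ (1 + 1 / 2 : ℝ) := by
          rw [one_div, Real.inv_rpow (by positivity), ← Real.rpow_neg (by positivity)]
          norm_num
      _ = 8 * (δ * √δ) := by
          have h2 : √(4 : ℝ) = 2 := by
            rw [show (4 : ℝ) = 2 ^ 2 by norm_num]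
            exact Real.sqrt_sq (by norm_num)
          rw [Real.rpow_add (by positivity), Real.rpow_one, ← Real.sqrt_eq_rpow,
            Real.sqrt_mul (by norm_num), h2]
          ring
  have herfc : 2 / √δ - 2 * Real.exp δ * √Real.pi * erfc √δ ≤ 2 / √δ := by
    have := erfc_nonneg √δ
    have : 0 ≤ 2 * Real.exp δ * √Real.pi * erfc √δ := by positivity
    linarith
  have hfac : 0 ≤ (1 - δ) / (24 * δ) := div_nonneg (by linarith) (by positivity)
  calc err4 δ (36 * kappaS N δ ^ (-3 / 2 : ℝ) * (N * √N))
      ≤ (1 - δ) / (24 * δ) * (36 * kappaS N δ ^ (-3 / 2 : ℝ) * (N * √N)) * (2 / √δ) := by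
        rw [err4]
        exact mul_le_mul_of_nonneg_left herfc (by positivity)
    _ ≤ 1 / (24 * δ) * (36 * (8 * (δ * √δ)) * (N * √N)) * (2 / √δ) := by
        gcongr
        linarith
    _ = 24 * (N * √N) := by
        field_simp
        ring

/-- The error terms of the lower bound have the order that is claimed. When `δ` is close to one,
the fourth derivatives are not needed, since the logarithm is bounded. -/
theorem exists_isLowerErr_le (hδ : 0 < δ) (hδ1 : δ < 1) :
    ∃ E, IsLowerErr N δ E ∧ E ≤ 200 * min (N * √N) (√N * (1 + Real.log (1 / δ))) := by
  have hN : (1 : ℝ) ≤ N := Nat.one_le_cast.2 (NeZero.pos N)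
  have hs := one_le_sqrt_natCast (N := N)
  have hl := one_le_one_add_log_inv hδ hδ1
  have hκ := kappaS_pos (N := N) hδ hδ1
  have h3 := err3_kappaS_le (N := N) hδ hδ1
  have hA : 0 ≤ √(N : ℝ) * (1 + Real.log (1 / δ)) := by positivity
  have hB : 0 ≤ (N : ℝ) * √N := by positivity
  have hE3 : IsLowerErr N δ (err3 δ (200 * (kappaS N δ)⁻¹ * √N)) :=
    Or.inl ⟨_, thirdBound_sqrt hκ, rfl⟩
  rw [mul_min_of_nonneg _ _ (by norm_num)]
  rcases le_total δ (1 / 2) with h | h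
  · rcases le_total ((N : ℝ) * √N) (√N * (1 + Real.log (1 / δ))) with h' | h'
    · have h4 := err4_kappaS_le (N := N) hδ h
      exact ⟨_, Or.inr ⟨_, fourthBound_mul_sqrt hκ, rfl⟩, le_min (by linarith) (by linarith)⟩
    · exact ⟨_, hE3, le_min (by linarith) (by linarith)⟩
  · have hlog : Real.log (1 / δ) ≤ 1 := by
      have h2 : 1 / δ ≤ 2 := by
        rw [div_le_iff₀ hδ]
        linarith
      have := Real.log_le_sub_one_of_pos (by positivity : 0 < 1 / δ)
      linarith
    refine ⟨_, hE3, le_min ?_ (by linarith)⟩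
    have : √(N : ℝ) * (1 + Real.log (1 / δ)) ≤ √N * 2 := by gcongr; linarith
    nlinarith

theorem exists_isUpperErr_le (hδ : 0 < δ) (hδ1 : δ < 1) :
    ∃ E, IsUpperErr N δ E ∧ E + 2 ≤ 200 * (√N * (1 + Real.log (1 / δ))) := by
  have hs := one_le_sqrt_natCast (N := N)
  have hl := one_le_one_add_log_inv hδ hδ1
  have hd : 0 < 1 - δ := by linarith
  refine ⟨_, ⟨_, thirdBound_sqrt (kappaU_pos hδ hδ1), rfl⟩, ?_⟩
  have h1 : err3 δ (200 * (kappaU δ)⁻¹ * √N) = 100 / 3 * (√N * (1 + Real.log (1 / δ))) := by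
    rw [err3, kappaU]
    field_simp
    norm_num
  rw [h1]
  nlinarith

end

/-! ### Small stopping rates -/

section

theorem tendsto_sqrt_nhdsGT_zero : Tendsto (fun δ : ℝ => √δ) (𝓝[>] 0) (𝓝 0) := by
  have := (Real.continuous_sqrt.tendsto 0).mono_left (nhdsWithin_le_nhds (s := Set.Ioi 0))
  rwa [Real.sqrt_zero] at this

theorem eventually_lt_nhdsGT_zero {ε : ℝ} (hε : 0 < ε) : ∀ᶠ δ in 𝓝[>] (0 : ℝ), δ < ε :=
  nhdsWithin_le_nhds (gt_mem_nhds hε)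

theorem eventually_pos_nhdsGT_zero : ∀ᶠ δ in 𝓝[>] (0 : ℝ), 0 < δ := self_mem_nhdsWithin

/-- The error term is bounded in `δ`, while the potential at the origin is of the order `gaussMax N
/ √δ`. -/
theorem eventually_sqrt_log_le_regret {N : ℕ} (hN : 1 ≤ N) : ∀ᶠ δ in 𝓝[>] (0 : ℝ),
    ∀ p : Player N, 1 / 160 * √(Real.log N / δ) ≤ regret δ p (heatAdversary N) := by
  have : NeZero N := ⟨by omega⟩
  rcases hN.eq_or_lt with rfl | hN
  · filter_upwards [eventually_pos_nhdsGT_zero, eventually_lt_nhdsGT_zero one_pos] with δ hδ hδ1 p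
    have := ciSup_le_regretFrom hδ hδ1 p 0
    rw [← regret_eq_regretFrom] at this
    simpa using this
  have hM := half_le_gaussMax hN
  have hsmall : ∀ᶠ δ in 𝓝[>] (0 : ℝ), √δ * (1600 * (N * √N)) < gaussMax N := by
    have := tendsto_sqrt_nhdsGT_zero.mul_const (1600 * ((N : ℝ) * √N))
    rw [zero_mul] at this
    exact this.eventually_lt_const (by linarith)
  have herfc : ∀ᶠ δ in 𝓝[>] (0 : ℝ), 3 / 4 < erfc √δ :=
    tendsto_erfc_sqrt_nhdsGT_zero.eventually_const_lt (by norm_num)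
  filter_upwards [eventually_pos_nhdsGT_zero, eventually_lt_nhdsGT_zero one_half_pos, hsmall,
    herfc] with δ hδ hδ2 hs he p
  have hδ1 : δ < 1 := by linarith
  obtain ⟨E, hE, hEle⟩ := exists_isLowerErr_le (N := N) hδ hδ1
  have h1 := heatLower_zero_sub_le_regret hδ hδ1 hE p
  rw [heatLower_zero hδ hδ1] at h1
  have hEN : E ≤ 200 * (N * √N) := hEle.trans (by gcongr; exact min_le_left _ _)
  have hsd := Real.sqrt_pos.2 hδ
  have hγ := (signFactor_bounds (N := N)).1
  have hκ : 1 / 2 / √δ ≤ √(2 * kappaS N δ) := by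
    rw [← Real.sqrt_sq (by positivity : (0 : ℝ) ≤ 1 / 2 / √δ)]
    refine Real.sqrt_le_sqrt ?_
    rw [div_pow, Real.sq_sqrt hδ.le, kappaS_eq, div_mul_eq_mul_div, ← mul_div_assoc]
    gcongr
    nlinarith
  have hc : 1 / 2 ≤ Real.exp δ * (√Real.pi / 2) * erfc √δ := by
    have h2 : 3 / 2 ≤ √Real.pi := Real.le_sqrt_of_sq_le (by linarith [Real.pi_gt_three])
    have h3 := Real.one_le_exp hδ.le
    calc (1 : ℝ) / 2 ≤ 1 * (3 / 2 / 2) * (3 / 4) := by norm_num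
      _ ≤ _ := by gcongr
  have hmain : 1 / 2 / √δ * gaussMax N * (1 / 2)
      ≤ √(2 * kappaS N δ) * gaussMax N * (Real.exp δ * (√Real.pi / 2) * erfc √δ) := by
    gcongr
  have hE' : 200 * ((N : ℝ) * √N) ≤ 1 / 8 * (gaussMax N / √δ) := by
    rw [← mul_div_assoc, le_div_iff₀ hsd]
    linarith
  have hlog : 1 / 160 * √(Real.log N / δ) ≤ 1 / 8 * (gaussMax N / √δ) := by
    rw [Real.sqrt_div' _ hδ.le, ← mul_div_assoc, ← mul_div_assoc]
    exact div_le_div_of_nonneg_right (by linarith [sqrt_log_le_gaussMax hN]) hsd.le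
  have hm' : 1 / 2 / √δ * gaussMax N * (1 / 2) = 1 / 4 * (gaussMax N / √δ) := by ring
  linarith

end

/-! ### Two experts -/

section

theorem kappaS_two (δ : ℝ) : kappaS 2 δ = (1 - δ) / δ := by simp [kappaS]

theorem sqrt_two_mul_mul_sqrt {δ : ℝ} (hδ : 0 < δ) :
    √(2 * δ) * √(2 * (1 - δ) / δ) = 2 * √(1 - δ) := by
  rw [← Real.sqrt_mul (by positivity)]
  have : 2 * δ * (2 * (1 - δ) / δ) = 2 ^ 2 * (1 - δ) := by
    field_simp
  rw [this, Real.sqrt_mul (by norm_num), Real.sqrt_sq (by norm_num)]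

theorem tendsto_sqrt_one_sub : Tendsto (fun δ : ℝ => √(1 - δ)) (𝓝[>] 0) (𝓝 1) := by
  have h : Continuous fun δ : ℝ => √(1 - δ) := by fun_prop
  have := (h.tendsto 0).mono_left (nhdsWithin_le_nhds (s := Set.Ioi 0))
  simpa using this

theorem tendsto_exp_mul_erfc :
    Tendsto (fun δ : ℝ => Real.exp δ * (√Real.pi / 2) * erfc √δ) (𝓝[>] 0) (𝓝 (√Real.pi / 2)) := by
  have h := (Real.continuous_exp.tendsto 0).mono_left (nhdsWithin_le_nhds (s := Set.Ioi 0))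
  simpa using (h.mul_const (√Real.pi / 2)).mul tendsto_erfc_sqrt_nhdsGT_zero

theorem tendsto_heatLower_two :
    Tendsto (fun δ : ℝ => √(2 * δ) * heatLower δ (0 : Fin 2 → ℝ)) (𝓝[>] 0) (𝓝 1) := by
  have hp := Real.sqrt_pos.2 Real.pi_pos
  have h := ((tendsto_sqrt_one_sub.const_mul (2 / √Real.pi)).mul tendsto_exp_mul_erfc)
  have h1 : 2 / √Real.pi * 1 * (√Real.pi / 2) = 1 := by field_simp
  rw [h1] at h
  refine h.congr' ?_
  filter_upwards [eventually_pos_nhdsGT_zero, eventually_lt_nhdsGT_zero one_pos] with δ hδ hδ1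
  have h3 := sqrt_two_mul_mul_sqrt hδ
  rw [mul_div_assoc] at h3
  rw [heatLower_zero hδ hδ1, kappaS_two, gaussMax_two]
  linear_combination (-(Real.exp δ * (√Real.pi / 2) * erfc √δ / √Real.pi)) * h3

theorem tendsto_heatUpper_two :
    Tendsto (fun δ : ℝ => √(2 * δ) * heatUpper δ (0 : Fin 2 → ℝ)) (𝓝[>] 0) (𝓝 1) := by
  have hp := Real.sqrt_pos.2 Real.pi_pos
  have h := (tendsto_sqrt_one_sub.const_mul (2 / √Real.pi)).mul
    (tendsto_exp_mul_erfc.add (tendsto_sqrt_nhdsGT_zero.const_mul 2))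
  have h1 : 2 / √Real.pi * 1 * (√Real.pi / 2 + 2 * 0) = 1 := by field_simp; ring
  rw [h1] at h
  refine h.congr' ?_
  filter_upwards [eventually_pos_nhdsGT_zero, eventually_lt_nhdsGT_zero one_pos] with δ hδ hδ1
  rw [heatUpper_zero hδ hδ1, gaussMax_two, ← mul_assoc, ← mul_assoc,
    sqrt_two_mul_mul_sqrt hδ]
  ring

theorem tendsto_sqrt_mul_log :
    Tendsto (fun δ : ℝ => √(2 * δ) * (1 + Real.log (1 / δ))) (𝓝[>] 0) (𝓝 0) := by
  have h1 := (tendsto_log_mul_rpow_nhdsGT_zero one_half_pos).const_mul (-√2)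
  have h2 := tendsto_sqrt_nhdsGT_zero.const_mul √2
  have h := h2.add h1
  simp only [mul_zero, add_zero] at h
  refine h.congr' ?_
  filter_upwards [eventually_pos_nhdsGT_zero] with δ hδ
  rw [Real.sqrt_mul (by norm_num), ← Real.sqrt_eq_rpow, one_div, Real.log_inv]
  ring

/-- Every quantity between the two guarantees is asymptotic to `1 / √(2δ)`. -/
theorem tendsto_of_heatLower_of_heatUpper {f : ℝ → ℝ} (A B : ℝ)
    (hl : ∀ δ, 0 < δ → δ < 1 → heatLower δ (0 : Fin 2 → ℝ) - A ≤ f δ)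
    (hu : ∀ δ, 0 < δ → δ < 1 → f δ ≤ heatUpper δ (0 : Fin 2 → ℝ) + B * (1 + Real.log (1 / δ))) :
    Tendsto (fun δ => √(2 * δ) * f δ) (𝓝[>] 0) (𝓝 1) := by
  have hs : Tendsto (fun δ : ℝ => √(2 * δ) * A) (𝓝[>] 0) (𝓝 0) := by
    have h := (tendsto_sqrt_nhdsGT_zero.const_mul √2).mul_const A
    simp only [mul_zero, zero_mul] at h
    refine h.congr fun δ => ?_
    rw [Real.sqrt_mul (by norm_num)]
  have h1 := tendsto_heatLower_two.sub hs
  have h2 := tendsto_heatUpper_two.add (tendsto_sqrt_mul_log.const_mul B)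
  rw [sub_zero] at h1
  rw [mul_zero, add_zero] at h2
  refine tendsto_of_tendsto_of_tendsto_of_le_of_le' h1 h2 ?_ ?_
  · filter_upwards [eventually_pos_nhdsGT_zero, eventually_lt_nhdsGT_zero one_pos] with δ hδ hδ1
    rw [← mul_sub]
    exact mul_le_mul_of_nonneg_left (hl δ hδ hδ1) (Real.sqrt_nonneg _)
  · filter_upwards [eventually_pos_nhdsGT_zero, eventually_lt_nhdsGT_zero one_pos] with δ hδ hδ1
    have := mul_le_mul_of_nonneg_left (hu δ hδ hδ1) (Real.sqrt_nonneg (2 * δ))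
    linarith

variable {N : ℕ} [NeZero N] {δ : ℝ}

theorem bddBelow_regret (hδ : 0 < δ) (hδ1 : δ < 1) :
    BddBelow (Set.range fun p : Player N => regret δ p (heatAdversary N)) := by
  simp only [regret_eq_regretFrom]
  exact bddBelow_regretFrom hδ hδ1 0

theorem bddAbove_regret (hδ : 0 < δ) (hδ1 : δ < 1) (p : Player N) :
    BddAbove (Set.range fun a : Adversary N => regret δ p a) := by
  simp only [regret_eq_regretFrom]
  exact bddAbove_regretFrom hδ hδ1 p 0

theorem bddBelow_iSup_regret (hδ : 0 < δ) (hδ1 : δ < 1) :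
    BddBelow (Set.range fun p : Player N => ⨆ a : Adversary N, regret δ p a) := by
  obtain ⟨b, hb⟩ := bddBelow_regret (N := N) hδ hδ1
  refine ⟨b, ?_⟩
  rintro _ ⟨p, rfl⟩
  exact (hb ⟨p, rfl⟩).trans (le_ciSup (bddAbove_regret hδ hδ1 p) (heatAdversary N))

theorem heatLower_two_sub_le_regret (hδ : 0 < δ) (hδ1 : δ < 1) (p : Player 2) :
    heatLower δ (0 : Fin 2 → ℝ) - 200 * (2 * √2) ≤ regret δ p (heatAdversary 2) := by
  obtain ⟨E, hE, hEle⟩ := exists_isLowerErr_le (N := 2) hδ hδ1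
  have h1 := heatLower_zero_sub_le_regret hδ hδ1 hE p
  have h2 : E ≤ 200 * (((2 : ℕ) : ℝ) * √((2 : ℕ) : ℝ)) :=
    hEle.trans (by gcongr; exact min_le_left _ _)
  rw [Nat.cast_ofNat] at h2
  linarith

theorem IsHeatPlayer.regret_two_le {p : MarkovPlayer 2} (hp : IsHeatPlayer δ p) (hδ : 0 < δ)
    (hδ1 : δ < 1) (a : Adversary 2) : regret δ (p.toPlayer 0) a
      ≤ heatUpper δ (0 : Fin 2 → ℝ) + 200 * √2 * (1 + Real.log (1 / δ)) := by
  obtain ⟨E, hE, hEle⟩ := exists_isUpperErr_le (N := 2) hδ hδ1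
  have h1 := (hp.regret_le hδ hδ1 hE a).1
  rw [Nat.cast_ofNat] at hEle
  linarith

theorem tendsto_iInf_regret_heatAdversary :
    Tendsto (fun δ : ℝ => √(2 * δ) * ⨅ p : Player 2, regret δ p (heatAdversary 2))
      (𝓝[>] 0) (𝓝 1) := by
  refine tendsto_of_heatLower_of_heatUpper (200 * (2 * √2)) (200 * √2)
    (fun δ hδ hδ1 => le_ciInf (heatLower_two_sub_le_regret hδ hδ1)) fun δ hδ hδ1 => ?_
  obtain ⟨p, hp, -⟩ := existsUnique_isHeatPlayer (N := 2) hδ hδ1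
  exact (ciInf_le (bddBelow_regret hδ hδ1) (p.toPlayer 0)).trans (hp.regret_two_le hδ hδ1 _)

theorem tendsto_iSup_regret_heatPlayer {p : ℝ → MarkovPlayer 2}
    (hp : ∀ δ : ℝ, 0 < δ → δ < 1 → IsHeatPlayer δ (p δ)) :
    Tendsto (fun δ : ℝ => √(2 * δ) * ⨆ a : Adversary 2, regret δ ((p δ).toPlayer 0) a)
      (𝓝[>] 0) (𝓝 1) :=
  tendsto_of_heatLower_of_heatUpper (200 * (2 * √2)) (200 * √2)
    (fun _ hδ hδ1 => (heatLower_two_sub_le_regret hδ hδ1 _).trans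
      (le_ciSup (bddAbove_regret hδ hδ1 _) (heatAdversary 2)))
    fun δ hδ hδ1 => ciSup_le ((hp δ hδ hδ1).regret_two_le hδ hδ1)

theorem tendsto_minimax_regret :
    Tendsto (fun δ : ℝ => √(2 * δ) * ⨅ p : Player 2, ⨆ a : Adversary 2, regret δ p a)
      (𝓝[>] 0) (𝓝 1) := by
  refine tendsto_of_heatLower_of_heatUpper (200 * (2 * √2)) (200 * √2)
    (fun δ hδ hδ1 => le_ciInf fun p => (heatLower_two_sub_le_regret hδ hδ1 p).trans
      (le_ciSup (bddAbove_regret hδ hδ1 p) (heatAdversary 2))) fun δ hδ hδ1 => ?_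
  obtain ⟨p, hp, -⟩ := existsUnique_isHeatPlayer (N := 2) hδ hδ1
  exact (ciInf_le (bddBelow_iSup_regret hδ hδ1) (p.toPlayer 0)).trans
    (ciSup_le (hp.regret_two_le hδ hδ1))

end

end Experts

theorem mainTheorem5 :
    -- one absolute constant `C` for all orders of magnitude
    (∃ C : ℝ, 0 < C ∧ ∀ N : ℕ, 1 ≤ N →
      -- `K₃ = O(κ⁻¹ √N)` and `K₄ = O(κ^{-3/2} N √N)`
      (∀ κ : ℝ, 0 < κ → ∃ K, Experts.ThirdBound N κ K ∧ K ≤ C * κ⁻¹ * √N) ∧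
      (∀ κ : ℝ, 0 < κ → ∃ K, Experts.FourthBound N κ K ∧ K ≤ C * κ ^ (-3 / 2 : ℝ) * (N * √N)) ∧
      ∀ δ : ℝ, 0 < δ → δ < 1 →
        -- lower bound: the error term
        (∃ E, Experts.IsLowerErr N δ E ∧
          E ≤ C * min (N * √N) (√N * (1 + Real.log (1 / δ)))) ∧
        -- lower bound: the value function of `a^h`, and the regret of any player against `a^h`
        (∀ x : Fin N → ℝ, BddBelow (Set.range fun p : Experts.Player N =>
          Experts.regretFrom δ p (Experts.heatAdversary N) x)) ∧
        (∀ E, Experts.IsLowerErr N δ E →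
          (∀ x : Fin N → ℝ,
            Experts.heatLower δ x - E ≤ Experts.adversaryValue δ (Experts.heatAdversary N) x ∧
            Experts.heatLower δ x - E ≤
              δ * (⨆ i, x i) +
                (1 - δ) * Experts.adversaryValue δ (Experts.heatAdversary N) x) ∧
          ∀ p : Experts.Player N,
            √(2 * Experts.kappaS N δ) * Experts.gaussMax N *
                (Real.exp δ * (√Real.pi / 2) * Experts.erfc √δ) - E
              ≤ Experts.regret δ p (Experts.heatAdversary N)) ∧
        -- upper bound: the error term
        (∃ E, Experts.IsUpperErr N δ E ∧ E + 2 ≤ C * (√N * (1 + Real.log (1 / δ)))) ∧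
        -- upper bound: the heat player is well defined
        (∃! p : Experts.MarkovPlayer N, Experts.IsHeatPlayer δ p) ∧
        -- upper bound: the value function of `p^h`, and its regret against any adversary
        (∀ p : Experts.MarkovPlayer N, Experts.IsHeatPlayer δ p →
          (∀ x : Fin N → ℝ, BddAbove (Set.range fun a : Experts.Adversary N =>
            Experts.regretFrom δ (p.toPlayer x) a x)) ∧
          ∀ E, Experts.IsUpperErr N δ E →
            (∀ x : Fin N → ℝ,
              Experts.playerValue δ p x ≤ Experts.heatUpper δ x + (E + 2) ∧
              δ * (⨆ i, x i) + (1 - δ) * Experts.playerValue δ p x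
                ≤ Experts.heatUpper δ x + E) ∧
            ∀ a : Experts.Adversary N,
              Experts.regret δ (p.toPlayer 0) a
                ≤ √(2 * (1 - δ) / δ) * Experts.gaussMax N *
                    (Real.exp δ * (√Real.pi / 2) * Experts.erfc √δ + 2 * √δ) + (E + 2) ∧
              (1 - δ) * Experts.regret δ (p.toPlayer 0) a
                ≤ √(2 * (1 - δ) / δ) * Experts.gaussMax N *
                    (Real.exp δ * (√Real.pi / 2) * Experts.erfc √δ + 2 * √δ) + E)) ∧
    -- the lower bound is of order `√(log N / δ)` as `δ → 0`
    (∃ c : ℝ, 0 < c ∧ ∀ N : ℕ, 1 ≤ N → ∀ᶠ δ in 𝓝[>] (0 : ℝ), ∀ p : Experts.Player N,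
      c * √(Real.log N / δ) ≤ Experts.regret δ p (Experts.heatAdversary N)) ∧
    -- asymptotic optimality for `N = 2`: potentials at the origin, the guarantees of both
    -- strategies, and the minimax regret are all asymptotic to `1 / √(2δ)`
    Tendsto (fun δ : ℝ => √(2 * δ) * Experts.heatLower δ (0 : Fin 2 → ℝ)) (𝓝[>] 0) (𝓝 1) ∧
    Tendsto (fun δ : ℝ => √(2 * δ) * Experts.heatUpper δ (0 : Fin 2 → ℝ)) (𝓝[>] 0) (𝓝 1) ∧
    Tendsto (fun δ : ℝ => √(2 * δ) * ⨅ p : Experts.Player 2,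
      Experts.regret δ p (Experts.heatAdversary 2)) (𝓝[>] 0) (𝓝 1) ∧
    (∀ p : ℝ → Experts.MarkovPlayer 2,
      (∀ δ : ℝ, 0 < δ → δ < 1 → Experts.IsHeatPlayer δ (p δ)) →
      Tendsto (fun δ : ℝ => √(2 * δ) * ⨆ a : Experts.Adversary 2,
        Experts.regret δ ((p δ).toPlayer 0) a) (𝓝[>] 0) (𝓝 1)) ∧
    Tendsto (fun δ : ℝ => √(2 * δ) * ⨅ p : Experts.Player 2, ⨆ a : Experts.Adversary 2,
      Experts.regret δ p a) (𝓝[>] 0) (𝓝 1) := by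
  refine ⟨⟨200, by norm_num, fun N hN => ?_⟩,
    ⟨1 / 160, by norm_num, fun N hN => Experts.eventually_sqrt_log_le_regret hN⟩,
    Experts.tendsto_heatLower_two, Experts.tendsto_heatUpper_two,
    Experts.tendsto_iInf_regret_heatAdversary,
    fun p hp => Experts.tendsto_iSup_regret_heatPlayer hp, Experts.tendsto_minimax_regret⟩
  have : NeZero N := ⟨by omega⟩
  refine ⟨fun κ hκ => ⟨_, Experts.thirdBound_sqrt hκ, le_rfl⟩,
    fun κ hκ => ⟨_, Experts.fourthBound_mul_sqrt hκ, ?_⟩, fun δ hδ hδ1 => ?_⟩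
  · gcongr
    norm_num
  refine ⟨Experts.exists_isLowerErr_le hδ hδ1, Experts.bddBelow_regretFrom hδ hδ1,
    fun E hE => ⟨fun x => ⟨Experts.heatLower_sub_le_adversaryValue hδ hδ1 hE x,
      Experts.heatLower_sub_le_adversaryValue_delayed hδ hδ1 hE x⟩, fun p => ?_⟩,
    Experts.exists_isUpperErr_le hδ hδ1, Experts.existsUnique_isHeatPlayer hδ hδ1,
    fun p hp => ⟨fun x => Experts.bddAbove_regretFrom hδ hδ1 (p.toPlayer x) x,
      fun E hE => ⟨fun x => ⟨hp.playerValue_le hδ hδ1 hE x,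
        hp.delayed_playerValue_le hδ hδ1 hE x⟩, fun a => ?_⟩⟩⟩
  · rw [← Experts.heatLower_zero hδ hδ1]
    exact Experts.heatLower_zero_sub_le_regret hδ hδ1 hE p
  · rw [← Experts.heatUpper_zero hδ hδ1]
    exact hp.regret_le hδ hδ1 hE a
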